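/- **Theorem 2.1 (Density of the local times).** Let $\Lambda$ be a finite or countably infinite set with at least two elements, and let $A=(A_{x,y})_{x,y\in\Lambda}$ be the conservative generator of a continuous-time Markov chain $(X_t)_{t\ge 0}$ on $\Lambda$; that is, $A_{x,y}\ge 0$ for $x\ne y$, $\sum_{y}A_{x,y}=0$ for every $x$, and $X$ is a time-homogeneous Markov chain with values in $\Lambda$ and almost surely right-continuous paths (for the discrete topology) whose transition probabilities $p_t(x,y)$ satisfy $\sum_y p_t(x,y)=1$ and $\lim_{h\downarrow 0}(p_h(x,y)-\delta_{x,y})/h=A_{x,y}$ for all $x,y\in\Lambda$. Let $\mathbb P_a$, $\mathbb E_a$ refer to the chain started at $X_0=a$, and let $$\ell_T(x)=\int_0^T \mathbb 1_{\{X_s=x\}}\,ds\quad(x\in\Lambda),\qquad R_T=\{X_s: s\in[0,T]\}.$$ For a finite set $R\subseteq\Lambda$ and $T>0$ let $\mathcal M_T^+(R)=\{l:R\to(0,\infty)\mid \sum_{x\in R}l_x=T\}$, and let $\sigma_T$ be the surface measure on $\mathcal M_T^+(R)$ determined by the disintegration $\int_{(0,\infty)^R}F(l)\,d^Rl=\int_0^\infty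 dT\int_{\mathcal M_T^+(R)}\sigma_T(dl)\,F(l)$; explicitly, for any $c\in R$, $\sigma_T$ is Lebesgue measure in the coordinates $(l_x)_{x\in R\setminus\{c\}}$, where $l_c=T-\sum_{x\ne c}l_x$. For $a,b\in R$ and an $R\times R$ matrix $M$ with commuting entries let $\det_{ab}^{(R)}(M)$ be the $(b,a)$ cofactor of $M$, that is, the determinant of the matrix $(\mathbb 1_{x\ne b}M_{x,y}\mathbb 1_{y\ne a}+\mathbb 1_{x=b,\,y=a})_{x,y\in R}$, and let $\partial_l$ be the diagonal matrix with entries $\partial_{l_x}$, so that $\det_{ab}^{(R)}(-A+\partial_l)$ (formed with the $R\times R$ submatrix of $A$) is a linear differential operator with constant coefficients. Fix a finite set $R\subseteq\Lambda$ and sites $a,b\in R$. Then the function $$g(l)=\int_{[0,2\pi]^R}\exp\Big(\sum_{x,y\in R}A_{x,y}\sqrt{l_x}\sqrt{l_y}\,e^{i(\theta_x-\theta_y)}\Big)\prod_{x\in R}\frac{d\theta_x}{2\pi}$$ is infinitely differentiable on $(0,\infty)^R$; and, with $$\rho_{ab}^{(R)}(l)=\det\nolimits_{ab}^{(R)}(-A+\partial_l)\,g(l),\qquad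 l\in(0,\infty)^R,$$ for every $T>0$ the function $\rho_{ab}^{(R)}$ is $\sigma_T$-integrable on $\mathcal M_T^+(R)$, and for every bounded measurable function $F:\mathcal M_T^+(R)\to\mathbb R$, $$\mathbb E_a\big[F\big((\ell_T(x))_{x\in R}\big)\,\mathbb 1_{\{X_T=b\}}\,\mathbb 1_{\{R_T=R\}}\big]=\int_{\mathcal M_T^+(R)}F(l)\,\rho_{ab}^{(R)}(l)\,\sigma_T(dl).$$ -/

import Mathlib

open MeasureTheory Filter Topology
open scoped NNReal ENNReal

noncomputable section

namespace LocalTimeDensity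

/-! ### Continuous-time Markov chains on a countable state space -/

/-- A conservative Q-matrix: nonnegative off-diagonal entries, every row sums to zero. -/
structure IsConservative {Λ : Type*} (A : Λ → Λ → ℝ) : Prop where
  offDiag_nonneg : ∀ x y, x ≠ y → 0 ≤ A x y
  row_sum : ∀ x, HasSum (A x) 0

/-- `p t x y` is an (honest) transition function on the discrete state space `Λ`. -/
structure IsTransitionFunction {Λ : Type*} (p : ℝ≥0 → Λ → Λ → ℝ) : Prop where
  nonneg : ∀ t x y, 0 ≤ p t x y
  row_sum : ∀ t x, HasSum (p t x) 1
  zero_self : ∀ x, p 0 x x = 1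
  zero_ne : ∀ x y, x ≠ y → p 0 x y = 0
  chapman_kolmogorov : ∀ s t x y, HasSum (fun z => p s x z * p t z y) (p (s + t) x y)

/-- `A` is the generator (Q-matrix) of the transition function `p`: the entrywise right derivative
of `p` at time `0` is `A`. -/
def HasGenerator {Λ : Type*} (p : ℝ≥0 → Λ → Λ → ℝ) (A : Λ → Λ → ℝ) : Prop :=
  ∀ x y, Tendsto (fun h : ℝ≥0 => (p h x y - p 0 x y) / (h : ℝ)) (𝓝[>] 0) (𝓝 (A x y))

/-- Under `P`, the process `X` is a time-homogeneous Markov chain with transition function `p`,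
started at `a`, with almost surely right-continuous paths (for the discrete topology of `Λ`). The
Markov property is expressed by the finite-dimensional distributions. -/
structure IsMarkovChainFrom {Λ Ω : Type*} [MeasurableSpace Ω] (p : ℝ≥0 → Λ → Λ → ℝ) (a : Λ)
    (P : Measure Ω) (X : ℝ≥0 → Ω → Λ) : Prop where
  measurable : ∀ t x, MeasurableSet {ω | X t ω = x}
  right_continuous : ∀ᵐ ω ∂P, ∀ t, ∀ᶠ s in 𝓝[≥] t, X s ω = X t ω
  finite_dim : ∀ (n : ℕ) (t : ℕ → ℝ≥0) (x : ℕ → Λ), Monotone t → t 0 = 0 → x 0 = a →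
    P.real {ω | ∀ i ≤ n, X (t i) ω = x i} =
      ∏ i ∈ Finset.range n, p (t (i + 1) - t i) (x i) (x (i + 1))

/-- The local time `ℓ_T(x) = ∫₀ᵀ 1{X_s = x} ds`. -/
def localTime {Λ Ω : Type*} (X : ℝ≥0 → Ω → Λ) (T : ℝ≥0) (ω : Ω) (x : Λ) : ℝ :=
  ∫ s in (0 : ℝ)..T, Set.indicator {s : ℝ | X s.toNNReal ω = x} (fun _ => (1 : ℝ)) s

/-- The range `R_T = {X_s : s ∈ [0, T]}`. -/
def chainRange {Λ Ω : Type*} (X : ℝ≥0 → Ω → Λ) (T : ℝ≥0) (ω : Ω) : Set Λ :=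
  (fun s => X s ω) '' Set.Icc 0 T

/-! ### The simplex and its surface measure -/

section Simplex

variable {ι : Type*} [Fintype ι]

/-- The open positive orthant `(0, ∞)^ι`. -/
def orthant (ι : Type*) : Set (ι → ℝ) := {l | ∀ x, 0 < l x}

/-- The open simplex of all `l : ι → (0, ∞)` with `∑ x, l x = T`. -/
def simplex (ι : Type*) [Fintype ι] (T : ℝ) : Set (ι → ℝ) :=
  {l | (∀ x, 0 < l x) ∧ ∑ x, l x = T}

lemma measurableSet_orthant : MeasurableSet (orthant ι) := by
  unfold orthant
  measurability

lemma measurableSet_simplex (T : ℝ) : MeasurableSet (simplex ι T) := by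
  have h : simplex ι T = orthant ι ∩ {l | ∑ x, l x = T} := by ext; rfl
  rw [h]
  exact measurableSet_orthant.inter (measurableSet_eq_fun (by fun_prop) measurable_const)

variable [DecidableEq ι]

/-- The parametrization of the hyperplane `∑ x, l x = T` by all coordinates except the one at
`c`. -/
def hyperplaneChart (c : ι) (T : ℝ) (u : {x : ι // x ≠ c} → ℝ) : ι → ℝ :=
  fun x => if h : x = c then T - ∑ y, u y else u ⟨x, h⟩

/-- The surface measure `σ_T` on the simplex: Lebesgue measure in all the coordinates except the
one at `c`. It is the one that disintegrates Lebesgue measure on the orthant, see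
`lintegral_orthant`, whatever `c` is. -/
def surfaceMeasure (c : ι) (T : ℝ) : Measure (ι → ℝ) :=
  ((volume : Measure ({x : ι // x ≠ c} → ℝ)).map (hyperplaneChart c T)).restrict (simplex ι T)

lemma measurable_hyperplaneChart (c : ι) :
    Measurable (fun q : ℝ × ({x : ι // x ≠ c} → ℝ) => hyperplaneChart c q.1 q.2) := by
  refine measurable_pi_lambda _ fun x => ?_
  unfold hyperplaneChart
  by_cases h : x = c
  · simp only [h, dite_true]; fun_prop
  · simp only [h, dite_false]; fun_prop

lemma sum_hyperplaneChart (c : ι) (T : ℝ) (u : {x : ι // x ≠ c} → ℝ) :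
    ∑ x, hyperplaneChart c T u x = T := by
  rw [← Fintype.sum_subtype_add_sum_subtype (fun x => x ≠ c) (hyperplaneChart c T u)]
  have h1 : ∑ i : {x : ι // x ≠ c}, hyperplaneChart c T u i = ∑ i, u i :=
    Finset.sum_congr rfl fun i _ => by simp [hyperplaneChart, i.2]
  have h2 : ∀ i : {x : ι // ¬ x ≠ c}, hyperplaneChart c T u i = T - ∑ y, u y := fun i => by
    simp [hyperplaneChart, not_not.1 i.2]
  have h3 : ∑ i : {x : ι // ¬ x ≠ c}, hyperplaneChart c T u i = T - ∑ y, u y := by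
    rw [Finset.sum_congr rfl fun i _ => h2 i, Finset.sum_const, Finset.card_univ,
      Fintype.card_eq_one_iff.2 ⟨⟨c, by simp⟩, fun i => Subtype.ext (not_not.1 i.2)⟩, one_smul]
  rw [h1, h3]
  ring

/-- Disintegration of Lebesgue measure on `(0, ∞)^ι` into the surface measures. -/
lemma lintegral_orthant (c : ι) (F : (ι → ℝ) → ℝ≥0∞) (hF : Measurable F) :
    ∫⁻ l in orthant ι, F l = ∫⁻ T in Set.Ioi (0 : ℝ), ∫⁻ l, F l ∂(surfaceMeasure c T) := by
  set G : (ι → ℝ) → ℝ≥0∞ := (orthant ι).indicator F with hG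
  have hGm : Measurable G := hF.indicator measurableSet_orthant
  have hch : ∀ T : ℝ, Measurable (hyperplaneChart c T) := fun T =>
    (measurable_hyperplaneChart c).comp (measurable_const.prodMk measurable_id)
  have inner : ∀ T : ℝ, ∫⁻ l, F l ∂(surfaceMeasure c T) = ∫⁻ u, G (hyperplaneChart c T u) := by
    intro T
    unfold surfaceMeasure
    rw [← lintegral_indicator (measurableSet_simplex T),
      lintegral_map (hF.indicator (measurableSet_simplex T)) (hch T)]
    refine lintegral_congr fun u => ?_
    have hs := sum_hyperplaneChart c T u
    simp only [hG, Set.indicator, simplex, orthant, Set.mem_ofPred_eq, hs, and_true]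
    congr
  simp only [inner]
  rw [← lintegral_indicator measurableSet_orthant, ← lintegral_indicator measurableSet_Ioi]
  have hout : ∀ T : ℝ, (Set.Ioi (0 : ℝ)).indicator
      (fun T => ∫⁻ u, G (hyperplaneChart c T u)) T = ∫⁻ u, G (hyperplaneChart c T u) := by
    intro T
    by_cases hT : 0 < T
    · simp [Set.indicator, hT]
    · have : ∀ u, G (hyperplaneChart c T u) = 0 := by
        intro u
        refine Set.indicator_of_notMem (fun hmem => hT ?_) _
        rw [← sum_hyperplaneChart c T u]
        exact Finset.sum_pos (fun x _ => hmem x) ⟨c, Finset.mem_univ c⟩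
      simp [this]
  simp only [hout]
  rw [lintegral_lintegral_swap (f := fun T u => G (hyperplaneChart c T u))
    (hGm.comp (measurable_hyperplaneChart c)).aemeasurable]
  have htr : ∀ u : {x : ι // x ≠ c} → ℝ, ∫⁻ T : ℝ, G (hyperplaneChart c T u) =
      ∫⁻ t : ℝ, G (hyperplaneChart c (t + ∑ y, u y) u) := fun u =>
    (lintegral_add_right_eq_self (fun T => G (hyperplaneChart c T u)) _).symm
  simp only [htr]
  have e1 := (volume_preserving_piEquivPiSubtypeProd (fun _ : ι => ℝ) (fun x => x ≠ c)).symm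
  rw [← e1.lintegral_comp hGm, Measure.volume_eq_prod, lintegral_prod (fun q => G _)
    (hGm.comp e1.measurable).aemeasurable]
  refine lintegral_congr fun u => ?_
  let uq : Unique {x : ι // ¬ x ≠ c} :=
    ⟨⟨⟨c, by simp⟩⟩, fun i => Subtype.ext (not_not.1 i.2)⟩
  have e2 : ∀ inst : Fintype {x : ι // ¬ x ≠ c},
      MeasurePreserving (MeasurableEquiv.funUnique {x : ι // ¬ x ≠ c} ℝ).symm volume
        (@volume _ (@MeasureSpace.pi {x : ι // ¬ x ≠ c} inst (fun _ => ℝ) _)) := by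
    intro inst
    obtain rfl := Subsingleton.elim inst Unique.fintype
    exact (volume_preserving_funUnique {x : ι // ¬ x ≠ c} ℝ).symm
  rw [← (e2 _).lintegral_comp (f := fun w => G ((MeasurableEquiv.piEquivPiSubtypeProd
    (fun _ : ι => ℝ) (fun x => x ≠ c)).symm (u, w)))
    (hGm.comp (e1.measurable.comp (measurable_const.prodMk measurable_id)))]
  refine lintegral_congr fun t => congrArg G ?_
  funext x
  by_cases h : x = c
  · simp [hyperplaneChart, MeasurableEquiv.piEquivPiSubtypeProd,
      Equiv.piEquivPiSubtypeProd, h]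
  · simp [hyperplaneChart, MeasurableEquiv.piEquivPiSubtypeProd,
      Equiv.piEquivPiSubtypeProd, h]

end Simplex

/-! ### The differential operator and the density -/

section Density

variable {ι : Type*}

/-- The partial derivative `∂f/∂l_x`. -/
def partialDeriv [DecidableEq ι] (x : ι) (f : (ι → ℝ) → ℂ) : (ι → ℝ) → ℂ :=
  fun l => deriv (fun t : ℝ => f (Function.update l x t)) (l x)

/-- The mixed partial derivative `∂^s f` of multi-index `s`. (The partial derivatives are taken
in some order; for smooth `f` the order is immaterial.) -/
def mixedDeriv [DecidableEq ι] (s : ι →₀ ℕ) (f : (ι → ℝ) → ℂ) : (ι → ℝ) → ℂ :=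
  s.toMultiset.toList.foldr partialDeriv f

/-- The constant-coefficient differential operator `Q(∂_l)`, applied to `f`: the indeterminate
`X x` of the polynomial `Q` stands for the partial derivative with respect to `l_x`. -/
def diffOp [DecidableEq ι] (Q : MvPolynomial ι ℂ) (f : (ι → ℝ) → ℂ) : (ι → ℝ) → ℂ :=
  fun l => ∑ s ∈ Q.support, Q.coeff s * mixedDeriv s f l

/-- The `(b, a)` cofactor `det_{ab} M`, the determinant of the matrix with entries
`1{x ≠ b} M x y 1{y ≠ a} + 1{x = b, y = a}`. -/
def cofactor [Fintype ι] [DecidableEq ι] {S : Type*} [CommRing S] (a b : ι)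
    (M : Matrix ι ι S) : S :=
  Matrix.det (Matrix.of fun x y =>
    (if x ≠ b ∧ y ≠ a then M x y else 0) + (if x = b ∧ y = a then 1 else 0))

/-- `det_{ab}(-A + ∂_l)` as a polynomial in the partial derivatives. -/
def cofactorSymbol [Fintype ι] [DecidableEq ι] (A : ι → ι → ℝ) (a b : ι) : MvPolynomial ι ℂ :=
  cofactor a b
    ((Matrix.of fun x y => MvPolynomial.C (-(A x y : ℂ))) + Matrix.diagonal MvPolynomial.X)

/-- `∫_{[0, 2π]^ι} exp(∑_{x,y} A_{xy} √l_x √l_y e^{i(θ_x - θ_y)}) ∏_x dθ_x / (2π)`. -/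
def torusIntegral [Fintype ι] (A : ι → ι → ℝ) (l : ι → ℝ) : ℂ :=
  ∫ θ in Set.univ.pi (fun _ : ι => Set.Icc (0 : ℝ) (2 * Real.pi)),
    Complex.exp (∑ x, ∑ y, (A x y : ℂ) * (√(l x) : ℂ) * (√(l y) : ℂ) *
      Complex.exp (Complex.I * ((θ x : ℂ) - (θ y : ℂ)))) * ∏ _x : ι, (1 / (2 * (Real.pi : ℂ)))

/-- The density `ρ_{ab}(l) = det_{ab}(-A + ∂_l) ∫ exp(...)`. -/
def density [Fintype ι] [DecidableEq ι] (A : ι → ι → ℝ) (a b : ι) : (ι → ℝ) → ℂ :=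
  diffOp (cofactorSymbol A a b) (torusIntegral A)

end Density

end LocalTimeDensity

end

open LocalTimeDensity

/-! Both sides are integrals of `F` against finite, possibly complex measures, so it suffices to
compare Fourier transforms in `l` (`integral_eq_of_character`). A factor `exp (-∑ v_x l_x)` amounts
on either side to replacing `A` by `A - diag v`. For the chain this is the Feynman–Kac formula. For
the density it holds because the squared modulus of `√l_x e^{iθ_x}` is the constant `l_x`: the tilt
leaves the torus integral, and commuting it past the operator turns `∂_x` into `∂_x - v_x`, which
cancels the change of `A` inside the cofactor (`expTransform_densityFunctional_sub_diagonal`). With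
`v = -iξ` only total masses remain to be compared, but for complex matrices.

Probabilistic mass: the chain that stays in `S ⊆ R` and ends in `b` has weight `(exp (T A_S))_{ab}`,
where `A_S` is the principal submatrix. Inclusion–exclusion over `S` selects the paths whose range
is exactly `R`, so the mass is the power series in `T` with coefficients `coveringPow A N a b / N!`
(`IsMarkovChainFrom.hasSum_coveringPow`).

Analytic mass: orthogonality on the torus gives `g(l) = ∑_n M_n l^n / n!`, where `M_n` is the
coefficient of `φ^n` in `∏_x (Aφ)_x^{n_x}`. Thus `g(l) = Φ(exp (∑ l_x X_x))` for the linear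
functional `Φ(X^n) = M_n`, differentiation is multiplication by `X` under `Φ`, and the density is
`Φ(det_{ab}(-A + X) exp (∑ l_x X_x))`. Integration over the simplex cancels the multinomial
coefficients against Dirichlet integrals and leaves, in each degree, the plain sum of the moments
`Φ(X^n det_{ab}(-A + X))`.

MacMahon's master theorem, `∑ M_n t^n = 1 / det(1 - diag(t) A)`, identifies such a moment with the
coefficient of `t^{n + (1,…,1)}` in the `(a, b)` entry of `(1 - diag(t) A)⁻¹ diag(t)`, the
generating series of paths by numbers of visits (`monomialFunctional_cofactorPoly`). The shift by
`(1,…,1)` says that every site is visited, so the sum over a degree is again `coveringPow`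
(`sum_monomialFunctional_cofactorPoly`). The two series agree term by term. -/

namespace LocalTimeDensity

set_option linter.unusedSectionVars false

/-! ### MacMahon's master theorem, by differentiation of formal power series. -/

section MacMahon

variable {ι : Type*} [Fintype ι] [DecidableEq ι] {K : Type*} [Field K]

/-- The linear form `∑ y, A x y φ_y` attached to the row `x` of `A`. -/
noncomputable def linearForm (A : Matrix ι ι K) (x : ι) : MvPolynomial ι K :=
  ∑ y, MvPolynomial.C (A x y) * MvPolynomial.X y

/-- The product `∏ x, (A φ)_x ^ n x`. -/
noncomputable def linearFormPow (A : Matrix ι ι K) (n : ι →₀ ℕ) : MvPolynomial ι K :=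
  ∏ x, linearForm A x ^ n x

/-- The coefficient of `φ ^ n` in `∏ x, (A φ)_x ^ n x`. -/
noncomputable def macMahonCoeff (A : Matrix ι ι K) (n : ι →₀ ℕ) : K :=
  MvPolynomial.coeff n (linearFormPow A n)

/-- The generating series of `macMahonCoeff`. -/
noncomputable def macMahonSeries (A : Matrix ι ι K) : MvPowerSeries ι K :=
  fun n => macMahonCoeff A n

/-- The diagonal matrix of the indeterminates. -/
noncomputable def diagX (ι : Type*) [DecidableEq ι] (K : Type*) [Field K] :
    Matrix ι ι (MvPowerSeries ι K) :=
  Matrix.diagonal MvPowerSeries.X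

/-- The matrix `1 - diag(t) A` over power series. -/
noncomputable def resolventMatrix (A : Matrix ι ι K) : Matrix ι ι (MvPowerSeries ι K) :=
  1 - diagX ι K * A.map MvPowerSeries.C

/-- The derivative of `macMahonSeries` with respect to the entry `A y z`. -/
noncomputable def entryDeriv (A : Matrix ι ι K) : Matrix ι ι (MvPowerSeries ι K) :=
  Matrix.of fun y z n =>
    (n y : K) * MvPolynomial.coeff n (MvPolynomial.X z * linearFormPow A (n - Finsupp.single y 1))

lemma linearFormPow_add_single (A : Matrix ι ι K) (n : ι →₀ ℕ) (x : ι) :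
    linearFormPow A (n + Finsupp.single x 1) = linearForm A x * linearFormPow A n := by
  have : ∀ z, linearForm A z ^ (n + Finsupp.single x 1 : ι →₀ ℕ) z =
      (if z = x then linearForm A z else 1) * linearForm A z ^ n z := by
    intro z
    by_cases h : z = x
    · subst h; simp [pow_succ, mul_comm]
    · simp [h]
  simp only [linearFormPow, this, Finset.prod_mul_distrib]
  simp

lemma sum_entryDeriv_coeff (A : Matrix ι ι K) (x y : ι) (n : ι →₀ ℕ) :
    ∑ z, A x z * MvPowerSeries.coeff n (entryDeriv A y z) =
      (n y : K) * MvPolynomial.coeff n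
        (linearForm A x * linearFormPow A (n - Finsupp.single y 1)) := by
  have h : ∀ z, MvPowerSeries.coeff n (entryDeriv A y z) = (n y : K) * MvPolynomial.coeff n
      (MvPolynomial.X z * linearFormPow A (n - Finsupp.single y 1)) := fun z => rfl
  simp only [h, linearForm, Finset.sum_mul, MvPolynomial.coeff_sum, Finset.mul_sum]
  refine Finset.sum_congr rfl fun z _ => ?_
  rw [mul_assoc, MvPolynomial.coeff_C_mul]
  ring

/-- Euler's identity for homogeneity in row `y` of `A`: the form of row `y` restores the factor that
`entryDeriv` removed. If `n y = 0` the truncated subtraction removes nothing, but the prefactor `n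
y` vanishes. -/
lemma sum_entryDeriv_coeff_self (A : Matrix ι ι K) (y : ι) (n : ι →₀ ℕ) :
    ∑ z, A y z * MvPowerSeries.coeff n (entryDeriv A y z) = (n y : K) * macMahonCoeff A n := by
  rw [sum_entryDeriv_coeff]
  by_cases h : n y = 0
  · simp [h]
  · rw [← linearFormPow_add_single, tsub_add_cancel_of_le]
    · rfl
    · simpa using Nat.one_le_iff_ne_zero.2 h

lemma coeff_X_mul_eq (s : ι) (f : MvPowerSeries ι K) (n : ι →₀ ℕ) :
    MvPowerSeries.coeff (n + Finsupp.single s 1) (MvPowerSeries.X s * f) =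
      MvPowerSeries.coeff n f := by
  rw [add_comm, MvPowerSeries.X_def, MvPowerSeries.coeff_add_monomial_mul, one_mul]

lemma coeff_X_mul_eq_zero (s : ι) (f : MvPowerSeries ι K) (n : ι →₀ ℕ) (h : n s = 0) :
    MvPowerSeries.coeff n (MvPowerSeries.X s * f) = 0 := by
  rw [MvPowerSeries.X_def, MvPowerSeries.coeff_monomial_mul, if_neg]
  simp [h]

/-- Write the exponent as `m + e_z`. Off the diagonal, the two terms of the `(z, y)` entry have the
same prefactor `m y` and the same polynomial, so they cancel. On the diagonal the prefactors are `m
z + 1` and `m z`, so one copy of `macMahonCoeff A m` survives. Exponents that do not contain `z`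
contribute nothing. -/
lemma resolventMatrix_mul_entryDeriv (A : Matrix ι ι K) :
    resolventMatrix A * (entryDeriv A).transpose = macMahonSeries A • diagX ι K := by
  ext z y n
  have hsum : ∀ m, MvPowerSeries.coeff m
      (∑ x, MvPowerSeries.C (A z x) * entryDeriv A y x) =
      ∑ x, A z x * MvPowerSeries.coeff m (entryDeriv A y x) := by
    intro m; simp
  have e1 : (resolventMatrix A * (entryDeriv A).transpose) z y =
      entryDeriv A y z - MvPowerSeries.X z * ∑ x, MvPowerSeries.C (A z x) * entryDeriv A y x := by
    rw [resolventMatrix, sub_mul, one_mul, Matrix.sub_apply, Matrix.mul_assoc, diagX,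
      Matrix.diagonal_mul, Matrix.mul_apply]
    simp [Matrix.transpose_apply]
  have e2 : (macMahonSeries A • diagX ι K) z y =
      if z = y then MvPowerSeries.X z * macMahonSeries A else 0 := by
    simp only [diagX, Matrix.smul_apply, Matrix.diagonal_apply, smul_eq_mul]
    split_ifs <;> simp [mul_comm]
  rw [e1, e2, map_sub]
  have e3 : ∀ m, MvPowerSeries.coeff m (entryDeriv A y z) = (m y : K) * MvPolynomial.coeff m
      (MvPolynomial.X z * linearFormPow A (m - Finsupp.single y 1)) := fun z => rfl
  by_cases hz : n z = 0
  · rw [coeff_X_mul_eq_zero _ _ _ hz, e3, MvPolynomial.coeff_X_mul', if_neg (by simp [hz])]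
    split_ifs
    · rw [coeff_X_mul_eq_zero _ _ _ hz]; simp
    · simp
  · obtain ⟨m, rfl⟩ : ∃ m, n = m + Finsupp.single z 1 :=
      ⟨n - Finsupp.single z 1, by
        rw [tsub_add_cancel_of_le]; simpa using Nat.one_le_iff_ne_zero.2 hz⟩
    rw [coeff_X_mul_eq, hsum, sum_entryDeriv_coeff, e3, add_comm m, MvPolynomial.coeff_X_mul]
    by_cases hzy : z = y
    · subst hzy
      rw [if_pos rfl, add_comm _ m, coeff_X_mul_eq, add_tsub_cancel_right]
      by_cases hm : m z = 0
      · simp [hm]; rfl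
      · have := linearFormPow_add_single A (m - Finsupp.single z 1) z
        rw [tsub_add_cancel_of_le (by simpa using Nat.one_le_iff_ne_zero.2 hm)] at this
        rw [← this]
        simp only [Finsupp.add_apply, Finsupp.single_eq_same]
        push_cast
        change _ = MvPolynomial.coeff m (linearFormPow A m)
        ring
    · rw [if_neg hzy]
      have h1 : (Finsupp.single z 1 + m : ι →₀ ℕ) y = m y := by simp [Ne.symm hzy]
      rw [h1]
      by_cases hm : m y = 0
      · simp [hm]
      · obtain ⟨k, rfl⟩ : ∃ k, m = k + Finsupp.single y 1 :=
          ⟨m - Finsupp.single y 1, by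
            rw [tsub_add_cancel_of_le]; simpa using Nat.one_le_iff_ne_zero.2 hm⟩
        rw [← add_assoc, add_tsub_cancel_right, add_tsub_cancel_right, add_comm _ k,
          linearFormPow_add_single, map_zero, sub_self]

/-- Jacobi's formula, rowwise, for a derivation. -/
lemma derivation_det {R S : Type*} [CommRing R] [CommRing S] [Algebra R S]
    (D : Derivation R S S) (M : Matrix ι ι S) :
    D M.det = ∑ i, (M.updateRow i fun j => D (M i j)).det := by
  have hprod : ∀ (s : Finset ι) (f : ι → S),
      D (∏ i ∈ s, f i) = ∑ i ∈ s, ∏ j ∈ s, if j = i then D (f j) else f j := by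
    intro s f
    induction s using Finset.induction_on with
    | empty => simp
    | insert a s ha ih =>
      rw [Finset.prod_insert ha, Derivation.leibniz, ih, Finset.sum_insert ha,
        Finset.prod_insert ha, if_pos rfl, smul_eq_mul, smul_eq_mul, Finset.mul_sum, add_comm]
      congr 1
      · rw [mul_comm]
        congr 1
        refine Finset.prod_congr rfl fun j hj => ?_
        rw [if_neg (by rintro rfl; exact ha hj)]
      · refine Finset.sum_congr rfl fun i hi => ?_
        rw [Finset.prod_insert ha, if_neg (by rintro rfl; exact ha hi)]
  rw [← Matrix.det_transpose, Matrix.det_apply]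
  simp only [Matrix.transpose_apply]
  rw [map_sum]
  simp_rw [← Matrix.det_transpose (Matrix.updateRow _ _ _), Matrix.det_apply]
  rw [Finset.sum_comm]
  refine Finset.sum_congr rfl fun σ _ => ?_
  have : ∀ (u : ℤˣ) (s : S), D (u • s) = u • D s := by
    intro u s
    rcases Int.units_eq_one_or u with rfl | rfl <;> simp
  rw [this, hprod, Finset.smul_sum]
  refine Finset.sum_congr rfl fun i _ => ?_
  congr 1
  refine Finset.prod_congr rfl fun j _ => ?_
  simp only [Matrix.transpose_apply, Matrix.updateRow_apply]
  split_ifs with h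
  · rw [h]
  · rfl

/-- The Euler derivation `∑ i, t_i ∂_i` on power series. -/
noncomputable def eulerDerivation (ι : Type*) [Fintype ι] (K : Type*) [Field K] :
    Derivation K (MvPowerSeries ι K) (MvPowerSeries ι K) :=
  ∑ i, (MvPowerSeries.X i : MvPowerSeries ι K) • MvPowerSeries.pderiv K i

lemma coeff_eulerDerivation (f : MvPowerSeries ι K) (n : ι →₀ ℕ) :
    MvPowerSeries.coeff n (eulerDerivation ι K f) = (∑ i, (n i : K)) * MvPowerSeries.coeff n f := by
  have : eulerDerivation ι K f = ∑ i, MvPowerSeries.X i * MvPowerSeries.pderiv K i f := by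
    rw [eulerDerivation, ← Derivation.coeFnAddMonoidHom_apply, map_sum, Finset.sum_apply]
    rfl
  rw [this, map_sum, Finset.sum_mul]
  refine Finset.sum_congr rfl fun i _ => ?_
  by_cases hi : n i = 0
  · rw [coeff_X_mul_eq_zero _ _ _ hi, hi]; simp
  · obtain ⟨m, rfl⟩ : ∃ m, n = m + Finsupp.single i 1 :=
      ⟨n - Finsupp.single i 1, by
        rw [tsub_add_cancel_of_le]; simpa using Nat.one_le_iff_ne_zero.2 hi⟩
    rw [coeff_X_mul_eq, MvPowerSeries.coeff_pderiv]
    simp [mul_comm]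

lemma eulerDerivation_X (i : ι) : eulerDerivation ι K (MvPowerSeries.X i) = MvPowerSeries.X i := by
  ext n
  rw [coeff_eulerDerivation, MvPowerSeries.coeff_X]
  split_ifs with h
  · subst h; simp [Finsupp.single_apply]
  · simp

/-- The total degree `∑ n_y` is distributed over the rows, and each `n_y` is produced by homogeneity
in row `y`. -/
lemma eulerDerivation_macMahonSeries (A : Matrix ι ι K) :
    eulerDerivation ι K (macMahonSeries A) =
      (A.map MvPowerSeries.C * (entryDeriv A).transpose).trace := by
  ext n
  rw [coeff_eulerDerivation, Matrix.trace, map_sum, Finset.sum_mul]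
  refine Finset.sum_congr rfl fun y _ => ?_
  rw [Matrix.diag_apply, Matrix.mul_apply, map_sum]
  simp only [Matrix.map_apply, Matrix.transpose_apply, MvPowerSeries.coeff_C_mul]
  rw [sum_entryDeriv_coeff_self]
  rfl

/-- Jacobi's formula, with the fact that `diag(t) A` is homogeneous of degree one in `t` and hence
fixed by the Euler derivation. -/
lemma eulerDerivation_det_resolventMatrix (A : Matrix ι ι K) :
    eulerDerivation ι K (resolventMatrix A).det =
      -((diagX ι K * A.map MvPowerSeries.C) * (resolventMatrix A).adjugate).trace := by
  have hD : ∀ i j, eulerDerivation ι K (resolventMatrix A i j) =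
      -(diagX ι K * A.map MvPowerSeries.C : Matrix ι ι (MvPowerSeries ι K)) i j := by
    intro i j
    rw [resolventMatrix, Matrix.sub_apply, map_sub, diagX, Matrix.diagonal_mul, Derivation.leibniz,
      eulerDerivation_X, Matrix.one_apply]
    have h1 : eulerDerivation ι K (if i = j then 1 else 0) = 0 := by split_ifs <;> simp
    have h2 : eulerDerivation ι K ((A.map MvPowerSeries.C) i j) = 0 := by
      ext n
      rw [coeff_eulerDerivation, Matrix.map_apply, MvPowerSeries.coeff_C]
      split_ifs with h
      · simp [h]
      · simp
    rw [h1, h2]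
    simp [mul_comm]
  rw [derivation_det, Matrix.trace, ← Finset.sum_neg_distrib]
  refine Finset.sum_congr rfl fun i _ => ?_
  rw [Matrix.diag_apply, Matrix.mul_apply, ← Finset.sum_neg_distrib]
  simp only [hD]
  rw [Matrix.det_eq_sum_mul_adjugate_row _ i]
  refine Finset.sum_congr rfl fun j _ => ?_
  rw [Matrix.updateRow_self, Matrix.adjugate_apply, Matrix.adjugate_apply, Matrix.updateRow_idem,
    neg_mul]

/-- MacMahon's master theorem. -/
theorem det_resolventMatrix_mul_macMahonSeries [CharZero K] (A : Matrix ι ι K) :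
    (resolventMatrix A).det * macMahonSeries A = 1 := by
  have hadj : (resolventMatrix A).det • (entryDeriv A).transpose =
      macMahonSeries A • ((resolventMatrix A).adjugate * diagX ι K) := by
    have := congrArg ((resolventMatrix A).adjugate * ·) (resolventMatrix_mul_entryDeriv A)
    simpa [← Matrix.mul_assoc, Matrix.adjugate_mul] using this
  -- The product rule yields two traces. `hadj` gives both the factor `macMahonSeries A`, and
  -- cyclicity of the trace makes them opposite.
  have hzero : eulerDerivation ι K ((resolventMatrix A).det * macMahonSeries A) = 0 := by
    rw [Derivation.leibniz, eulerDerivation_macMahonSeries, eulerDerivation_det_resolventMatrix,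
      smul_eq_mul, smul_eq_mul, ← smul_eq_mul, ← Matrix.trace_smul, ← Matrix.mul_smul, hadj,
      Matrix.mul_smul, Matrix.trace_smul, smul_eq_mul, ← mul_add,
      Matrix.mul_assoc, Matrix.trace_mul_comm (diagX ι K), Matrix.mul_assoc, add_neg_cancel,
      mul_zero]
  ext n
  by_cases hn : n = 0
  · subst hn
    have hL : MvPowerSeries.constantCoeff (macMahonSeries A) = 1 := by
      change MvPolynomial.coeff 0 (linearFormPow A 0) = 1
      simp [linearFormPow]
    have hdet : MvPowerSeries.constantCoeff (resolventMatrix A).det = 1 := by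
      rw [RingHom.map_det]
      convert Matrix.det_one (n := ι) (R := K)
      ext i j
      simp [resolventMatrix, diagX, Matrix.one_apply, apply_ite]
    rw [MvPowerSeries.coeff_zero_eq_constantCoeff_apply, map_mul, hL, hdet]
    simp
  · have := congrArg (MvPowerSeries.coeff n) hzero
    rw [coeff_eulerDerivation, map_zero, mul_eq_zero] at this
    rw [MvPowerSeries.coeff_one, if_neg hn]
    -- The Euler derivation multiplies a coefficient by its total degree, which is nonzero in
    -- characteristic zero unless the exponent is `0`. Hence the product is its constant term.
    refine this.resolve_left fun h => hn ?_
    have h' : ∑ i, n i = 0 := by exact_mod_cast h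
    ext i
    simpa using (Finset.sum_eq_zero_iff.1 h') i (Finset.mem_univ i)

end MacMahon

/-! ### From cofactors to path counting and inclusion–exclusion. -/

section Resolvent

variable {ι : Type*} [Fintype ι] [DecidableEq ι] {K : Type*} [Field K]

/-- The linear functional on polynomials that takes the monomial `X ^ n` to `c n`. -/
noncomputable def monomialFunctional (c : (ι →₀ ℕ) → K) : MvPolynomial ι K →ₗ[K] K :=
  (MvPolynomial.basisMonomials ι K).constr K c

lemma monomialFunctional_monomial (c : (ι →₀ ℕ) → K) (n : ι →₀ ℕ) (r : K) :
    monomialFunctional c (MvPolynomial.monomial n r) = r * c n := by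
  have h : (MvPolynomial.monomial n r : MvPolynomial ι K) = r • MvPolynomial.monomial n 1 := by
    rw [MvPolynomial.smul_monomial, smul_eq_mul, mul_one]
  have h1 : monomialFunctional c (MvPolynomial.monomial n 1) = c n := by
    have := (MvPolynomial.basisMonomials ι K).constr_basis K c n
    rwa [MvPolynomial.coe_basisMonomials] at this
  rw [h, map_smul, h1, smul_eq_mul]

lemma monomialFunctional_C_mul (c : (ι →₀ ℕ) → K) (r : K) (P : MvPolynomial ι K) :
    monomialFunctional c (MvPolynomial.C r * P) = r * monomialFunctional c P := by
  rw [← MvPolynomial.smul_eq_C_mul, map_smul, smul_eq_mul]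

/-- A factor `α + β X_x` combines the coefficients of `f` at `n` and at `n + e_x`. Multiplication of
the series by `α t_x + β` does the same when read at `n + e_x`. Each factor therefore exchanges
constant and linear terms at the cost of one unit in the exponent. -/
lemma monomialFunctional_prod (f : MvPowerSeries ι K) (α β : ι → K) (s : Finset ι) (n : ι →₀ ℕ) :
    monomialFunctional (fun m => MvPowerSeries.coeff m f) (MvPolynomial.monomial n 1 *
      ∏ x ∈ s, (MvPolynomial.C (α x) + MvPolynomial.C (β x) * MvPolynomial.X x)) =
    MvPowerSeries.coeff (n + ∑ x ∈ s, Finsupp.single x 1)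
      ((∏ x ∈ s, (MvPowerSeries.C (α x) * MvPowerSeries.X x + MvPowerSeries.C (β x))) * f) := by
  induction s using Finset.induction_on generalizing n with
  | empty => simp [monomialFunctional_monomial]
  | insert a s ha ih =>
    rw [Finset.prod_insert ha, Finset.prod_insert ha, Finset.sum_insert ha]
    have e1 : MvPolynomial.monomial n (1 : K) *
        ((MvPolynomial.C (α a) + MvPolynomial.C (β a) * MvPolynomial.X a) *
          ∏ x ∈ s, (MvPolynomial.C (α x) + MvPolynomial.C (β x) * MvPolynomial.X x)) =
        MvPolynomial.C (α a) * (MvPolynomial.monomial n 1 *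
          ∏ x ∈ s, (MvPolynomial.C (α x) + MvPolynomial.C (β x) * MvPolynomial.X x)) +
        MvPolynomial.C (β a) * (MvPolynomial.monomial (n + Finsupp.single a 1) 1 *
          ∏ x ∈ s, (MvPolynomial.C (α x) + MvPolynomial.C (β x) * MvPolynomial.X x)) := by
      rw [← one_mul (1 : K), ← MvPolynomial.monomial_mul, ← MvPolynomial.X]
      simp only [one_mul]
      ring
    rw [e1, map_add, monomialFunctional_C_mul, monomialFunctional_C_mul, ih, ih, mul_assoc,
      add_mul, map_add, mul_assoc, MvPowerSeries.coeff_C_mul, MvPowerSeries.coeff_C_mul,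
      add_left_comm n, add_comm (Finsupp.single a 1), coeff_X_mul_eq,
      add_right_comm n (Finsupp.single a 1)]

/-- Row `x` involves only the variable of `x`, so each permutation contributes a product with one
linear factor per variable, as in `monomialFunctional_prod`. The transposes make the permutation act
on columns. -/
lemma monomialFunctional_det (f : MvPowerSeries ι K) (α β : Matrix ι ι K) (n : ι →₀ ℕ) :
    monomialFunctional (fun m => MvPowerSeries.coeff m f) (MvPolynomial.monomial n 1 *
      (Matrix.of fun x y =>
        MvPolynomial.C (α x y) + MvPolynomial.C (β x y) * MvPolynomial.X x).det) =
    MvPowerSeries.coeff (n + ∑ x, Finsupp.single x 1)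
      ((Matrix.of fun x y =>
        MvPowerSeries.C (α x y) * MvPowerSeries.X x + MvPowerSeries.C (β x y)).det * f) := by
  rw [← Matrix.det_transpose, Matrix.det_apply, ← Matrix.det_transpose, Matrix.det_apply,
    Finset.mul_sum, Finset.sum_mul, map_sum, map_sum]
  refine Finset.sum_congr rfl fun σ _ => ?_
  have := monomialFunctional_prod f (fun x => α x (σ x)) (fun x => β x (σ x)) Finset.univ n
  simp only [Matrix.transpose_apply, Matrix.of_apply]
  rcases Int.units_eq_one_or (Equiv.Perm.sign σ) with h | h
  · rw [h, one_smul, one_smul, this]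
  · rw [h, Units.neg_smul, Units.neg_smul, one_smul, one_smul, mul_neg, map_neg, neg_mul, map_neg,
      this]

/-- The cofactor `det_{ab}(-A + X)` as a polynomial. -/
noncomputable def cofactorPoly (A : Matrix ι ι K) (a b : ι) : MvPolynomial ι K :=
  cofactor a b ((Matrix.of fun x y => MvPolynomial.C (-(A x y))) +
    Matrix.diagonal MvPolynomial.X)

/-- Row `b` is the unit vector `e_a`; its multiples clear column `a` in the other rows without
changing the determinant. -/
lemma cofactor_eq_det_updateRow {S : Type*} [CommRing S] (a b : ι) (M : Matrix ι ι S) :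
    cofactor a b M = (M.updateRow b (Pi.single a 1)).det := by
  unfold cofactor
  symm
  refine Matrix.det_eq_of_forall_row_eq_smul_add_const (fun x => if x = b then 0 else M x a) b
    (by simp) ?_
  intro x y
  by_cases hx : x = b
  · subst hx
    simp [Pi.single_apply]
  · by_cases hy : y = a <;> simp [hx, hy]

/-- The solution `W` of `W = diag(t) + diag(t) A W`, the generating series of the paths weighted
by `A`, by the number of visits to each site. -/
noncomputable def pathSeries (A : Matrix ι ι K) : Matrix ι ι (MvPowerSeries ι K) :=
  macMahonSeries A • ((resolventMatrix A).adjugate * diagX ι K)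

lemma pathSeries_eq [CharZero K] (A : Matrix ι ι K) :
    pathSeries A = diagX ι K + diagX ι K * A.map MvPowerSeries.C * pathSeries A := by
  have h : resolventMatrix A * pathSeries A = diagX ι K := by
    rw [pathSeries, Matrix.mul_smul, ← Matrix.mul_assoc, Matrix.mul_adjugate, Matrix.smul_mul,
      one_mul, smul_smul, mul_comm, det_resolventMatrix_mul_macMahonSeries, one_smul]
  rw [resolventMatrix, sub_mul, one_mul, sub_eq_iff_eq_add] at h
  exact h

/-- The exchange of constant and linear terms turns `-A + X` into `1 - diag(t) A`, and the row `e_a`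
at `b` into `t_b e_a`. The resulting determinant is `t_b` times an entry of the adjugate of the
resolvent matrix. Multiplied by `macMahonSeries A`, the inverse of the determinant, it is an entry
of `pathSeries A`. -/
lemma monomialFunctional_cofactorPoly (A : Matrix ι ι K) (a b : ι) (n : ι →₀ ℕ) :
    monomialFunctional (macMahonCoeff A) (MvPolynomial.monomial n 1 * cofactorPoly A a b) =
      MvPowerSeries.coeff (n + ∑ x, Finsupp.single x 1) (pathSeries A a b) := by
  have h := monomialFunctional_det (macMahonSeries A)
    ((-A).updateRow b (Pi.single a 1)) ((1 : Matrix ι ι K).updateRow b 0) n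
  have e1 : cofactorPoly A a b = (Matrix.of fun x y =>
      MvPolynomial.C (((-A).updateRow b (Pi.single a 1)) x y) +
      MvPolynomial.C (((1 : Matrix ι ι K).updateRow b 0) x y) * MvPolynomial.X x).det := by
    rw [cofactorPoly, cofactor_eq_det_updateRow]
    congr 1
    ext1 x y
    by_cases hx : x = b
    · subst hx
      simp [Pi.single_apply, apply_ite]
    · simp only [Matrix.updateRow_ne hx, Matrix.add_apply, Matrix.of_apply, Matrix.neg_apply,
        Matrix.diagonal_apply, Matrix.one_apply]
      split_ifs <;> simp
  have e2 : (Matrix.of fun x y => MvPowerSeries.C (((-A).updateRow b (Pi.single a 1)) x y) *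
      MvPowerSeries.X x + MvPowerSeries.C (((1 : Matrix ι ι K).updateRow b 0) x y)) =
      (resolventMatrix A).updateRow b
        ((MvPowerSeries.X b : MvPowerSeries ι K) • (Pi.single a 1)) := by
    ext1 x y
    by_cases hx : x = b
    · subst hx
      by_cases hy : y = a <;> simp [hy]
    · simp only [Matrix.updateRow_ne hx, Matrix.of_apply, Matrix.neg_apply,
        Matrix.one_apply, resolventMatrix, Matrix.sub_apply, diagX, Matrix.diagonal_mul,
        Matrix.map_apply]
      split_ifs <;> simp <;> ring
  rw [e1]
  refine (h.trans ?_)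
  rw [e2, Matrix.det_updateRow_smul, ← Matrix.adjugate_apply, pathSeries, Matrix.smul_apply,
    diagX, Matrix.mul_diagonal, smul_eq_mul]
  congr 1
  ring

/-- The sum of the coefficients of degree `N` supported in `S`. -/
noncomputable def coeffSum (S : Finset ι) (N : ℕ) (f : MvPowerSeries ι K) : K :=
  ∑ k ∈ Finset.finsuppAntidiag S N, MvPowerSeries.coeff k f

lemma coeffSum_X_mul_of_mem {S : Finset ι} {x : ι} (hx : x ∈ S) (N : ℕ) (f : MvPowerSeries ι K) :
    coeffSum S (N + 1) (MvPowerSeries.X x * f) = coeffSum S N f := by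
  unfold coeffSum
  rw [← Finset.sum_filter_of_ne (p := fun k : ι →₀ ℕ => k x ≠ 0)]
  swap
  · intro k _ hk h0
    exact hk (coeff_X_mul_eq_zero _ _ _ h0)
  symm
  refine Finset.sum_bij' (fun k _ => k + Finsupp.single x 1) (fun k _ => k - Finsupp.single x 1)
    ?_ ?_ ?_ ?_ ?_
  · intro k hk
    rw [Finset.mem_finsuppAntidiag] at hk
    rw [Finset.mem_filter, Finset.mem_finsuppAntidiag]
    refine ⟨⟨?_, ?_⟩, by simp⟩
    · change ∑ y ∈ S, (k + Finsupp.single x 1 : ι →₀ ℕ) y = N + 1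
      have h1 : ∑ y ∈ S, k y = N := hk.1
      simp [Finset.sum_add_distrib, h1, Finsupp.single_apply, hx]
    · refine Finsupp.support_add.trans (Finset.union_subset hk.2 ?_)
      exact Finsupp.support_single_subset.trans (by simpa using hx)
  · intro k hk
    rw [Finset.mem_filter, Finset.mem_finsuppAntidiag] at hk
    rw [Finset.mem_finsuppAntidiag]
    have hle : Finsupp.single x 1 ≤ k := by simpa using Nat.one_le_iff_ne_zero.2 hk.2
    obtain ⟨m, rfl⟩ := exists_add_of_le hle
    rw [add_tsub_cancel_left]
    refine ⟨?_, ?_⟩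
    · have : ∑ y ∈ S, (Finsupp.single x 1 + m : ι →₀ ℕ) y = N + 1 := hk.1.1
      change ∑ y ∈ S, m y = N
      simp only [Finsupp.add_apply, Finset.sum_add_distrib, Finsupp.single_apply,
        Finset.sum_ite_eq, if_pos hx] at this
      omega
    · refine fun y hy => hk.1.2 ?_
      simp only [Finsupp.mem_support_iff, Finsupp.add_apply] at hy ⊢
      omega
  · intro k _; simp
  · intro k hk
    rw [Finset.mem_filter] at hk
    exact tsub_add_cancel_of_le (by simpa using Nat.one_le_iff_ne_zero.2 hk.2)
  · intro k _; rw [coeff_X_mul_eq]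

lemma coeffSum_X_mul_of_notMem {S : Finset ι} {x : ι} (hx : x ∉ S) (N : ℕ)
    (f : MvPowerSeries ι K) : coeffSum S N (MvPowerSeries.X x * f) = 0 := by
  refine Finset.sum_eq_zero fun k hk => coeff_X_mul_eq_zero _ _ _ ?_
  rw [Finset.mem_finsuppAntidiag] at hk
  by_contra h
  exact hx (hk.2 (by simpa using h))

lemma coeffSum_zero (S : Finset ι) (f : MvPowerSeries ι K) :
    coeffSum S 0 f = MvPowerSeries.constantCoeff f := by
  simp [coeffSum]

/-- The entry of the `N`-th power of the principal submatrix of `A` on `S`, zero outside `S`. -/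
noncomputable def restrictedPow (A : Matrix ι ι K) (S : Finset ι) (N : ℕ) (x b : ι) : K :=
  if h : x ∈ S ∧ b ∈ S then
    ((A.submatrix Subtype.val Subtype.val : Matrix S S K) ^ N) ⟨x, h.1⟩ ⟨b, h.2⟩
  else 0

lemma pathSeries_apply [CharZero K] (A : Matrix ι ι K) (x b : ι) :
    pathSeries A x b = MvPowerSeries.X x *
      ((if x = b then 1 else 0) + ∑ y, MvPowerSeries.C (A x y) * pathSeries A y b) := by
  conv_lhs => rw [pathSeries_eq]
  rw [Matrix.add_apply, Matrix.mul_assoc, diagX, Matrix.diagonal_mul, Matrix.diagonal_apply,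
    Matrix.mul_apply, mul_add]
  simp

/-- Setting `t_x = t` on `S` and `t_x = 0` elsewhere turns the path series into `t (1 - t A_S)⁻¹`,
whose coefficient of `t^{N+1}` is `A_S^N`: a path with `N` steps has `N + 1` points. The induction
peels off the first step. -/
lemma coeffSum_pathSeries [CharZero K] (A : Matrix ι ι K) (S : Finset ι) (N : ℕ) (x b : ι) :
    coeffSum S (N + 1) (pathSeries A x b) = restrictedPow A S N x b := by
  have hlin : ∀ M (x : ι), coeffSum S M
      ((if x = b then (1 : MvPowerSeries ι K) else 0) +
        ∑ y, MvPowerSeries.C (A x y) * pathSeries A y b) =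
      coeffSum S M (if x = b then (1 : MvPowerSeries ι K) else 0) +
      ∑ y, A x y * coeffSum S M (pathSeries A y b) := by
    intro M x
    simp only [coeffSum, map_add, map_sum, MvPowerSeries.coeff_C_mul, Finset.sum_add_distrib,
      Finset.mul_sum]
    rw [Finset.sum_comm]
  by_cases hx : x ∈ S
  · induction N generalizing x with
    | zero =>
      rw [pathSeries_apply, coeffSum_X_mul_of_mem hx, hlin]
      have h0 : ∀ y, coeffSum S 0 (pathSeries A y b) = 0 := by
        intro y
        rw [pathSeries_apply, coeffSum_zero, map_mul]
        simp
      simp only [h0, coeffSum_zero, restrictedPow, pow_zero]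
      by_cases hb : x = b
      · subst hb; simp [hx]
      · simp [hb]
    | succ N ih =>
      rw [pathSeries_apply, coeffSum_X_mul_of_mem hx, hlin]
      have h1 : coeffSum S (N + 1) (if x = b then (1 : MvPowerSeries ι K) else 0) = 0 := by
        refine Finset.sum_eq_zero fun k hk => ?_
        rw [Finset.mem_finsuppAntidiag] at hk
        have : k ≠ 0 := by rintro rfl; simp at hk
        split_ifs <;> simp [MvPowerSeries.coeff_one, this]
      have h2 : ∀ y, y ∉ S → coeffSum S (N + 1) (pathSeries A y b) = 0 := by
        intro y hy
        rw [pathSeries_apply, coeffSum_X_mul_of_notMem hy]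
      rw [h1, zero_add, ← Finset.sum_subset (Finset.subset_univ S)
        (fun y _ hy => by rw [h2 y hy, mul_zero]), Finset.sum_congr rfl fun y hy => by rw [ih y hy],
        ← Finset.sum_coe_sort]
      unfold restrictedPow
      by_cases hb : b ∈ S
      · simp [hx, hb, pow_succ', Matrix.mul_apply]
      · simp [hb]
  · rw [pathSeries_apply, coeffSum_X_mul_of_notMem hx, restrictedPow, dif_neg (by simp [hx])]

/-- Expand `∏_x (1 - 1{x ∉ U})` over the subsets of `ι`. -/
lemma sum_neg_one_pow_compl (U : Finset ι) :
    ∑ S : Finset ι, (-1 : K) ^ Sᶜ.card * (if U ⊆ S then 1 else 0) =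
      if U = Finset.univ then 1 else 0 := by
  have h := Finset.prod_add (fun _ : ι => (1 : K)) (fun x => -(if x ∈ U then 0 else 1)) Finset.univ
  have h1 : ∏ x : ι, ((1 : K) + -(if x ∈ U then 0 else 1)) = if U = Finset.univ then 1 else 0 := by
    split_ifs with hU
    · simp [hU]
    · obtain ⟨x, hx⟩ : ∃ x, x ∉ U := by
        by_contra! hc
        exact hU (Finset.eq_univ_iff_forall.2 hc)
      exact Finset.prod_eq_zero (Finset.mem_univ x) (by simp [hx])
  rw [← h1, h, Finset.powerset_univ]
  refine Finset.sum_congr rfl fun S _ => ?_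
  rw [Finset.prod_const_one, one_mul, ← Finset.compl_eq_univ_sdiff, Finset.prod_neg]
  congr 1
  split_ifs with hs
  · symm
    refine Finset.prod_eq_one fun x hx => if_neg fun hxU => ?_
    exact (Finset.mem_compl.1 hx) (hs hxU)
  · obtain ⟨x, hx, hxS⟩ := Finset.not_subset.1 hs
    exact (Finset.prod_eq_zero (Finset.mem_compl.2 hxS) (by simp [hx])).symm

/-- The alternating sum of `restrictedPow` over all subsets. -/
noncomputable def coveringPow (A : Matrix ι ι K) (N : ℕ) (a b : ι) : K :=
  ∑ S : Finset ι, (-1) ^ Sᶜ.card * restrictedPow A S N a b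

/-- A monomial counts for `S` when its support lies in `S`; the alternating sum retains only full
support. -/
lemma coveringPow_eq_sum [CharZero K] (A : Matrix ι ι K) (N : ℕ) (a b : ι) :
    coveringPow A N a b = ∑ k ∈ Finset.finsuppAntidiag Finset.univ (N + 1) with
      k.support = Finset.univ, MvPowerSeries.coeff k (pathSeries A a b) := by
  unfold coveringPow
  have h : ∀ S : Finset ι, restrictedPow A S N a b =
      ∑ k ∈ Finset.finsuppAntidiag (Finset.univ : Finset ι) (N + 1),
        (if k.support ⊆ S then 1 else 0) * MvPowerSeries.coeff k (pathSeries A a b) := by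
    intro S
    rw [← coeffSum_pathSeries, coeffSum]
    simp only [ite_mul, one_mul, zero_mul]
    rw [← Finset.sum_filter]
    refine Finset.sum_congr ?_ fun _ _ => rfl
    ext k
    simp only [Finset.mem_filter, Finset.mem_finsuppAntidiag, Finset.subset_univ, and_true]
    constructor
    · rintro ⟨h1, h2⟩
      refine ⟨?_, h2⟩
      rw [← h1]
      symm
      exact Finset.sum_subset (Finset.subset_univ S) fun x _ hx => by
        by_contra hc
        exact hx (h2 (by simpa using hc))
    · rintro ⟨h1, h2⟩
      refine ⟨?_, h2⟩
      rw [← h1]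
      exact Finset.sum_subset (Finset.subset_univ S) fun x _ hx => by
        by_contra hc
        exact hx (h2 (by simpa using hc))
  simp only [h, Finset.mul_sum]
  rw [Finset.sum_comm, Finset.sum_filter]
  refine Finset.sum_congr rfl fun k _ => ?_
  have := sum_neg_one_pow_compl (K := K) k.support
  simp only [← mul_assoc]
  rw [← Finset.sum_mul, this]
  split_ifs <;> simp

/-- A path with `N + 1` points cannot cover more than `N + 1` sites. -/
lemma coveringPow_eq_zero [CharZero K] (A : Matrix ι ι K) (N : ℕ) (a b : ι)
    (h : N + 1 < Fintype.card ι) : coveringPow A N a b = 0 := by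
  rw [coveringPow_eq_sum]
  refine Finset.sum_eq_zero fun k hk => ?_
  rw [Finset.mem_filter, Finset.mem_finsuppAntidiag] at hk
  exfalso
  have : Fintype.card ι ≤ ∑ x, k x := by
    rw [← Finset.card_univ, Finset.card_eq_sum_ones]
    refine Finset.sum_le_sum fun x _ => Nat.one_le_iff_ne_zero.2 ?_
    have : x ∈ k.support := hk.2 ▸ Finset.mem_univ x
    simpa using this
  have h2 : ∑ x, k x = N + 1 := hk.1.1
  omega

/-- Adding one to every exponent is a bijection from all exponents of degree `M` onto those of full
support in degree `M + card ι`. A path with that many points has one step fewer, whence the `- 1`.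
-/
lemma sum_monomialFunctional_cofactorPoly [CharZero K] (A : Matrix ι ι K) (M : ℕ) (a b : ι) :
    ∑ n ∈ Finset.finsuppAntidiag Finset.univ M,
      monomialFunctional (macMahonCoeff A) (MvPolynomial.monomial n 1 * cofactorPoly A a b) =
      coveringPow A (M + Fintype.card ι - 1) a b := by
  have hpos : 0 < Fintype.card ι := Fintype.card_pos_iff.2 ⟨a⟩
  have hone : ∀ x, (∑ y : ι, Finsupp.single y 1 : ι →₀ ℕ) x = 1 := by
    intro x; simp [Finsupp.finsetSum_apply, Finsupp.single_apply]
  rw [coveringPow_eq_sum, Nat.sub_add_cancel (by omega)]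
  simp only [monomialFunctional_cofactorPoly]
  refine Finset.sum_bij' (fun k _ => k + ∑ x, Finsupp.single x 1)
    (fun k _ => k - ∑ x, Finsupp.single x 1) ?_ ?_ ?_ ?_ ?_
  · intro k hk
    rw [Finset.mem_finsuppAntidiag] at hk
    rw [Finset.mem_filter, Finset.mem_finsuppAntidiag]
    refine ⟨⟨?_, Finset.subset_univ _⟩, ?_⟩
    · change ∑ y, (k + ∑ x, Finsupp.single x 1 : ι →₀ ℕ) y = _
      have h1 : ∑ y, k y = M := hk.1
      simp only [Finsupp.add_apply, Finset.sum_add_distrib, h1, hone]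
      simp
    · ext x
      simp
  · intro k hk
    rw [Finset.mem_filter, Finset.mem_finsuppAntidiag] at hk
    rw [Finset.mem_finsuppAntidiag]
    refine ⟨?_, Finset.subset_univ _⟩
    have h1 : ∀ x, 1 ≤ k x := fun x => by
      have : x ∈ k.support := hk.2 ▸ Finset.mem_univ x
      exact Nat.one_le_iff_ne_zero.2 (by simpa using this)
    have h2 : ∑ x, k x = ∑ x, (k - ∑ x, Finsupp.single x 1 : ι →₀ ℕ) x + Fintype.card ι := by
      rw [← Finset.card_univ, Finset.card_eq_sum_ones, ← Finset.sum_add_distrib]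
      refine Finset.sum_congr rfl fun x _ => ?_
      rw [Finsupp.tsub_apply, hone, Nat.sub_add_cancel (h1 x)]
    have h3 : ∑ x, k x = M + Fintype.card ι := hk.1.1
    change ∑ x, (k - ∑ x, Finsupp.single x 1 : ι →₀ ℕ) x = M
    omega
  · intro k _; simp
  · intro k hk
    rw [Finset.mem_filter] at hk
    refine tsub_add_cancel_of_le fun x => ?_
    rw [hone]
    have : x ∈ k.support := hk.2 ▸ Finset.mem_univ x
    exact Nat.one_le_iff_ne_zero.2 (by simpa using this)
  · intro k _; rfl

end Resolvent

/-! ### Exponential transforms of functionals on polynomials, and differential operators. -/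

section ExponentialTransform

variable {ι : Type*} [Fintype ι] [DecidableEq ι]

/-- The linear polynomial `∑ x, l x X_x`. -/
noncomputable def linPoly (l : ι → ℝ) : MvPolynomial ι ℂ :=
  ∑ x, MvPolynomial.C (l x : ℂ) * MvPolynomial.X x

/-- The functional `P ↦ φ (Q * P)`. -/
noncomputable def shiftFunctional (φ : MvPolynomial ι ℂ →ₗ[ℂ] ℂ) (Q : MvPolynomial ι ℂ) :
    MvPolynomial ι ℂ →ₗ[ℂ] ℂ :=
  φ.comp (LinearMap.mulLeft ℂ Q)

lemma shiftFunctional_apply (φ : MvPolynomial ι ℂ →ₗ[ℂ] ℂ) (Q P : MvPolynomial ι ℂ) :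
    shiftFunctional φ Q P = φ (Q * P) := rfl

lemma shiftFunctional_shiftFunctional (φ : MvPolynomial ι ℂ →ₗ[ℂ] ℂ) (Q P : MvPolynomial ι ℂ) :
    shiftFunctional (shiftFunctional φ Q) P = shiftFunctional φ (Q * P) := by
  refine LinearMap.ext fun R => ?_
  simp only [shiftFunctional_apply, mul_assoc]

/-- A functional on polynomials that grows at most geometrically on monomials. -/
def GeomBounded (φ : MvPolynomial ι ℂ →ₗ[ℂ] ℂ) : Prop :=
  ∃ K C : ℝ, 0 ≤ K ∧ 0 ≤ C ∧ ∀ n : ι →₀ ℕ, ‖φ (MvPolynomial.monomial n 1)‖ ≤ K * C ^ ∑ x, n x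

lemma GeomBounded.shift {φ : MvPolynomial ι ℂ →ₗ[ℂ] ℂ} (h : GeomBounded φ)
    (Q : MvPolynomial ι ℂ) : GeomBounded (shiftFunctional φ Q) := by
  induction Q using MvPolynomial.induction_on with
  | C a =>
    obtain ⟨K, C, hK, hC, hb⟩ := h
    refine ⟨‖a‖ * K, C, by positivity, hC, fun n => ?_⟩
    rw [shiftFunctional_apply, ← MvPolynomial.smul_eq_C_mul, map_smul, norm_smul, mul_assoc]
    gcongr
    exact hb n
  | add P Q hP hQ =>
    obtain ⟨K, C, hK, hC, hb⟩ := hP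
    obtain ⟨K', C', hK', hC', hb'⟩ := hQ
    refine ⟨K + K', max C C', by positivity, le_max_of_le_left hC, fun n => ?_⟩
    rw [shiftFunctional_apply, add_mul, map_add, add_mul]
    refine (norm_add_le _ _).trans (add_le_add ((hb n).trans ?_) ((hb' n).trans ?_))
    · gcongr; exact le_max_left _ _
    · gcongr; exact le_max_right _ _
  | mul_X P x hP =>
    obtain ⟨K, C, hK, hC, hb⟩ := hP
    refine ⟨K * C, C, by positivity, hC, fun n => ?_⟩
    have h1 : P * MvPolynomial.X x * MvPolynomial.monomial n 1 =
        P * MvPolynomial.monomial (Finsupp.single x 1 + n) 1 := by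
      rw [mul_assoc, MvPolynomial.X, MvPolynomial.monomial_mul, one_mul]
    rw [shiftFunctional_apply, h1]
    refine (hb _).trans (le_of_eq ?_)
    simp only [Finsupp.add_apply, Finset.sum_add_distrib, Finsupp.single_apply]
    simp [pow_add, mul_assoc]

lemma norm_functional_linPoly_pow_le {φ : MvPolynomial ι ℂ →ₗ[ℂ] ℂ} {K C : ℝ}
    (hb : ∀ n : ι →₀ ℕ, ‖φ (MvPolynomial.monomial n 1)‖ ≤ K * C ^ ∑ x, n x) (l : ι → ℝ)
    (N : ℕ) : ‖φ (linPoly l ^ N)‖ ≤ K * (C * ∑ x, |l x|) ^ N := by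
  -- A monomial prefactor is carried along, because expanding one factor `linPoly l` multiplies by
  -- some `X_x`.
  suffices H : ∀ m : ι →₀ ℕ, ‖φ (MvPolynomial.monomial m 1 * linPoly l ^ N)‖ ≤
      K * C ^ (∑ x, m x) * (C * ∑ x, |l x|) ^ N by
    simpa using H 0
  induction N with
  | zero => intro m; simpa using hb m
  | succ N ih =>
    intro m
    have e : MvPolynomial.monomial m 1 * linPoly l ^ (N + 1) = ∑ x, (l x : ℂ) •
        (MvPolynomial.monomial (m + Finsupp.single x 1) 1 * linPoly l ^ N) := by
      rw [pow_succ', ← mul_assoc]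
      nth_rewrite 1 [linPoly]
      rw [Finset.mul_sum, Finset.sum_mul]
      refine Finset.sum_congr rfl fun x _ => ?_
      rw [← MvPolynomial.smul_eq_C_mul, mul_smul_comm, MvPolynomial.X, MvPolynomial.monomial_mul,
        one_mul, smul_mul_assoc]
    rw [e, map_sum]
    refine (norm_sum_le _ _).trans ?_
    have : ∀ x, ‖φ ((l x : ℂ) • (MvPolynomial.monomial (m + Finsupp.single x 1) 1 *
        linPoly l ^ N))‖ ≤ |l x| * (K * C ^ (∑ x, m x + 1) * (C * ∑ x, |l x|) ^ N) := by
      intro x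
      rw [map_smul, norm_smul, Complex.norm_real, Real.norm_eq_abs]
      refine mul_le_mul_of_nonneg_left ((ih _).trans (le_of_eq ?_)) (abs_nonneg _)
      simp only [Finsupp.add_apply, Finset.sum_add_distrib, Finsupp.single_apply]
      simp
    refine (Finset.sum_le_sum fun x _ => this x).trans (le_of_eq ?_)
    rw [← Finset.sum_mul]
    ring

/-- The function `l ↦ φ (exp (∑ x, l x X_x))`. -/
noncomputable def expTransform (φ : MvPolynomial ι ℂ →ₗ[ℂ] ℂ) (l : ι → ℝ) : ℂ :=
  ∑' N : ℕ, φ (linPoly l ^ N) / (N.factorial : ℂ)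

lemma GeomBounded.summable_norm {φ : MvPolynomial ι ℂ →ₗ[ℂ] ℂ} (h : GeomBounded φ) (l : ι → ℝ) :
    Summable fun N : ℕ => ‖φ (linPoly l ^ N) / (N.factorial : ℂ)‖ := by
  obtain ⟨K, C, hK, hC, hb⟩ := h
  refine Summable.of_nonneg_of_le (fun _ => norm_nonneg _) (fun N => ?_)
    ((Real.summable_pow_div_factorial (C * ∑ x, |l x|)).mul_left K)
  rw [norm_div, Complex.norm_natCast, ← mul_div_assoc]
  gcongr
  exact norm_functional_linPoly_pow_le hb l N

lemma GeomBounded.hasSum {φ : MvPolynomial ι ℂ →ₗ[ℂ] ℂ} (h : GeomBounded φ) (l : ι → ℝ) :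
    HasSum (fun N : ℕ => φ (linPoly l ^ N) / (N.factorial : ℂ)) (expTransform φ l) :=
  (h.summable_norm l).of_norm.hasSum

lemma functional_linPoly_pow_succ (φ : MvPolynomial ι ℂ →ₗ[ℂ] ℂ) (l : ι → ℝ) (N : ℕ) :
    φ (linPoly l ^ (N + 1)) =
      ∑ x, (l x : ℂ) * shiftFunctional φ (MvPolynomial.X x) (linPoly l ^ N) := by
  rw [pow_succ']
  conv_lhs => rw [linPoly]
  rw [Finset.sum_mul, map_sum]
  refine Finset.sum_congr rfl fun x _ => ?_
  rw [mul_assoc, ← MvPolynomial.smul_eq_C_mul, map_smul, smul_eq_mul]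
  rfl

/-- No topology is placed on the polynomials, so the power is not differentiated there. One linear
factor at a time is expanded, its coefficients `l x` become scalars, and `X_x` is moved into the
functional; hence the induction is for all `φ` at once. -/
lemma hasFDerivAt_functional_linPoly_pow (φ : MvPolynomial ι ℂ →ₗ[ℂ] ℂ) (N : ℕ) (l : ι → ℝ) :
    HasFDerivAt (fun l : ι → ℝ => φ (linPoly l ^ (N + 1)))
      (∑ x, (ContinuousLinearMap.proj x : (ι → ℝ) →L[ℝ] ℝ).smulRight
        (((N + 1 : ℕ) : ℂ) * shiftFunctional φ (MvPolynomial.X x) (linPoly l ^ N))) l := by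
  have hproj : ∀ x : ι, HasFDerivAt (fun l : ι → ℝ => (l x : ℂ))
      ((ContinuousLinearMap.proj x : (ι → ℝ) →L[ℝ] ℝ).smulRight (1 : ℂ)) l := by
    intro x
    have := Complex.ofRealCLM.hasFDerivAt.comp l
      (ContinuousLinearMap.proj x : (ι → ℝ) →L[ℝ] ℝ).hasFDerivAt
    refine this.congr_fderiv ?_
    ext; simp
  induction N generalizing φ with
  | zero =>
    simp only [functional_linPoly_pow_succ, pow_zero]
    refine (HasFDerivAt.fun_sum fun x _ => (hproj x).mul_const _).congr_fderiv ?_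
    ext v
    simp [mul_comm]
  | succ N ih =>
    simp only [functional_linPoly_pow_succ φ _ (N + 1)]
    refine (HasFDerivAt.fun_sum fun x _ => (hproj x).mul
      (ih (shiftFunctional φ (MvPolynomial.X x)))).congr_fderiv ?_
    ext v
    simp only [sum_apply, add_apply,
      smul_apply, ContinuousLinearMap.smulRight_apply,
      ContinuousLinearMap.proj_apply, smul_eq_mul, Complex.real_smul]
    rw [Finset.sum_add_distrib]
    have h1 : ∑ x, (l x : ℂ) * ∑ y, (v y : ℂ) * (((N + 1 : ℕ) : ℂ) *
        shiftFunctional (shiftFunctional φ (MvPolynomial.X x)) (MvPolynomial.X y) (linPoly l ^ N)) =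
        ∑ y, (v y : ℂ) * (((N + 1 : ℕ) : ℂ) *
          shiftFunctional φ (MvPolynomial.X y) (linPoly l ^ (N + 1))) := by
      simp only [functional_linPoly_pow_succ, Finset.mul_sum]
      rw [Finset.sum_comm]
      refine Finset.sum_congr rfl fun y _ => Finset.sum_congr rfl fun x _ => ?_
      rw [shiftFunctional_shiftFunctional, shiftFunctional_shiftFunctional,
        mul_comm (MvPolynomial.X x)]
      ring
    rw [h1, ← Finset.sum_add_distrib]
    refine Finset.sum_congr rfl fun x _ => ?_
    push_cast
    ring

/-- Termwise differentiation. Its outcome, that `∂_x` acts as multiplication by `X_x` under the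
functional, reproduces the same class of functions and hence yields smoothness. -/
lemma GeomBounded.hasFDerivAt {φ : MvPolynomial ι ℂ →ₗ[ℂ] ℂ} (h : GeomBounded φ) (l : ι → ℝ) :
    HasFDerivAt (expTransform φ)
      (∑ x, (ContinuousLinearMap.proj x : (ι → ℝ) →L[ℝ] ℝ).smulRight
        (expTransform (shiftFunctional φ (MvPolynomial.X x)) l)) l := by
  -- The constant term is split off so that the derivative of the term indexed `N` in the new series
  -- is the `N`-th term of the shifted transforms.
  have hsplit : expTransform φ =
      fun l => φ 1 + ∑' N : ℕ, φ (linPoly l ^ (N + 1)) / ((N + 1).factorial : ℂ) := by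
    ext l
    rw [expTransform, (h.hasSum l).summable.tsum_eq_zero_add]
    simp
  have hderiv : ∀ (N : ℕ) (l : ι → ℝ), HasFDerivAt
      (fun l : ι → ℝ => φ (linPoly l ^ (N + 1)) / ((N + 1).factorial : ℂ))
      (∑ x, (ContinuousLinearMap.proj x : (ι → ℝ) →L[ℝ] ℝ).smulRight
        (shiftFunctional φ (MvPolynomial.X x) (linPoly l ^ N) / (N.factorial : ℂ))) l := by
    intro N l
    simp only [div_eq_mul_inv]
    refine ((hasFDerivAt_functional_linPoly_pow φ N l).mul_const _).congr_fderiv ?_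
    ext v
    simp only [sum_apply,
      smul_apply, ContinuousLinearMap.smulRight_apply,
      ContinuousLinearMap.proj_apply, smul_eq_mul, Complex.real_smul, Finset.mul_sum]
    refine Finset.sum_congr rfl fun x _ => ?_
    have h1 : ((N + 1 : ℕ) : ℂ) ≠ 0 := Nat.cast_ne_zero.2 N.succ_ne_zero
    have h2 : (N.factorial : ℂ) ≠ 0 := Nat.cast_ne_zero.2 N.factorial_ne_zero
    rw [Nat.factorial_succ, Nat.cast_mul]
    field_simp
  choose K C hK hC hb using fun x : ι => h.shift (MvPolynomial.X x)
  -- On the open `ℓ¹` ball of radius `r`, which contains `l` and is convex, the geometric bounds on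
  -- the derivatives are uniform.
  set r : ℝ := ∑ x, |l x| + 1 with hr
  have hs : IsOpen {l : ι → ℝ | ∑ x, |l x| < r} :=
    isOpen_lt (by fun_prop) continuous_const
  have hconv : Convex ℝ {l : ι → ℝ | ∑ x, |l x| < r} := by
    have : ConvexOn ℝ Set.univ fun l : ι → ℝ => ∑ x, |l x| := by
      refine ⟨convex_univ, fun u _ v _ a b ha hb _ => ?_⟩
      simp only [Pi.add_apply, Pi.smul_apply, smul_eq_mul, Finset.mul_sum]
      rw [← Finset.sum_add_distrib]
      refine Finset.sum_le_sum fun x _ => (abs_add_le _ _).trans ?_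
      rw [abs_mul, abs_mul, abs_of_nonneg ha, abs_of_nonneg hb]
    simpa using this.convex_lt r
  have hu : Summable fun N : ℕ => ∑ x, K x * ((C x * r) ^ N / N.factorial) :=
    summable_sum fun x _ => (Real.summable_pow_div_factorial (C x * r)).mul_left (K x)
  rw [hsplit]
  have hmem : l ∈ {l : ι → ℝ | ∑ x, |l x| < r} := by simp [hr]
  have hmain := hasFDerivAt_tsum_of_isPreconnected hu hs hconv.isPreconnected
    (fun N l _ => hderiv N l) ?_ hmem ((summable_nat_add_iff 1).2 (h.hasSum l).summable) hmem
  · refine (hmain.const_add (φ 1)).congr_fderiv ?_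
    refine HasSum.tsum_eq (hasSum_sum fun x _ => ?_)
    exact (((h.shift (MvPolynomial.X x)).hasSum l).mapL
      (ContinuousLinearMap.smulRightL ℝ (ι → ℝ) ℂ (ContinuousLinearMap.proj x)))
  · intro N l hl
    refine (norm_sum_le _ _).trans (Finset.sum_le_sum fun x _ => ?_)
    rw [ContinuousLinearMap.norm_smulRight_apply, norm_div, Complex.norm_natCast]
    have h1 : ‖(ContinuousLinearMap.proj x : (ι → ℝ) →L[ℝ] ℝ)‖ ≤ 1 :=
      ContinuousLinearMap.opNorm_le_bound _ zero_le_one fun v => by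
        simpa using norm_le_pi_norm v x
    refine (mul_le_of_le_one_left (by positivity) h1).trans ?_
    rw [← mul_div_assoc]
    gcongr
    refine (norm_functional_linPoly_pow_le (hb x) l N).trans ?_
    have hl' : ∑ x, |l x| < r := hl
    have := hK x
    have := hC x
    gcongr

lemma GeomBounded.contDiff_nat {φ : MvPolynomial ι ℂ →ₗ[ℂ] ℂ} (h : GeomBounded φ) (n : ℕ) :
    ContDiff ℝ n (expTransform φ) := by
  induction n generalizing φ with
  | zero =>
    exact contDiff_zero.2 (continuous_iff_continuousAt.2 fun l => (h.hasFDerivAt l).continuousAt)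
  | succ n ih =>
    have : ((n + 1 : ℕ) : WithTop ℕ∞) = (n : WithTop ℕ∞) + 1 := by push_cast; rfl
    rw [this, contDiff_succ_iff_hasFDerivAt]
    refine ⟨_, ?_, fun l => h.hasFDerivAt l⟩
    refine ContDiff.sum fun x _ => ?_
    exact (ContinuousLinearMap.smulRightL ℝ (ι → ℝ) ℂ
      (ContinuousLinearMap.proj x)).contDiff.comp (ih (h.shift (MvPolynomial.X x)))

lemma GeomBounded.contDiff {φ : MvPolynomial ι ℂ →ₗ[ℂ] ℂ} (h : GeomBounded φ) :
    ContDiff ℝ (⊤ : ℕ∞) (expTransform φ) :=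
  contDiff_infty.2 h.contDiff_nat

lemma GeomBounded.continuous {φ : MvPolynomial ι ℂ →ₗ[ℂ] ℂ} (h : GeomBounded φ) :
    Continuous (expTransform φ) := h.contDiff.continuous

/-- The exponential `exp (-∑ x, v x l x)`. -/
noncomputable def expTilt (v : ι → ℂ) (l : ι → ℝ) : ℂ :=
  Complex.exp (-∑ x, v x * (l x : ℂ))

/-- The torus integral is identified with an exponential transform only on the orthant, so
derivatives must be compared on open sets. -/
lemma partialDeriv_congr {f g : (ι → ℝ) → ℂ} {U : Set (ι → ℝ)} (hU : IsOpen U)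
    (h : Set.EqOn f g U) (x : ι) : Set.EqOn (partialDeriv x f) (partialDeriv x g) U := by
  intro l hl
  refine Filter.EventuallyEq.deriv_eq ?_
  have hc : ContinuousAt (fun t : ℝ => Function.update l x t) (l x) :=
    (continuous_const.update x continuous_id).continuousAt
  have : ∀ᶠ t in 𝓝 (l x), Function.update l x t ∈ U :=
    hc (by simpa using hU.mem_nhds hl)
  filter_upwards [this] with t ht using h ht

/-- Conjugation by the tilt turns `∂_x` into `∂_x - v_x`. -/
lemma partialDeriv_expTilt_mul {φ : MvPolynomial ι ℂ →ₗ[ℂ] ℂ} (h : GeomBounded φ) (v : ι → ℂ)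
    (x : ι) : partialDeriv x (fun l => expTilt v l * expTransform φ l) = fun l =>
      expTilt v l *
        expTransform (shiftFunctional φ (MvPolynomial.X x - MvPolynomial.C (v x))) l := by
  ext l
  have hupd : HasDerivAt (fun t : ℝ => Function.update l x t) (Pi.single x 1) (l x) :=
    hasDerivAt_update l x (l x)
  have h1 : HasDerivAt (fun t : ℝ => expTransform φ (Function.update l x t))
      (expTransform (shiftFunctional φ (MvPolynomial.X x)) l) (l x) := by
    have := (HasFDerivAt.comp_hasDerivAt (l x)
      (by simpa using h.hasFDerivAt l) hupd :
      HasDerivAt (expTransform φ ∘ fun t : ℝ => Function.update l x t) _ _)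
    refine this.congr_deriv ?_
    simp [Pi.single_apply]
  have h2 : HasDerivAt (fun t : ℝ => expTilt v (Function.update l x t))
      (expTilt v l * -(v x)) (l x) := by
    have e : HasDerivAt (fun t : ℝ => -∑ y, v y * ((Function.update l x t y : ℝ) : ℂ)) (-(v x))
        (l x) := by
      refine ((HasDerivAt.fun_sum fun y _ => (((hasDerivAt_pi.1 hupd) y).ofReal_comp.const_mul
        (v y))).neg).congr_deriv ?_
      simp [Pi.single_apply, apply_ite]
    have := e.cexp
    simpa [expTilt] using this
  have h3 := (h2.mul h1).deriv
  simp only [Function.update_eq_self] at h3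
  refine h3.trans ?_
  have h4 : expTransform (shiftFunctional φ (MvPolynomial.X x - MvPolynomial.C (v x))) l =
      expTransform (shiftFunctional φ (MvPolynomial.X x)) l - v x * expTransform φ l := by
    refine HasSum.tsum_eq ?_
    refine (((h.shift (MvPolynomial.X x)).hasSum l).sub
      ((h.hasSum l).mul_left (v x))).congr_fun fun N => ?_
    rw [shiftFunctional_apply, shiftFunctional_apply, sub_mul, map_sub,
      ← MvPolynomial.smul_eq_C_mul, map_smul, smul_eq_mul]
    ring
  rw [h4]
  ring

lemma foldr_partialDeriv_eqOn {φ : MvPolynomial ι ℂ →ₗ[ℂ] ℂ} (h : GeomBounded φ) (v : ι → ℂ)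
    {f : (ι → ℝ) → ℂ} {U : Set (ι → ℝ)} (hU : IsOpen U)
    (hf : Set.EqOn f (fun l => expTilt v l * expTransform φ l) U) (L : List ι) :
    Set.EqOn (L.foldr partialDeriv f) (fun l => expTilt v l * expTransform (shiftFunctional φ
      (L.map fun x => MvPolynomial.X x - MvPolynomial.C (v x)).prod) l) U := by
  induction L with
  | nil =>
    simpa [shiftFunctional] using hf
  | cons x L ih =>
    refine (partialDeriv_congr hU ih x).trans ?_
    rw [partialDeriv_expTilt_mul (h.shift _) v x, shiftFunctional_shiftFunctional, mul_comm]
    exact fun l _ => rfl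

lemma mixedDeriv_eqOn {φ : MvPolynomial ι ℂ →ₗ[ℂ] ℂ} (h : GeomBounded φ) (v : ι → ℂ)
    {f : (ι → ℝ) → ℂ} {U : Set (ι → ℝ)} (hU : IsOpen U)
    (hf : Set.EqOn f (fun l => expTilt v l * expTransform φ l) U) (s : ι →₀ ℕ) :
    Set.EqOn (mixedDeriv s f) (fun l => expTilt v l * expTransform (shiftFunctional φ
      (MvPolynomial.aeval (fun x => MvPolynomial.X x - MvPolynomial.C (v x))
        (MvPolynomial.monomial s (1 : ℂ)))) l) U := by
  have hprod : MvPolynomial.aeval (fun x => MvPolynomial.X x - MvPolynomial.C (v x))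
      (MvPolynomial.monomial s (1 : ℂ)) = (s.toMultiset.toList.map fun x =>
        (MvPolynomial.X x - MvPolynomial.C (v x) : MvPolynomial ι ℂ)).prod := by
    rw [MvPolynomial.aeval_monomial, map_one, one_mul, ← Multiset.prod_coe, ← Multiset.map_coe,
      Multiset.coe_toList, Finsupp.toMultiset_map, Finsupp.prod_toMultiset,
      Finsupp.prod_mapDomain_index]
    · simp
    · intros; rw [pow_add]
  rw [hprod]
  exact foldr_partialDeriv_eqOn h v hU hf s.toMultiset.toList

/-- Iterating the one-variable rule replaces each `X_x` by `X_x - v_x` in the symbol. The shifted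
symbols multiply in a commutative ring, so the order of derivatives in `mixedDeriv` does not matter.
-/
lemma diffOp_eqOn {φ : MvPolynomial ι ℂ →ₗ[ℂ] ℂ} (h : GeomBounded φ) (v : ι → ℂ)
    {f : (ι → ℝ) → ℂ} {U : Set (ι → ℝ)} (hU : IsOpen U)
    (hf : Set.EqOn f (fun l => expTilt v l * expTransform φ l) U) (Q : MvPolynomial ι ℂ) :
    Set.EqOn (diffOp Q f) (fun l => expTilt v l * expTransform (shiftFunctional φ
      (MvPolynomial.aeval (fun x => MvPolynomial.X x - MvPolynomial.C (v x)) Q)) l) U := by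
  intro l hl
  unfold diffOp
  rw [Finset.sum_congr rfl fun s _ => by rw [mixedDeriv_eqOn h v hU hf s hl]]
  simp only [mul_left_comm _ (expTilt v l)]
  rw [← Finset.mul_sum]
  congr 1
  symm
  refine HasSum.tsum_eq ?_
  refine (hasSum_sum fun s (_ : s ∈ Q.support) => ((h.shift (MvPolynomial.aeval
    (fun x => MvPolynomial.X x - MvPolynomial.C (v x))
    (MvPolynomial.monomial s (1 : ℂ)))).hasSum l).mul_left (Q.coeff s)).congr_fun fun N => ?_
  conv_lhs => rw [Q.as_sum, map_sum]
  rw [shiftFunctional_apply, Finset.sum_mul, map_sum, Finset.sum_div]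
  refine Finset.sum_congr rfl fun s _ => ?_
  have : (MvPolynomial.monomial s (MvPolynomial.coeff s Q) : MvPolynomial ι ℂ) =
      MvPolynomial.coeff s Q • MvPolynomial.monomial s (1 : ℂ) := by
    rw [MvPolynomial.smul_monomial, smul_eq_mul, mul_one]
  rw [this, map_smul, smul_mul_assoc, map_smul, smul_eq_mul, mul_div_assoc, shiftFunctional_apply]

end ExponentialTransform

/-! ### The torus integral as an exponential transform, and the effect of a diagonal change of `A`.
-/

section Torus

variable {ι : Type*} [Fintype ι] [DecidableEq ι]

/-- The mean over the torus `[0, 2π] ^ ι`. -/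
noncomputable def torusMean (f : (ι → ℝ) → ℂ) : ℂ :=
  ∫ θ in Set.univ.pi (fun _ : ι => Set.Icc (0 : ℝ) (2 * Real.pi)),
    f θ * ∏ _x : ι, (1 / (2 * (Real.pi : ℂ)))

lemma torusMean_prod (h : ι → ℝ → ℂ) :
    torusMean (fun θ => ∏ x, h x (θ x)) =
      ∏ x, ∫ t in (0 : ℝ)..(2 * Real.pi), h x t * (1 / (2 * (Real.pi : ℂ))) := by
  unfold torusMean
  simp only [← Finset.prod_mul_distrib]
  rw [volume_pi, Measure.restrict_pi_pi,
    integral_fintype_prod_eq_prod (fun x t => h x t * (1 / (2 * (Real.pi : ℂ))))]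
  refine Finset.prod_congr rfl fun x _ => ?_
  rw [intervalIntegral.integral_of_le (by positivity), integral_Icc_eq_integral_Ioc]

lemma isCompact_torus : IsCompact (Set.univ.pi (fun _ : ι => Set.Icc (0 : ℝ) (2 * Real.pi))) :=
  isCompact_univ_pi fun _ => isCompact_Icc

lemma torusMean_sum {α : Type*} (s : Finset α) (c : α → ℂ) (f : α → (ι → ℝ) → ℂ)
    (hf : ∀ i, Continuous (f i)) :
    torusMean (fun θ => ∑ i ∈ s, c i * f i θ) = ∑ i ∈ s, c i * torusMean (f i) := by
  unfold torusMean
  simp only [Finset.sum_mul]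
  rw [integral_finsetSum]
  · refine Finset.sum_congr rfl fun i _ => ?_
    simp only [mul_assoc]
    rw [integral_const_mul]
  · intro i _
    exact ((continuous_const.mul (hf i)).mul continuous_const).continuousOn.integrableOn_compact
      isCompact_torus

lemma norm_torusMean_le {f : (ι → ℝ) → ℂ} {C : ℝ} (hf : ∀ θ, ‖f θ‖ ≤ C) : ‖torusMean f‖ ≤ C := by
  unfold torusMean
  rw [integral_mul_const, norm_mul]
  have hvol : volume.real (Set.univ.pi (fun _ : ι => Set.Icc (0 : ℝ) (2 * Real.pi))) =
      ∏ _x : ι, (2 * Real.pi) := by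
    rw [Measure.real, volume_pi_pi, ENNReal.toReal_prod]
    simp [Real.pi_pos.le]
  have h1 := norm_setIntegral_le_of_norm_le_const (μ := volume)
    (isCompact_torus (ι := ι)).measure_lt_top (fun θ _ => hf θ)
  rw [hvol] at h1
  refine (mul_le_mul_of_nonneg_right h1 (norm_nonneg _)).trans (le_of_eq ?_)
  rw [norm_prod, mul_assoc, ← Finset.prod_mul_distrib]
  have : ∀ x : ι, 2 * Real.pi * ‖(1 / (2 * (Real.pi : ℂ)))‖ = 1 := by
    intro _
    rw [norm_div, norm_mul, Complex.norm_real]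
    rw [norm_one, Complex.norm_ofNat, Real.norm_of_nonneg Real.pi_pos.le]
    field_simp
  rw [Finset.prod_congr rfl fun x _ => this x, Finset.prod_const_one, mul_one]

lemma integral_exp_int_mul (n m : ℕ) :
    ∫ t in (0 : ℝ)..(2 * Real.pi), Complex.exp (Complex.I * t) ^ n *
      Complex.exp (-(Complex.I * t)) ^ m * (1 / (2 * (Real.pi : ℂ))) = if n = m then 1 else 0 := by
  have h : ∀ t : ℝ, Complex.exp (Complex.I * t) ^ n * Complex.exp (-(Complex.I * t)) ^ m =
      Complex.exp ((((n : ℂ) - m) * Complex.I) * t) := by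
    intro t
    rw [← Complex.exp_nat_mul, ← Complex.exp_nat_mul, ← Complex.exp_add]
    congr 1; ring
  simp only [h]
  rw [intervalIntegral.integral_mul_const]
  have hpi : (Real.pi : ℂ) ≠ 0 := by exact_mod_cast Real.pi_ne_zero
  split_ifs with hnm
  · subst hnm
    simp
    field_simp
  · have hc : ((n : ℂ) - m) * Complex.I ≠ 0 :=
      mul_ne_zero (sub_ne_zero.2 (by exact_mod_cast hnm)) Complex.I_ne_zero
    rw [integral_exp_mul_complex hc]
    have : Complex.exp (((n : ℂ) - m) * Complex.I * ((2 * Real.pi : ℝ) : ℂ)) = 1 := by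
      rw [Complex.exp_eq_one_iff]
      exact ⟨(n : ℤ) - m, by push_cast; ring⟩
    rw [this]
    simp

/-- The point `√l e^{iθ}` of `ℂ ^ ι`. -/
noncomputable def torusPoint (l θ : ι → ℝ) (x : ι) : ℂ :=
  (√(l x) : ℂ) * Complex.exp (Complex.I * θ x)

/-- The point `√l e^{-iθ}` of `ℂ ^ ι`. -/
noncomputable def torusPointConj (l θ : ι → ℝ) (x : ι) : ℂ :=
  (√(l x) : ℂ) * Complex.exp (-(Complex.I * θ x))

lemma continuous_torusPoint (l : ι → ℝ) (x : ι) : Continuous fun θ => torusPoint l θ x := by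
  unfold torusPoint; fun_prop

lemma continuous_torusPointConj (l : ι → ℝ) (x : ι) :
    Continuous fun θ => torusPointConj l θ x := by
  unfold torusPointConj; fun_prop

lemma continuous_eval_torusPointConj (l : ι → ℝ) (Q : MvPolynomial ι ℂ) :
    Continuous fun θ => MvPolynomial.eval (torusPointConj l θ) Q :=
  (MvPolynomial.continuous_eval Q).comp
    (continuous_pi fun x => continuous_torusPointConj l x)

lemma torusMean_monomials {l : ι → ℝ} (hl : ∀ x, 0 ≤ l x) (n m : ι →₀ ℕ) :
    torusMean (fun θ => (∏ x, torusPoint l θ x ^ n x) * ∏ x, torusPointConj l θ x ^ m x) =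
      if n = m then ∏ x, (l x : ℂ) ^ n x else 0 := by
  have h : ∀ θ : ι → ℝ, (∏ x, torusPoint l θ x ^ n x) * ∏ x, torusPointConj l θ x ^ m x =
      ∏ x, ((√(l x) : ℂ) ^ n x * (√(l x) : ℂ) ^ m x * (Complex.exp (Complex.I * θ x) ^ n x *
        Complex.exp (-(Complex.I * θ x)) ^ m x)) := by
    intro θ
    rw [← Finset.prod_mul_distrib]
    refine Finset.prod_congr rfl fun x _ => ?_
    rw [torusPoint, torusPointConj, mul_pow, mul_pow]
    ring
  simp only [h]
  rw [torusMean_prod (fun x t => (√(l x) : ℂ) ^ n x * (√(l x) : ℂ) ^ m x *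
    (Complex.exp (Complex.I * t) ^ n x * Complex.exp (-(Complex.I * t)) ^ m x))]
  simp only [mul_assoc ((√(l _) : ℂ) ^ n _ * (√(l _) : ℂ) ^ m _)]
  simp only [intervalIntegral.integral_const_mul, integral_exp_int_mul]
  split_ifs with hnm
  · subst hnm
    refine Finset.prod_congr rfl fun x _ => ?_
    rw [if_pos rfl, mul_one, ← mul_pow, ← Complex.ofReal_mul, Real.mul_self_sqrt (hl x)]
  · obtain ⟨x, hx⟩ := Finsupp.ne_iff.1 hnm
    exact Finset.prod_eq_zero (Finset.mem_univ x) (by simp [hx])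

/-- Averaging over the angles extracts the coefficient of the matching monomial, since `√l_x
e^{iθ_x}` times its conjugate is `l_x`. -/
lemma torusMean_monomial_mul_eval {l : ι → ℝ} (hl : ∀ x, 0 ≤ l x) (n : ι →₀ ℕ)
    (Q : MvPolynomial ι ℂ) :
    torusMean (fun θ => (∏ x, torusPoint l θ x ^ n x) *
      MvPolynomial.eval (torusPointConj l θ) Q) = (∏ x, (l x : ℂ) ^ n x) * Q.coeff n := by
  simp only [MvPolynomial.eval_eq', Finset.mul_sum, mul_left_comm _ (MvPolynomial.coeff _ Q)]
  rw [torusMean_sum]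
  · simp only [torusMean_monomials hl]
    rw [Finset.sum_eq_single n]
    · rw [if_pos rfl, mul_comm]
    · intro m _ hm
      rw [if_neg (Ne.symm hm), mul_zero]
    · intro h
      rw [MvPolynomial.notMem_support_iff.1 h, zero_mul]
  · intro m
    exact (continuous_finsetProd _ fun x _ => (continuous_torusPoint l x).pow _).mul
      (continuous_finsetProd _ fun x _ => (continuous_torusPointConj l x).pow _)

/-- The functional `P ↦ ∑ n, P_n M_n`, with `M_n` the coefficients of MacMahon's theorem. -/
noncomputable def macMahonFunctional (A : Matrix ι ι ℂ) : MvPolynomial ι ℂ →ₗ[ℂ] ℂ :=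
  monomialFunctional (macMahonCoeff A)

/-- The terms of the exponent in the torus integral. -/
noncomputable def torusForm (A : Matrix ι ι ℂ) (l θ : ι → ℝ) (x : ι) : ℂ :=
  torusPoint l θ x * MvPolynomial.eval (torusPointConj l θ) (linearForm A x)

lemma continuous_torusForm (A : Matrix ι ι ℂ) (l : ι → ℝ) (x : ι) :
    Continuous fun θ => torusForm A l θ x :=
  (continuous_torusPoint l x).mul (continuous_eval_torusPointConj l _)

lemma prod_torusForm_pow (A : Matrix ι ι ℂ) (l θ : ι → ℝ) (n : ι →₀ ℕ) :
    ∏ x, torusForm A l θ x ^ n x = (∏ x, torusPoint l θ x ^ n x) *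
      MvPolynomial.eval (torusPointConj l θ) (linearFormPow A n) := by
  simp only [torusForm, mul_pow, Finset.prod_mul_distrib, linearFormPow, map_prod, map_pow]

/-- With `z = √l e^{iθ}`, a monomial in the terms `z_x (A z̄)_x` has as its mean the coefficient of
`z̄^n` in `∏ (A z̄)_x^{n_x}`, times `l^n`. This is where the coefficients of MacMahon's theorem
enter. -/
lemma torusMean_eval_torusForm (A : Matrix ι ι ℂ) {l : ι → ℝ} (hl : ∀ x, 0 ≤ l x)
    (P : MvPolynomial ι ℂ) :
    torusMean (fun θ => MvPolynomial.eval (torusForm A l θ) P) = macMahonFunctional A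
      (MvPolynomial.aeval (fun x => MvPolynomial.C (l x : ℂ) * MvPolynomial.X x) P) := by
  simp only [MvPolynomial.eval_eq']
  rw [torusMean_sum]
  · simp only [prod_torusForm_pow, torusMean_monomial_mul_eval hl]
    conv_rhs => rw [P.as_sum, map_sum, map_sum]
    refine Finset.sum_congr rfl fun n _ => ?_
    have : MvPolynomial.aeval (fun x => MvPolynomial.C (l x : ℂ) * MvPolynomial.X x)
        (MvPolynomial.monomial n (MvPolynomial.coeff n P)) =
        MvPolynomial.monomial n (P.coeff n * ∏ x, (l x : ℂ) ^ n x) := by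
      rw [MvPolynomial.aeval_monomial, MvPolynomial.monomial_eq]
      rw [Finsupp.prod_fintype _ _ (by simp)]
      simp only [Finsupp.prod_pow, mul_pow, Finset.prod_mul_distrib, MvPolynomial.C_mul, map_prod,
        map_pow, mul_assoc]
      rfl
    rw [this, macMahonFunctional, monomialFunctional_monomial, macMahonCoeff, mul_assoc]
  · intro m
    exact continuous_finsetProd _ fun x _ => (continuous_torusForm A l x).pow _

lemma norm_torusForm_le (A : Matrix ι ι ℂ) (l θ : ι → ℝ) (x : ι) :
    ‖torusForm A l θ x‖ ≤ √(l x) * ∑ y, ‖A x y‖ * √(l y) := by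
  have h1 : ‖torusPoint l θ x‖ = √(l x) := by
    rw [torusPoint, norm_mul, Complex.norm_exp]
    simp [abs_of_nonneg (Real.sqrt_nonneg _)]
  have h2 : ∀ y, ‖torusPointConj l θ y‖ = √(l y) := by
    intro y
    rw [torusPointConj, norm_mul, Complex.norm_exp]
    simp [abs_of_nonneg (Real.sqrt_nonneg _)]
  rw [torusForm, norm_mul, h1]
  gcongr
  simp only [linearForm, map_sum, map_mul, MvPolynomial.eval_C, MvPolynomial.eval_X]
  refine (norm_sum_le _ _).trans (Finset.sum_le_sum fun y _ => ?_)
  rw [norm_mul, h2]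

/-- At `l = 1` the coefficient `M_n` is itself a torus mean, of a product of `∑ n_x` factors each
bounded by the sum of all `‖A x y‖`. -/
lemma geomBounded_macMahonFunctional (A : Matrix ι ι ℂ) : GeomBounded (macMahonFunctional A) := by
  set C := ∑ x, ∑ y, ‖A x y‖ with hC
  have hC0 : 0 ≤ C := Finset.sum_nonneg fun x _ => Finset.sum_nonneg fun y _ => norm_nonneg _
  refine ⟨1, C, zero_le_one, hC0, fun n => ?_⟩
  have h := torusMean_eval_torusForm A (l := fun _ => 1) (fun _ => zero_le_one)
    (MvPolynomial.monomial n 1)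
  have e : MvPolynomial.aeval (fun x : ι => MvPolynomial.C ((1 : ℝ) : ℂ) * MvPolynomial.X x)
      (MvPolynomial.monomial n (1 : ℂ)) = MvPolynomial.monomial n 1 := by
    simp only [Complex.ofReal_one, map_one, one_mul]
    exact MvPolynomial.aeval_X_left_apply _
  rw [e] at h
  rw [← h, one_mul]
  refine norm_torusMean_le fun θ => ?_
  rw [MvPolynomial.eval_monomial, one_mul, Finsupp.prod_pow, norm_prod,
    ← Finset.prod_pow_eq_pow_sum]
  refine Finset.prod_le_prod (fun _ _ => norm_nonneg _) fun x _ => ?_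
  rw [norm_pow]
  gcongr
  refine (norm_torusForm_le A _ θ x).trans ?_
  simp only [Real.sqrt_one, mul_one, one_mul]
  exact Finset.single_le_sum (f := fun x => ∑ y, ‖A x y‖)
    (fun x _ => Finset.sum_nonneg fun y _ => norm_nonneg _) (Finset.mem_univ x)

/-- The exponential series may be averaged term by term, since the exponent is bounded by `B`
uniformly in the angles. -/
lemma torusMean_exp (A : Matrix ι ι ℂ) {l : ι → ℝ} (hl : ∀ x, 0 ≤ l x) :
    torusMean (fun θ => Complex.exp (∑ x, torusForm A l θ x)) =
      expTransform (macMahonFunctional A) l := by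
  set B : ℝ := ∑ x, √(l x) * ∑ y, ‖A x y‖ * √(l y) with hB
  have hbound : ∀ θ, ‖∑ x, torusForm A l θ x‖ ≤ B := fun θ =>
    (norm_sum_le _ _).trans (Finset.sum_le_sum fun x _ => norm_torusForm_le A l θ x)
  have hcont : Continuous fun θ => ∑ x, torusForm A l θ x :=
    continuous_finsetSum _ fun x _ => continuous_torusForm A l x
  have hpow : ∀ N : ℕ, torusMean (fun θ => (∑ x, torusForm A l θ x) ^ N / (N.factorial : ℂ)) =
      macMahonFunctional A (linPoly l ^ N) / (N.factorial : ℂ) := by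
    intro N
    have := torusMean_eval_torusForm A hl ((∑ x, MvPolynomial.X x) ^ N)
    simp only [map_pow, map_sum, MvPolynomial.eval_X, MvPolynomial.aeval_X] at this
    change _ = macMahonFunctional A (linPoly l ^ N) at this
    rw [← this]
    unfold torusMean
    rw [← integral_div]
    congr 1
    ext θ
    ring
  refine HasSum.unique ?_ ((geomBounded_macMahonFunctional A).hasSum l)
  simp only [← hpow]
  unfold torusMean
  have hint : ∀ c : ℝ, IntegrableOn (fun _ : ι → ℝ => c)
      (Set.univ.pi (fun _ : ι => Set.Icc (0 : ℝ) (2 * Real.pi))) := fun c =>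
    continuous_const.continuousOn.integrableOn_compact isCompact_torus
  refine hasSum_integral_of_dominated_convergence
    (fun N _ => B ^ N / N.factorial * ‖∏ _x : ι, (1 / (2 * (Real.pi : ℂ)))‖) ?_ ?_ ?_ ?_ ?_
  · intro N
    exact (((hcont.pow N).div_const _).mul continuous_const).aestronglyMeasurable
  · intro N
    refine ae_of_all _ fun θ => ?_
    rw [norm_mul, norm_div, norm_pow, Complex.norm_natCast]
    gcongr
    exact hbound θ
  · exact ae_of_all _ fun θ => (Real.summable_pow_div_factorial B).mul_right _
  · exact hint _
  · refine ae_of_all _ fun θ => ?_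
    refine HasSum.mul_right _ ?_
    rw [Complex.exp_eq_exp_ℂ]
    exact NormedSpace.exp_series_hasSum_exp' (𝕂 := ℂ) (∑ x, torusForm A l θ x) |>.congr_fun
      fun N => by simp only [smul_eq_mul, div_eq_inv_mul]

lemma sum_torusForm (A : Matrix ι ι ℂ) {l : ι → ℝ} (θ : ι → ℝ) :
    ∑ x, torusForm A l θ x = ∑ x, ∑ y, A x y * (√(l x) : ℂ) * (√(l y) : ℂ) *
      Complex.exp (Complex.I * ((θ x : ℂ) - (θ y : ℂ))) := by
  refine Finset.sum_congr rfl fun x _ => ?_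
  simp only [torusForm, linearForm, map_sum, map_mul, MvPolynomial.eval_C, MvPolynomial.eval_X,
    Finset.mul_sum]
  refine Finset.sum_congr rfl fun y _ => ?_
  rw [torusPoint, torusPointConj, mul_sub, sub_eq_add_neg, Complex.exp_add]
  ring

lemma torusIntegral_eq_expTransform (A : ι → ι → ℝ) {l : ι → ℝ} (hl : ∀ x, 0 ≤ l x) :
    torusIntegral A l =
      expTransform (macMahonFunctional (Matrix.of fun x y => (A x y : ℂ))) l := by
  rw [← torusMean_exp _ hl]
  simp only [sum_torusForm]
  rfl

/-- The diagonal terms of the exponent are `v_x |z_x|² = v_x l_x`, independent of the angles, and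
leave the integral. -/
lemma expTransform_sub_diagonal (A : Matrix ι ι ℂ) (v : ι → ℂ) {l : ι → ℝ} (hl : ∀ x, 0 ≤ l x) :
    expTransform (macMahonFunctional (A - Matrix.diagonal v)) l =
      expTilt v l * expTransform (macMahonFunctional A) l := by
  have h : ∀ θ, ∑ x, torusForm (A - Matrix.diagonal v) l θ x =
      -∑ x, v x * (l x : ℂ) + ∑ x, torusForm A l θ x := by
    intro θ
    rw [← Finset.sum_neg_distrib, ← Finset.sum_add_distrib]
    refine Finset.sum_congr rfl fun x _ => ?_
    have e : MvPolynomial.eval (torusPointConj l θ) (linearForm (A - Matrix.diagonal v) x) =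
        MvPolynomial.eval (torusPointConj l θ) (linearForm A x) - v x * torusPointConj l θ x := by
      simp only [linearForm, map_sum, Matrix.sub_apply, map_sub, sub_mul, map_mul,
        MvPolynomial.eval_C, MvPolynomial.eval_X, Finset.sum_sub_distrib, Matrix.diagonal_apply]
      simp
    have e2 : torusPoint l θ x * torusPointConj l θ x = l x := by
      rw [torusPoint, torusPointConj, mul_mul_mul_comm, ← Complex.exp_add, add_neg_cancel,
        Complex.exp_zero, mul_one, ← Complex.ofReal_mul, Real.mul_self_sqrt (hl x)]
    rw [torusForm, torusForm, e, mul_sub, mul_left_comm _ (v x), e2]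
    ring
  rw [← torusMean_exp _ hl, ← torusMean_exp _ hl]
  simp only [h, Complex.exp_add]
  unfold torusMean
  rw [← integral_const_mul]
  simp only [mul_assoc]
  rfl

/-- The functional that represents the density. -/
noncomputable def densityFunctional (A : Matrix ι ι ℂ) (a b : ι) : MvPolynomial ι ℂ →ₗ[ℂ] ℂ :=
  shiftFunctional (macMahonFunctional A) (cofactorPoly A a b)

lemma geomBounded_densityFunctional (A : Matrix ι ι ℂ) (a b : ι) :
    GeomBounded (densityFunctional A a b) :=
  (geomBounded_macMahonFunctional A).shift _

lemma isOpen_orthant : IsOpen (orthant ι) := by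
  have : orthant ι = ⋂ x, {l : ι → ℝ | 0 < l x} := by ext; simp [orthant]
  rw [this]
  exact isOpen_iInter_of_finite fun x => isOpen_lt continuous_const (continuous_apply x)

lemma diffOp_cofactorPoly_eqOn (A : Matrix ι ι ℂ) (a b : ι) {f : (ι → ℝ) → ℂ}
    (hf : Set.EqOn f (expTransform (macMahonFunctional A)) (orthant ι)) :
    Set.EqOn (diffOp (cofactorPoly A a b) f) (expTransform (densityFunctional A a b))
      (orthant ι) := by
  have := diffOp_eqOn (geomBounded_macMahonFunctional A) 0 isOpen_orthant (f := f)
    (fun l hl => by simpa [expTilt] using hf hl) (cofactorPoly A a b)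
  intro l hl
  simpa [expTilt, densityFunctional, MvPolynomial.aeval_X_left_apply] using this hl

lemma density_eqOn (A : ι → ι → ℝ) (a b : ι) :
    Set.EqOn (density A a b)
      (expTransform (densityFunctional (Matrix.of fun x y => (A x y : ℂ)) a b)) (orthant ι) :=
  diffOp_cofactorPoly_eqOn (Matrix.of fun x y => (A x y : ℂ)) a b
    fun _ hl => torusIntegral_eq_expTransform A fun x => (hl x).le

/-- `-(A - diag v) + (X - v) = -A + X`. -/
lemma aeval_cofactorPoly (A : Matrix ι ι ℂ) (v : ι → ℂ) (a b : ι) :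
    MvPolynomial.aeval (fun x => MvPolynomial.X x - MvPolynomial.C (v x))
      (cofactorPoly (A - Matrix.diagonal v) a b) = cofactorPoly A a b := by
  unfold cofactorPoly cofactor
  rw [AlgHom.map_det]
  congr 1
  ext1 x y
  simp only [AlgHom.mapMatrix_apply, Matrix.map_apply, Matrix.of_apply, map_add, Matrix.add_apply,
    Matrix.sub_apply]
  congr 1
  · split_ifs
    · by_cases hxy : x = y
      · subst hxy
        simp only [Matrix.diagonal_apply_eq, map_add, MvPolynomial.aeval_X, MvPolynomial.aeval_C,
          MvPolynomial.algebraMap_eq, map_neg, map_sub]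
        ring
      · simp [Matrix.diagonal_apply_ne _ hxy, MvPolynomial.algebraMap_eq]
    · simp
  · split_ifs <;> simp

/-- The operator built from `A - diag v`, applied to the transform for `A - diag v`, is computed
twice: directly, and with the tilt pulled out, where the shift of the symbol undoes the change of
matrix. This makes the Fourier transform of the density a total mass. -/
lemma expTransform_densityFunctional_sub_diagonal (A : Matrix ι ι ℂ) (v : ι → ℂ) (a b : ι)
    {l : ι → ℝ} (hl : l ∈ orthant ι) :
    expTransform (densityFunctional (A - Matrix.diagonal v) a b) l =
      expTilt v l * expTransform (densityFunctional A a b) l := by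
  have h1 := diffOp_cofactorPoly_eqOn (A - Matrix.diagonal v) a b
    (f := expTransform (macMahonFunctional (A - Matrix.diagonal v))) (fun _ _ => rfl) hl
  have h2 := diffOp_eqOn (geomBounded_macMahonFunctional A) v isOpen_orthant
    (f := expTransform (macMahonFunctional (A - Matrix.diagonal v)))
    (fun l hl => expTransform_sub_diagonal A v fun x => (hl x).le)
    (cofactorPoly (A - Matrix.diagonal v) a b) hl
  rw [aeval_cofactorPoly] at h2
  exact h1.symm.trans h2

end Torus

/-! ### Dirichlet integrals and the total mass of the density. -/

section Dirichlet

variable {ι : Type*} [Fintype ι] [DecidableEq ι]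

lemma lintegral_surfaceMeasure (c : ι) (T : ℝ) {F : (ι → ℝ) → ℝ≥0∞} (hF : Measurable F) :
    ∫⁻ l, F l ∂(surfaceMeasure c T) =
      ∫⁻ u, (simplex ι T).indicator F (hyperplaneChart c T u) := by
  unfold surfaceMeasure
  rw [← lintegral_indicator (measurableSet_simplex T),
    lintegral_map (hF.indicator (measurableSet_simplex T))]
  exact (measurable_hyperplaneChart c).comp (measurable_const.prodMk measurable_id)

lemma hyperplaneChart_smul (c : ι) (T : ℝ) (w : {x : ι // x ≠ c} → ℝ) :
    hyperplaneChart c T (T • w) = T • hyperplaneChart c 1 w := by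
  ext x
  by_cases h : x = c
  · simp [hyperplaneChart, h, mul_sub, Finset.mul_sum]
  · simp [hyperplaneChart, h]

lemma smul_mem_simplex_iff {T : ℝ} (hT : 0 < T) (l : ι → ℝ) :
    T • l ∈ simplex ι T ↔ l ∈ simplex ι 1 := by
  simp only [simplex, Set.mem_ofPred_eq, Pi.smul_apply, smul_eq_mul, ← Finset.mul_sum,
    mul_pos_iff_of_pos_left hT]
  refine and_congr_right fun _ => ⟨fun h => ?_, fun h => by rw [h, mul_one]⟩
  exact mul_left_cancel₀ hT.ne' (by rw [h, mul_one])

lemma card_ne_eq (c : ι) : Fintype.card {x : ι // x ≠ c} = Fintype.card ι - 1 := by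
  rw [Fintype.card_subtype_compl, Fintype.card_subtype_eq]

/-- Under `u = T w` Lebesgue measure in `card ι - 1` coordinates and the monomial supply the two
parts of the exponent of `T`. -/
lemma lintegral_surfaceMeasure_monomial_scale (c : ι) {T : ℝ} (hT : 0 < T) (n : ι →₀ ℕ) :
    ∫⁻ l, ENNReal.ofReal (∏ x, l x ^ n x) ∂(surfaceMeasure c T) =
      ENNReal.ofReal (T ^ (∑ x, n x + Fintype.card ι - 1)) *
        ∫⁻ l, ENNReal.ofReal (∏ x, l x ^ n x) ∂(surfaceMeasure c 1) := by
  have hm : Measurable fun l : ι → ℝ => ENNReal.ofReal (∏ x, l x ^ n x) := by fun_prop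
  have hcard : 0 < Fintype.card ι := Fintype.card_pos_iff.2 ⟨c⟩
  rw [lintegral_surfaceMeasure c T hm, lintegral_surfaceMeasure c 1 hm]
  have hG : Measurable fun u : {x : ι // x ≠ c} → ℝ => (simplex ι T).indicator
      (fun l => ENNReal.ofReal (∏ x, l x ^ n x)) (hyperplaneChart c T u) :=
    (hm.indicator (measurableSet_simplex T)).comp
      ((measurable_hyperplaneChart c).comp (measurable_const.prodMk measurable_id))
  have hmap := Measure.map_addHaar_smul
    (volume : Measure ({x : ι // x ≠ c} → ℝ)) hT.ne'
  have h1 := lintegral_map hG (measurable_const_smul T)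
    (μ := (volume : Measure ({x : ι // x ≠ c} → ℝ)))
  rw [hmap, lintegral_smul_measure, Module.finrank_fintype_fun_eq_card, card_ne_eq,
    abs_of_pos (by positivity), smul_eq_mul] at h1
  have h2 : ∀ w : {x : ι // x ≠ c} → ℝ, (simplex ι T).indicator
      (fun l => ENNReal.ofReal (∏ x, l x ^ n x)) (hyperplaneChart c T (T • w)) =
      ENNReal.ofReal (T ^ ∑ x, n x) * (simplex ι 1).indicator
      (fun l => ENNReal.ofReal (∏ x, l x ^ n x)) (hyperplaneChart c 1 w) := by
    intro w
    rw [hyperplaneChart_smul]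
    by_cases h : hyperplaneChart c 1 w ∈ simplex ι 1
    · rw [Set.indicator_of_mem h, Set.indicator_of_mem ((smul_mem_simplex_iff hT _).2 h),
        ← ENNReal.ofReal_mul (by positivity)]
      congr 1
      simp only [Pi.smul_apply, smul_eq_mul, mul_pow, Finset.prod_mul_distrib,
        Finset.prod_pow_eq_pow_sum]
    · rw [Set.indicator_of_notMem h,
        Set.indicator_of_notMem (fun h' => h ((smul_mem_simplex_iff hT _).1 h')), mul_zero]
  simp only [h2] at h1
  rw [lintegral_const_mul' _ _ ENNReal.ofReal_ne_top] at h1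
  have h3 : ENNReal.ofReal (T ^ (Fintype.card ι - 1)) *
      ENNReal.ofReal ((T ^ (Fintype.card ι - 1))⁻¹) = 1 := by
    rw [← ENNReal.ofReal_mul (by positivity), mul_inv_cancel₀ (by positivity), ENNReal.ofReal_one]
  have h4 := congrArg (ENNReal.ofReal (T ^ (Fintype.card ι - 1)) * ·) h1
  simp only [← mul_assoc, h3, one_mul] at h4
  rw [h4, ← ENNReal.ofReal_mul (by positivity), ← pow_add]
  congr 4
  omega

lemma integrableOn_exp_neg_mul_pow (n : ℕ) :
    IntegrableOn (fun x : ℝ => Real.exp (-x) * x ^ n) (Set.Ioi 0) := by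
  have := Real.GammaIntegral_convergent (s := (n : ℝ) + 1) (by positivity)
  simpa using this

lemma integral_exp_neg_mul_pow (n : ℕ) :
    ∫ x in Set.Ioi (0 : ℝ), Real.exp (-x) * x ^ n = n.factorial := by
  rw [← Real.Gamma_nat_eq_factorial, Real.Gamma_eq_integral (by positivity)]
  simp

lemma lintegral_exp_neg_mul_pow (n : ℕ) :
    ∫⁻ x in Set.Ioi (0 : ℝ), ENNReal.ofReal (Real.exp (-x) * x ^ n) =
      ENNReal.ofReal n.factorial := by
  rw [← integral_exp_neg_mul_pow, ofReal_integral_eq_lintegral_ofReal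
    (integrableOn_exp_neg_mul_pow n)]
  filter_upwards [ae_restrict_mem measurableSet_Ioi] with x hx
  have : (0 : ℝ) < x := hx
  positivity

lemma lintegral_orthant_exp_monomial (n : ι →₀ ℕ) :
    ∫⁻ l in orthant ι, ENNReal.ofReal (∏ x, (Real.exp (-l x) * l x ^ n x)) =
      ENNReal.ofReal (∏ x, ((n x).factorial : ℝ)) := by
  have ho : orthant ι = Set.univ.pi fun _ => Set.Ioi 0 := by ext; simp [orthant]
  simp only [← integral_exp_neg_mul_pow]
  rw [← integral_fintype_prod_eq_prod (fun x (t : ℝ) => Real.exp (-t) * t ^ n x), ho, volume_pi,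
    Measure.restrict_pi_pi, ofReal_integral_eq_lintegral_ofReal]
  · exact Integrable.fintype_prod_dep fun x => integrableOn_exp_neg_mul_pow (n x)
  · rw [← Measure.restrict_pi_pi]
    filter_upwards [ae_restrict_mem (MeasurableSet.univ_pi fun _ => measurableSet_Ioi)] with l hl
    refine Finset.prod_nonneg fun x _ => ?_
    have : 0 < l x := hl x (Set.mem_univ x)
    positivity

/-- The Dirichlet integral. -/
lemma lintegral_surfaceMeasure_monomial (c : ι) {T : ℝ} (hT : 0 < T) (n : ι →₀ ℕ) :
    ∫⁻ l, ENNReal.ofReal (∏ x, l x ^ n x) ∂(surfaceMeasure c T) =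
      ENNReal.ofReal ((∏ x, ((n x).factorial : ℝ)) * (T ^ (∑ x, n x + Fintype.card ι - 1) /
        (∑ x, n x + Fintype.card ι - 1).factorial)) := by
  set m := ∑ x, n x + Fintype.card ι - 1 with hm
  set J := ∫⁻ l, ENNReal.ofReal (∏ x, l x ^ n x) ∂(surfaceMeasure c 1) with hJ
  -- The unknown value `J` at `T = 1` comes from evaluating `∫ exp (-∑ l_x) l^n` over the orthant
  -- twice: as a product of Gamma integrals, and by disintegration as `m! J`.
  have h := lintegral_orthant c (fun l => ENNReal.ofReal (∏ x, (Real.exp (-l x) * l x ^ n x)))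
    (by fun_prop)
  have hin : ∀ T ∈ Set.Ioi (0 : ℝ), ∫⁻ l, ENNReal.ofReal (∏ x, (Real.exp (-l x) * l x ^ n x))
      ∂(surfaceMeasure c T) = ENNReal.ofReal (Real.exp (-T) * T ^ m) * J := by
    intro T hT
    have e : ∀ᵐ l ∂(surfaceMeasure c T), ENNReal.ofReal (∏ x, (Real.exp (-l x) * l x ^ n x)) =
        ENNReal.ofReal (Real.exp (-T)) * ENNReal.ofReal (∏ x, l x ^ n x) := by
      unfold surfaceMeasure
      filter_upwards [ae_restrict_mem (measurableSet_simplex T)] with l hl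
      rw [Finset.prod_mul_distrib, ← Real.exp_sum, Finset.sum_neg_distrib, hl.2,
        ENNReal.ofReal_mul (Real.exp_pos _).le]
    rw [lintegral_congr_ae e, lintegral_const_mul' _ _ ENNReal.ofReal_ne_top,
      lintegral_surfaceMeasure_monomial_scale c hT, ← mul_assoc,
      ← ENNReal.ofReal_mul (Real.exp_pos _).le]
  rw [lintegral_orthant_exp_monomial, setLIntegral_congr_fun measurableSet_Ioi hin,
    lintegral_mul_const _ (by fun_prop), lintegral_exp_neg_mul_pow] at h
  have hfac : (0 : ℝ) < m.factorial := by exact_mod_cast m.factorial_pos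
  have hJ' : J = ENNReal.ofReal ((∏ x, ((n x).factorial : ℝ)) / m.factorial) := by
    rw [ENNReal.ofReal_div_of_pos hfac, h, mul_comm, mul_div_assoc, ENNReal.div_self, mul_one]
    · simpa using m.factorial_ne_zero
    · exact ENNReal.ofReal_ne_top
  rw [lintegral_surfaceMeasure_monomial_scale c hT, ← hJ, hJ', ← ENNReal.ofReal_mul (by positivity)]
  congr 1
  ring

lemma ae_mem_simplex (c : ι) (T : ℝ) : ∀ᵐ l ∂(surfaceMeasure c T), l ∈ simplex ι T :=
  ae_restrict_mem (measurableSet_simplex T)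

lemma isFiniteMeasure_surfaceMeasure (c : ι) {T : ℝ} (hT : 0 < T) :
    IsFiniteMeasure (surfaceMeasure c T) := by
  refine ⟨?_⟩
  have := lintegral_surfaceMeasure_monomial c hT 0
  simp only [Finsupp.coe_zero, Pi.zero_apply, pow_zero, Finset.prod_const_one, ENNReal.ofReal_one,
    lintegral_one] at this
  rw [this]
  exact ENNReal.ofReal_lt_top

lemma integral_surfaceMeasure_monomial (c : ι) {T : ℝ} (hT : 0 < T) (n : ι →₀ ℕ) :
    ∫ l, ∏ x, l x ^ n x ∂(surfaceMeasure c T) =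
      (∏ x, ((n x).factorial : ℝ)) * (T ^ (∑ x, n x + Fintype.card ι - 1) /
        (∑ x, n x + Fintype.card ι - 1).factorial) := by
  rw [integral_eq_lintegral_of_nonneg_ae, lintegral_surfaceMeasure_monomial c hT,
    ENNReal.toReal_ofReal (by positivity)]
  · filter_upwards [ae_mem_simplex c T] with l hl
    exact Finset.prod_nonneg fun x _ => pow_nonneg (hl.1 x).le _
  · exact (Measurable.aestronglyMeasurable (by fun_prop))

lemma simplex_subset_Icc (T : ℝ) : simplex ι T ⊆ Set.Icc 0 (fun _ => T) := by
  intro l hl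
  refine ⟨fun x => (hl.1 x).le, fun x => ?_⟩
  rw [← hl.2]
  exact Finset.single_le_sum (f := l) (fun y _ => (hl.1 y).le) (Finset.mem_univ x)

lemma integrable_surfaceMeasure_of_continuous (c : ι) {T : ℝ} (hT : 0 < T) {f : (ι → ℝ) → ℂ}
    (hf : Continuous f) : Integrable f (surfaceMeasure c T) := by
  have := isFiniteMeasure_surfaceMeasure c hT
  obtain ⟨C, hC⟩ := (isCompact_Icc (a := (0 : ι → ℝ)) (b := fun _ => T)).exists_bound_of_continuousOn
    hf.continuousOn
  refine Integrable.of_bound hf.aestronglyMeasurable C ?_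
  filter_upwards [ae_mem_simplex c T] with l hl using hC l (simplex_subset_Icc T hl)

lemma linPoly_pow (l : ι → ℝ) (N : ℕ) :
    linPoly l ^ N = ∑ n ∈ Finset.finsuppAntidiag Finset.univ N,
      ((Nat.multinomial Finset.univ n : ℂ) * ((∏ x, l x ^ n x : ℝ) : ℂ)) •
        MvPolynomial.monomial n (1 : ℂ) := by
  rw [linPoly, Finset.sum_pow_eq_sum_piAntidiag]
  refine Finset.sum_bij' (fun k _ => Finsupp.equivFunOnFinite.symm k) (fun n _ => ⇑n)
    ?_ ?_ ?_ ?_ ?_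
  · intro k hk
    rw [Finset.mem_piAntidiag] at hk
    rw [Finset.mem_finsuppAntidiag]
    exact ⟨hk.1, Finset.subset_univ _⟩
  · intro n hn
    rw [Finset.mem_finsuppAntidiag] at hn
    rw [Finset.mem_piAntidiag]
    exact ⟨hn.1, fun x _ => Finset.mem_univ x⟩
  · intro k _; rfl
  · intro n _; ext; rfl
  · intro k _
    rw [MvPolynomial.smul_monomial, smul_eq_mul, mul_one, MvPolynomial.monomial_eq,
      Finsupp.prod_fintype _ _ (by simp)]
    simp only [mul_pow, Finset.prod_mul_distrib, Finsupp.coe_equivFunOnFinite_symm]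
    rw [MvPolynomial.C_mul, mul_assoc]
    simp

/-- The factorials of the Dirichlet integral turn each multinomial coefficient into `N!`, which the
exponential series divides out. Only an unweighted sum of moments is left. -/
lemma integral_functional_linPoly_pow (φ : MvPolynomial ι ℂ →ₗ[ℂ] ℂ) (c : ι) {T : ℝ} (hT : 0 < T)
    (N : ℕ) : ∫ l, φ (linPoly l ^ N) / (N.factorial : ℂ) ∂(surfaceMeasure c T) =
      (∑ n ∈ Finset.finsuppAntidiag Finset.univ N, φ (MvPolynomial.monomial n 1)) *
        ((T : ℂ) ^ (N + Fintype.card ι - 1) / (N + Fintype.card ι - 1).factorial) := by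
  rw [integral_div]
  simp only [linPoly_pow, map_sum, map_smul, smul_eq_mul]
  rw [integral_finsetSum]
  · rw [Finset.sum_div, Finset.sum_mul]
    refine Finset.sum_congr rfl fun n hn => ?_
    have hsum : ∑ x, n x = N := (Finset.mem_finsuppAntidiag.1 hn).1
    rw [integral_mul_const, integral_const_mul, integral_complex_ofReal,
      integral_surfaceMeasure_monomial c hT, hsum]
    have hspec := Nat.multinomial_spec Finset.univ n
    rw [hsum] at hspec
    rw [← hspec]
    have h1 : (Nat.multinomial Finset.univ n : ℂ) ≠ 0 :=
      Nat.cast_ne_zero.2 (Nat.multinomial_pos _ _).ne'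
    have h2 : (∏ x, ((n x).factorial : ℂ)) ≠ 0 :=
      Finset.prod_ne_zero_iff.2 fun x _ => Nat.cast_ne_zero.2 (Nat.factorial_ne_zero _)
    push_cast
    field_simp
  · intro n _
    refine integrable_surfaceMeasure_of_continuous c hT ?_
    fun_prop

/-- On the simplex `∑ |l_x| = T`, so the geometric bound dominates the exponential series uniformly.
-/
lemma GeomBounded.hasSum_integral {φ : MvPolynomial ι ℂ →ₗ[ℂ] ℂ} (h : GeomBounded φ) (c : ι)
    {T : ℝ} (hT : 0 < T) :
    HasSum (fun N : ℕ =>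
      (∑ n ∈ Finset.finsuppAntidiag Finset.univ N, φ (MvPolynomial.monomial n 1)) *
        ((T : ℂ) ^ (N + Fintype.card ι - 1) / (N + Fintype.card ι - 1).factorial))
      (∫ l, expTransform φ l ∂(surfaceMeasure c T)) := by
  have := isFiniteMeasure_surfaceMeasure c hT
  simp only [← integral_functional_linPoly_pow φ c hT]
  obtain ⟨K, C, hK, hC, hb⟩ := id h
  have hcont : ∀ N : ℕ, Continuous fun l : ι → ℝ => φ (linPoly l ^ N) / (N.factorial : ℂ) := by
    intro N
    simp only [linPoly_pow, map_sum, map_smul, smul_eq_mul]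
    fun_prop
  refine hasSum_integral_of_dominated_convergence
    (fun N _ => K * ((C * T) ^ N / N.factorial)) ?_ ?_ ?_ ?_ ?_
  · intro N
    exact (hcont N).aestronglyMeasurable
  · intro N
    filter_upwards [ae_mem_simplex c T] with l hl
    rw [norm_div, Complex.norm_natCast, ← mul_div_assoc]
    gcongr
    refine (norm_functional_linPoly_pow_le hb l N).trans (le_of_eq ?_)
    rw [Finset.sum_congr rfl fun x _ => abs_of_pos (hl.1 x), hl.2]
  · exact ae_of_all _ fun _ => (Real.summable_pow_div_factorial _).mul_left _
  · exact integrable_const _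
  · exact ae_of_all _ fun l => h.hasSum l

/-- The total mass of the density on the simplex. -/
theorem hasSum_integral_densityFunctional (A : Matrix ι ι ℂ) (a b c : ι) {T : ℝ} (hT : 0 < T) :
    HasSum (fun N : ℕ => coveringPow A N a b * ((T : ℂ) ^ N / N.factorial))
      (∫ l, expTransform (densityFunctional A a b) l ∂(surfaceMeasure c T)) := by
  have h := (geomBounded_densityFunctional A a b).hasSum_integral c hT
  have e : ∀ n, densityFunctional A a b (MvPolynomial.monomial n 1) =
      monomialFunctional (macMahonCoeff A) (MvPolynomial.monomial n 1 * cofactorPoly A a b) := by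
    intro n
    rw [densityFunctional, shiftFunctional_apply, mul_comm]
    rfl
  simp only [e, sum_monomialFunctional_cofactorPoly] at h
  have hpos : 0 < Fintype.card ι := Fintype.card_pos_iff.2 ⟨a⟩
  -- The terms found are those of index `N + card ι - 1`. The omitted smaller indices carry zero
  -- coefficients, since such short paths cannot cover all sites.
  have hinj : Function.Injective fun N : ℕ => N + Fintype.card ι - 1 := by
    intro m n hmn
    simp only at hmn
    omega
  refine (hinj.hasSum_iff ?_).1 h
  intro N hN
  rw [coveringPow_eq_zero, zero_mul]
  by_contra hlt
  exact hN ⟨N + 1 - Fintype.card ι, by simp only; omega⟩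

end Dirichlet

/-! ### Powers of small perturbations of the identity. -/

section PowerLimit

/-- If `n (a n - 1) → M` then `a n ^ n → exp M`, with the exponential written as a series. -/
lemma hasSum_of_tendsto_pow {𝔸 : Type*} [NormedRing 𝔸] [NormedAlgebra ℂ 𝔸] [CompleteSpace 𝔸]
    [NormOneClass 𝔸] {a : ℕ → 𝔸} {M : 𝔸}
    (h : Tendsto (fun n : ℕ => (n : ℂ) • (a n - 1)) atTop (𝓝 M)) :
    ∃ L, Tendsto (fun n => a n ^ n) atTop (𝓝 L) ∧
      HasSum (fun k : ℕ => ((k.factorial : ℂ)⁻¹) • M ^ k) L := by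
  set b : ℕ → 𝔸 := fun n => (n : ℂ) • (a n - 1) with hb
  obtain ⟨C, hC⟩ : ∃ C : ℝ, ∀ n, ‖b n‖ ≤ C := by
    obtain ⟨C, hC⟩ := (Metric.isBounded_range_of_tendsto b h).exists_norm_le
    exact ⟨C, fun n => hC _ (Set.mem_range_self n)⟩
  have hC0 : 0 ≤ C := (norm_nonneg _).trans (hC 0)
  -- The binomial expansion of `(1 + b n / n) ^ n`, extended by zero beyond `k = n` and dominated by
  -- the series of `exp C`.
  set f : ℕ → ℕ → 𝔸 := fun n k => ((n.choose k : ℂ) * ((n : ℂ)⁻¹) ^ k) • b n ^ k with hf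
  have hpow : ∀ n, 0 < n → a n ^ n = ∑' k, f n k := by
    intro n hn
    have hn' : (n : ℂ) ≠ 0 := Nat.cast_ne_zero.2 hn.ne'
    have e : a n = (n : ℂ)⁻¹ • b n + 1 := by
      simp only [hb]
      rw [smul_smul, inv_mul_cancel₀ hn', one_smul, sub_add_cancel]
    rw [tsum_eq_sum (s := Finset.range (n + 1))]
    · conv_lhs => rw [e]
      rw [(Commute.one_right _).add_pow]
      refine Finset.sum_congr rfl fun k _ => ?_
      rw [smul_pow, one_pow, mul_one, ← nsmul_eq_mul', ← Nat.cast_smul_eq_nsmul ℂ, smul_smul]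
    · intro k hk
      rw [Finset.mem_range, not_lt] at hk
      simp [hf, Nat.choose_eq_zero_of_lt hk]
  have hbound : ∀ n k, ‖f n k‖ ≤ C ^ k / k.factorial := by
    intro n k
    simp only [hf]
    rw [norm_smul, norm_mul, norm_pow, norm_inv, Complex.norm_natCast, Complex.norm_natCast]
    have h1 : (n.choose k : ℝ) * ((n : ℝ)⁻¹) ^ k ≤ 1 / k.factorial := by
      have := Nat.choose_le_pow_div (α := ℝ) k n
      rcases Nat.eq_zero_or_pos n with rfl | hn
      · rcases Nat.eq_zero_or_pos k with rfl | hk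
        · simp
        · rw [Nat.choose_eq_zero_of_lt hk]; simp
      · have hn' : (0 : ℝ) < n := by exact_mod_cast hn
        calc (n.choose k : ℝ) * ((n : ℝ)⁻¹) ^ k
            ≤ ((n : ℝ) ^ k / k.factorial) * ((n : ℝ)⁻¹) ^ k := by gcongr
          _ = 1 / k.factorial := by rw [inv_pow]; field_simp
    calc (n.choose k : ℝ) * ((n : ℝ)⁻¹) ^ k * ‖b n ^ k‖
        ≤ 1 / k.factorial * C ^ k := by
          gcongr
          exact (norm_pow_le _ _).trans (by gcongr; exact hC n)
      _ = C ^ k / k.factorial := by ring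
  have hlim : ∀ k, Tendsto (fun n => f n k) atTop (𝓝 (((k.factorial : ℂ)⁻¹) • M ^ k)) := by
    intro k
    refine Tendsto.smul ?_ (h.pow k)
    have h1 : Tendsto (fun n : ℕ => (n : ℝ) * (n : ℝ)⁻¹) atTop (𝓝 1) := by
      refine tendsto_const_nhds.congr' ?_
      filter_upwards [eventually_gt_atTop 0] with n hn
      rw [mul_inv_cancel₀ (by exact_mod_cast hn.ne')]
    -- The binomial-to-Poisson limit with parameter one: `n.choose k / n ^ k → 1 / k!`.
    have h2 := ProbabilityTheory.tendsto_choose_mul_pow_atTop k h1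
    have h3 := (Complex.continuous_ofReal.tendsto _).comp h2
    convert h3 using 2
    · simp
    · simp
  have htend := tendsto_tsum_of_dominated_convergence (Real.summable_pow_div_factorial C) hlim
    (Eventually.of_forall fun n k => hbound n k)
  have hsum : Summable fun k : ℕ => ((k.factorial : ℂ)⁻¹) • M ^ k := by
    refine Summable.of_norm_bounded (Real.summable_pow_div_factorial C) fun k => ?_
    exact le_of_tendsto (hlim k).norm (Eventually.of_forall fun n => hbound n k)
  refine ⟨_, htend.congr' ?_, hsum.hasSum⟩
  filter_upwards [eventually_gt_atTop 0] with n hn using (hpow n hn).symm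

lemma hasSum_of_tendsto_matrix_pow {ι : Type*} [Fintype ι] [DecidableEq ι]
    {Q : ℕ → Matrix ι ι ℂ} {M : Matrix ι ι ℂ}
    (h : ∀ α β, Tendsto (fun n : ℕ => (n : ℂ) * (Q n - 1) α β) atTop (𝓝 (M α β)))
    {α β : ι} {z : ℂ} (hz : Tendsto (fun n => (Q n ^ n) α β) atTop (𝓝 z)) :
    HasSum (fun k : ℕ => ((k.factorial : ℂ)⁻¹) * (M ^ k) α β) z := by
  have : Nonempty ι := ⟨α⟩
  -- The operator norm is auxiliary: its topology is that of entrywise convergence, in which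
  -- hypotheses and conclusion are stated.
  let : NormedRing (Matrix ι ι ℂ) := Matrix.linftyOpNormedRing
  let : NormedAlgebra ℂ (Matrix ι ι ℂ) := Matrix.linftyOpNormedAlgebra
  have : NormOneClass (Matrix ι ι ℂ) := Matrix.linfty_opNormOneClass
  have hM : Tendsto (fun n : ℕ => (n : ℂ) • (Q n - 1)) atTop (𝓝 M) := by
    refine tendsto_pi_nhds.2 fun α => tendsto_pi_nhds.2 fun β => ?_
    exact h α β
  obtain ⟨L, hL, hs⟩ := hasSum_of_tendsto_pow hM
  have hL' : Tendsto (fun n => (Q n ^ n) α β) atTop (𝓝 (L α β)) :=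
    tendsto_pi_nhds.1 (tendsto_pi_nhds.1 hL α) β
  rw [tendsto_nhds_unique hz hL']
  have h3 : Tendsto (fun s : Finset ℕ => (∑ k ∈ s, ((k.factorial : ℂ)⁻¹) • M ^ k) α β) atTop
      (𝓝 (L α β)) := tendsto_pi_nhds.1 (tendsto_pi_nhds.1 hs α) β
  refine Tendsto.congr (fun s => ?_) h3
  rw [Matrix.sum_apply]
  rfl

end PowerLimit

/-! ### Riemann sums of right-continuous step paths. -/

section Riemann

/-- Rounding up to the grid approaches `s` from the right, the side on which the paths are
controlled. -/
lemma tendsto_ceil_mesh {T s : ℝ} (hT : 0 < T) :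
    Tendsto (fun n : ℕ => (⌈s / (T / n)⌉ : ℝ) * (T / n)) atTop (𝓝[≥] s) := by
  refine tendsto_nhdsWithin_iff.2 ⟨?_, ?_⟩
  · have h0 : Tendsto (fun n : ℕ => s + T / n) atTop (𝓝 s) := by
      simpa using tendsto_const_nhds.add (tendsto_const_div_atTop_nhds_zero_nat T)
    refine tendsto_of_tendsto_of_tendsto_of_le_of_le' tendsto_const_nhds h0 ?_ ?_
    · filter_upwards [eventually_gt_atTop 0] with n hn
      have : 0 < T / n := div_pos hT (by exact_mod_cast hn)
      rw [← div_le_iff₀ this]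
      exact Int.le_ceil _
    · filter_upwards [eventually_gt_atTop 0] with n hn
      have : 0 < T / n := div_pos hT (by exact_mod_cast hn)
      have h1 := (Int.ceil_lt_add_one (s / (T / n))).le
      calc (⌈s / (T / n)⌉ : ℝ) * (T / n) ≤ (s / (T / n) + 1) * (T / n) := by gcongr
        _ = s + T / n := by field_simp
  · filter_upwards [eventually_gt_atTop 0] with n hn
    have : 0 < T / n := div_pos hT (by exact_mod_cast hn)
    rw [Set.mem_Ici, ← div_le_iff₀ this]
    exact Int.le_ceil _

/-- Riemann sums of a bounded function converge if the function is right-continuous for the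
discrete topology. -/
lemma tendsto_riemann_sum {T : ℝ} (hT : 0 < T) {u : ℝ → ℝ} {C : ℝ} (hC : ∀ s, ‖u s‖ ≤ C)
    (hu : ∀ s, 0 < s → ∀ᶠ r in 𝓝[≥] s, u r = u s) :
    Tendsto (fun n : ℕ => ∑ k ∈ Finset.range n, T / n * u ((k + 1 : ℕ) * (T / n))) atTop
      (𝓝 (∫ s in (0 : ℝ)..T, u s)) := by
  have hmain : Tendsto (fun n : ℕ => ∫ s in (0 : ℝ)..T, u (⌈s / (T / n)⌉ * (T / n))) atTop
      (𝓝 (∫ s in (0 : ℝ)..T, u s)) := by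
    refine intervalIntegral.tendsto_integral_filter_of_dominated_convergence (fun _ => C) ?_ ?_ ?_ ?_
    · refine Eventually.of_forall fun n => Measurable.aestronglyMeasurable ?_
      have h1 : Measurable fun s : ℝ => ⌈s / (T / n)⌉ := by fun_prop
      exact (measurable_from_top (f := fun m : ℤ => u (m * (T / n)))).comp h1
    · exact Eventually.of_forall fun n => ae_of_all _ fun s _ => hC _
    · exact intervalIntegrable_const
    · refine ae_of_all _ fun s hs => ?_
      rw [Set.uIoc_of_le hT.le] at hs
      refine tendsto_const_nhds.congr' ?_
      filter_upwards [(tendsto_ceil_mesh hT).eventually (hu s hs.1)] with n hn using hn.symm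
  refine hmain.congr' ?_
  filter_upwards [eventually_gt_atTop 0] with n hn
  have hn' : (0 : ℝ) < n := by exact_mod_cast hn
  have hh : 0 < T / n := div_pos hT hn'
  have hint : ∀ k : ℕ, Set.EqOn (fun s => u (⌈s / (T / n)⌉ * (T / n)))
      (fun _ => u ((k + 1 : ℕ) * (T / n))) (Set.uIoc (k * (T / n)) ((k + 1 : ℕ) * (T / n))) := by
    intro k s hs
    rw [Set.uIoc_of_le (by gcongr; simp)] at hs
    have : ⌈s / (T / n)⌉ = (k + 1 : ℕ) := by
      rw [Int.ceil_eq_iff]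
      constructor
      · rw [lt_div_iff₀ hh]; push_cast; simpa using hs.1
      · rw [div_le_iff₀ hh]; exact_mod_cast hs.2
    simp only [this]
    norm_cast
  have hsplit := intervalIntegral.sum_integral_adjacent_intervals (n := n)
    (f := fun s => u (⌈s / (T / n)⌉ * (T / n))) (a := fun k : ℕ => (k : ℝ) * (T / n)) (μ := volume)
    (fun k _ => (intervalIntegrable_congr (hint k)).2 intervalIntegrable_const)
  have e0 : ((0 : ℕ) : ℝ) * (T / n) = 0 := by simp
  have e1 : (n : ℝ) * (T / n) = T := by field_simp
  simp only [e0, e1] at hsplit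
  rw [← hsplit]
  refine Finset.sum_congr rfl fun k _ => ?_
  rw [intervalIntegral.integral_congr_ae (ae_of_all _ fun s hs => hint k hs), intervalIntegral.integral_const, smul_eq_mul]
  push_cast
  ring

end Riemann

/-! ### The chain sampled on a grid as a matrix power. -/

section Chain

variable {Λ Ω : Type*} [Countable Λ] [MeasurableSpace Ω] {p : ℝ≥0 → Λ → Λ → ℝ} {a : Λ}
  {P : Measure Ω} [IsProbabilityMeasure P] {X : ℝ≥0 → Ω → Λ}
  {ι : Type*} [Fintype ι] [DecidableEq ι]

lemma IsMarkovChainFrom.measurable_comp (hX : IsMarkovChainFrom p a P X) {β : Type*}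
    [MeasurableSpace β] (f : Λ → β) (t : ℝ≥0) : Measurable fun ω => f (X t ω) := by
  let _ : MeasurableSpace Λ := ⊤
  have hXt : Measurable (X t) := measurable_to_countable' fun x => hX.measurable t x
  exact (measurable_from_top (f := f)).comp hXt

lemma IsMarkovChainFrom.ae_zero_eq (hX : IsMarkovChainFrom p a P X) : ∀ᵐ ω ∂P, X 0 ω = a := by
  have h := hX.finite_dim 0 (fun _ => 0) (fun _ => a) monotone_const rfl rfl
  simp only [Nat.le_zero, forall_eq, Finset.range_zero, Finset.prod_empty] at h
  change {ω | X 0 ω = a} ∈ ae P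
  rw [mem_ae_iff_prob_eq_one (hX.measurable 0 a), ← ENNReal.ofReal_toReal (measure_ne_top P {ω | X 0 ω = a}), ← Measure.real, h,
    ENNReal.ofReal_one]

/-- The one-step matrix of the chain with time step `h`, with the weight `f` at the end point. -/
def stepMatrix (p : ℝ≥0 → Λ → Λ → ℝ) (h : ℝ≥0) (j : ι → Λ) (f : Λ → ℂ) : Matrix ι ι ℂ :=
  Matrix.of fun α β => (p h (j α) (j β) : ℂ) * f (j β)

/-- The event that the chain follows the path `x` for the first `m` steps. -/
def pathEvent (X : ℝ≥0 → Ω → Λ) (h : ℝ≥0) (m : ℕ) (x : ℕ → Λ) : Set Ω :=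
  {ω | ∀ i ≤ m, X ((i : ℝ≥0) * h) ω = x i}

lemma IsMarkovChainFrom.measurableSet_pathEvent (hX : IsMarkovChainFrom p a P X) (h : ℝ≥0) (m : ℕ)
    (x : ℕ → Λ) : MeasurableSet (pathEvent X h m x) := by
  have : pathEvent X h m x = ⋂ i ∈ Set.Iic m, {ω | X ((i : ℝ≥0) * h) ω = x i} := by
    ext; simp [pathEvent]
  rw [this]
  exact MeasurableSet.biInter (Set.to_countable _) fun i _ => hX.measurable _ _

lemma IsMarkovChainFrom.real_pathEvent (hX : IsMarkovChainFrom p a P X) (h : ℝ≥0) (m : ℕ)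
    (x : ℕ → Λ) (hx : x 0 = a) :
    P.real (pathEvent X h m x) = ∏ i ∈ Finset.range m, p h (x i) (x (i + 1)) := by
  have := hX.finite_dim m (fun i => (i : ℝ≥0) * h) x
    (fun i k hik => mul_le_mul_left (by exact_mod_cast hik) h) (by simp) hx
  refine this.trans (Finset.prod_congr rfl fun i _ => ?_)
  congr 1
  push_cast
  rw [add_mul, one_mul, add_tsub_cancel_left]

lemma IsMarkovChainFrom.integral_pathEvent (hX : IsMarkovChainFrom p a P X) (h : ℝ≥0) (m : ℕ)
    (x : ℕ → Λ) (hx : x 0 = a) :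
    ∫ ω, (pathEvent X h m x).indicator (fun _ => (1 : ℂ)) ω ∂P =
      ∏ i ∈ Finset.range m, (p h (x i) (x (i + 1)) : ℂ) := by
  rw [integral_indicator (hX.measurableSet_pathEvent h m x), setIntegral_const,
    hX.real_pathEvent h m x hx]
  simp

/-- The Markov property is available only through probabilities of complete paths, so the induction
on the `n` remaining steps carries a prescribed past of length `m`. Each step sums over the next
position. -/
lemma IsMarkovChainFrom.integral_path (hX : IsMarkovChainFrom p a P X) (h : ℝ≥0) {j : ι → Λ}
    (hj : Function.Injective j) {f : Λ → ℂ} (hf : ∀ y, y ∉ Set.range j → f y = 0) (β : ι)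
    (n m : ℕ) (x : ℕ → ι) (hx : j (x 0) = a) :
    ∫ ω, (pathEvent X h m (j ∘ x)).indicator (fun _ => (1 : ℂ)) ω *
      ((∏ k ∈ Finset.range n, f (X (((m + k + 1 : ℕ) : ℝ≥0) * h) ω)) *
        Set.indicator {ω | X (((m + n : ℕ) : ℝ≥0) * h) ω = j β} (fun _ => (1 : ℂ)) ω) ∂P =
      (∏ i ∈ Finset.range m, (p h (j (x i)) (j (x (i + 1))) : ℂ)) *
        (stepMatrix p h j f ^ n) (x m) β := by
  induction n generalizing m x with
  | zero =>
    simp only [Finset.range_zero, Finset.prod_empty, one_mul, add_zero, pow_zero]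
    by_cases hb : x m = β
    · have : ∀ ω, (pathEvent X h m (j ∘ x)).indicator (fun _ => (1 : ℂ)) ω *
          Set.indicator {ω | X ((m : ℝ≥0) * h) ω = j β} (fun _ => (1 : ℂ)) ω =
          (pathEvent X h m (j ∘ x)).indicator (fun _ => (1 : ℂ)) ω := by
        intro ω
        by_cases hω : ω ∈ pathEvent X h m (j ∘ x)
        · have h1 : ω ∈ {ω | X ((m : ℝ≥0) * h) ω = j β} := by
            change X ((m : ℝ≥0) * h) ω = j β
            rw [hω m le_rfl, Function.comp_apply, hb]
          rw [Set.indicator_of_mem hω, Set.indicator_of_mem h1, one_mul]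
        · simp [hω]
      simp only [this]
      rw [hX.integral_pathEvent h m (j ∘ x) hx, hb, Matrix.one_apply_eq, mul_one]
      rfl
    · have : ∀ ω, (pathEvent X h m (j ∘ x)).indicator (fun _ => (1 : ℂ)) ω *
          Set.indicator {ω | X ((m : ℝ≥0) * h) ω = j β} (fun _ => (1 : ℂ)) ω = 0 := by
        intro ω
        by_cases hω : ω ∈ pathEvent X h m (j ∘ x)
        · have h1 : ω ∉ {ω | X ((m : ℝ≥0) * h) ω = j β} := by
            intro h1
            have h2 := hω m le_rfl
            rw [show X ((m : ℝ≥0) * h) ω = j β from h1] at h2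
            exact hb (hj h2).symm
          rw [Set.indicator_of_notMem h1, mul_zero]
        · simp [hω]
      simp only [this]
      rw [Matrix.one_apply_ne hb, integral_zero, mul_zero]
  | succ n ih =>
    set B : ℝ := ∑ γ, ‖f (j γ)‖ with hB
    have hfB : ∀ y, ‖f y‖ ≤ B := by
      intro y
      by_cases hy : y ∈ Set.range j
      · obtain ⟨γ, rfl⟩ := hy
        exact Finset.single_le_sum (f := fun γ => ‖f (j γ)‖) (fun _ _ => norm_nonneg _)
          (Finset.mem_univ γ)
      · rw [hf y hy, norm_zero]
        exact Finset.sum_nonneg fun _ _ => norm_nonneg _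
    -- Split according to the position at time `(m + 1) h`, recorded by `Function.update`. Positions
    -- outside the range of `j` are removed by `f`, which leaves a finite sum.
    have hdecomp : ∀ ω, (pathEvent X h m (j ∘ x)).indicator (fun _ => (1 : ℂ)) ω *
        ((∏ k ∈ Finset.range (n + 1), f (X (((m + k + 1 : ℕ) : ℝ≥0) * h) ω)) *
          Set.indicator {ω | X (((m + (n + 1) : ℕ) : ℝ≥0) * h) ω = j β} (fun _ => (1 : ℂ)) ω) =
        ∑ γ, f (j γ) * ((pathEvent X h (m + 1)
          (j ∘ Function.update x (m + 1) γ)).indicator (fun _ => (1 : ℂ)) ω *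
        ((∏ k ∈ Finset.range n, f (X (((m + 1 + k + 1 : ℕ) : ℝ≥0) * h) ω)) *
          Set.indicator {ω | X (((m + 1 + n : ℕ) : ℝ≥0) * h) ω = j β} (fun _ => (1 : ℂ)) ω)) := by
      intro ω
      have hmem : ∀ γ, ω ∈ pathEvent X h (m + 1) (j ∘ Function.update x (m + 1) γ) ↔
          ω ∈ pathEvent X h m (j ∘ x) ∧ X (((m + 1 : ℕ) : ℝ≥0) * h) ω = j γ := by
        intro γ
        constructor
        · intro hω
          refine ⟨fun i hi => ?_, ?_⟩
          · rw [hω i (by omega), Function.comp_apply, Function.update_of_ne (by omega)]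
            rfl
          · rw [hω (m + 1) le_rfl, Function.comp_apply, Function.update_self]
        · rintro ⟨h1, h2⟩ i hi
          rcases Nat.lt_or_ge m i with hlt | hle
          · obtain rfl : i = m + 1 := by omega
            rw [h2, Function.comp_apply, Function.update_self]
          · rw [h1 i hle, Function.comp_apply, Function.comp_apply,
              Function.update_of_ne (by omega)]
      have hprod : ∏ k ∈ Finset.range (n + 1), f (X (((m + k + 1 : ℕ) : ℝ≥0) * h) ω) =
          f (X (((m + 1 : ℕ) : ℝ≥0) * h) ω) *
            ∏ k ∈ Finset.range n, f (X (((m + 1 + k + 1 : ℕ) : ℝ≥0) * h) ω) := by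
        rw [Finset.prod_range_succ', mul_comm]
        congr 1
        refine Finset.prod_congr rfl fun k _ => ?_
        rw [show m + (k + 1) + 1 = m + 1 + k + 1 by ring]
      rw [hprod, show m + (n + 1) = m + 1 + n by ring]
      simp only [← mul_assoc]
      rw [← Finset.sum_mul, ← Finset.sum_mul]
      congr 2
      by_cases hω : ω ∈ pathEvent X h m (j ∘ x)
      · rw [Set.indicator_of_mem hω, one_mul]
        by_cases hy : X (((m + 1 : ℕ) : ℝ≥0) * h) ω ∈ Set.range j
        · obtain ⟨δ, hδ⟩ := hy
          rw [Finset.sum_eq_single δ]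
          · rw [Set.indicator_of_mem ((hmem δ).2 ⟨hω, hδ.symm⟩), mul_one, hδ]
          · intro γ _ hγ
            rw [Set.indicator_of_notMem, mul_zero]
            intro hc
            exact hγ (hj (((hmem γ).1 hc).2.symm.trans hδ.symm))
          · simp
        · rw [hf _ hy]
          symm
          refine Finset.sum_eq_zero fun γ _ => ?_
          rw [Set.indicator_of_notMem, mul_zero]
          intro hc
          exact hy ⟨γ, ((hmem γ).1 hc).2.symm⟩
      · rw [Set.indicator_of_notMem hω, zero_mul]
        symm
        refine Finset.sum_eq_zero fun γ _ => ?_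
        rw [Set.indicator_of_notMem, mul_zero]
        exact fun hc => hω ((hmem γ).1 hc).1
    simp only [hdecomp]
    rw [integral_finsetSum]
    · have hih : ∀ γ, _ := fun γ => ih (m + 1) (Function.update x (m + 1) γ)
        (by rw [Function.update_of_ne (by omega)]; exact hx)
      simp only [integral_const_mul, hih]
      rw [pow_succ', Matrix.mul_apply, Finset.mul_sum]
      refine Finset.sum_congr rfl fun γ _ => ?_
      rw [Finset.prod_range_succ, Function.update_self, Function.update_of_ne (by omega)]
      have hp' : ∏ i ∈ Finset.range m, (p h (j (Function.update x (m + 1) γ i))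
          (j (Function.update x (m + 1) γ (i + 1))) : ℂ) =
          ∏ i ∈ Finset.range m, (p h (j (x i)) (j (x (i + 1))) : ℂ) := by
        refine Finset.prod_congr rfl fun i hi => ?_
        rw [Finset.mem_range] at hi
        rw [Function.update_of_ne (by omega), Function.update_of_ne (by omega)]
      rw [hp', stepMatrix, Matrix.of_apply]
      ring
    · intro γ _
      refine Integrable.const_mul (Integrable.of_bound (C := B ^ n) ?_ ?_) _
      · refine Measurable.aestronglyMeasurable ?_
        refine Measurable.mul ?_ (Measurable.mul ?_ ?_)
        · exact measurable_const.indicator (hX.measurableSet_pathEvent _ _ _)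
        · exact Finset.measurable_prod _ fun k _ => hX.measurable_comp f _
        · exact measurable_const.indicator (hX.measurable _ _)
      · refine ae_of_all _ fun ω => ?_
        have hi : ∀ S : Set Ω, ‖S.indicator (fun _ => (1 : ℂ)) ω‖ ≤ 1 := fun S => by
          by_cases hS : ω ∈ S <;> simp [hS]
        have hpr : ‖∏ k ∈ Finset.range n, f (X (((m + 1 + k + 1 : ℕ) : ℝ≥0) * h) ω)‖ ≤ B ^ n := by
          rw [norm_prod]
          refine (Finset.prod_le_prod (fun _ _ => norm_nonneg _) fun k _ => hfB _).trans ?_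
          simp
        rw [norm_mul, norm_mul]
        calc _ ≤ 1 * (B ^ n * 1) := by
              gcongr
              · exact hi _
              · exact hi _
          _ = B ^ n := by ring

lemma IsMarkovChainFrom.integral_skeleton (hX : IsMarkovChainFrom p a P X) (h : ℝ≥0) {j : ι → Λ}
    (hj : Function.Injective j) {f : Λ → ℂ} (hf : ∀ y, y ∉ Set.range j → f y = 0) (α β : ι)
    (hα : j α = a) (n : ℕ) :
    ∫ ω, (∏ k ∈ Finset.range n, f (X (((k + 1 : ℕ) : ℝ≥0) * h) ω)) *
        Set.indicator {ω | X ((n : ℝ≥0) * h) ω = j β} (fun _ => (1 : ℂ)) ω ∂P =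
      (stepMatrix p h j f ^ n) α β := by
  have := hX.integral_path h hj hf β n 0 (fun _ => α) hα
  simp only [Finset.range_zero, Finset.prod_empty, one_mul, zero_add] at this
  rw [← this]
  refine integral_congr_ae ?_
  filter_upwards [hX.ae_zero_eq] with ω hω
  rw [Set.indicator_of_mem (a := ω) (s := pathEvent X h 0 _), one_mul]
  intro i hi
  obtain rfl : i = 0 := by omega
  simp [hω, hα]

end Chain

/-! ### The Feynman–Kac formula with killing outside a finite set. -/

section FeynmanKac

variable {Λ Ω : Type*} [Countable Λ] [MeasurableSpace Ω] {p : ℝ≥0 → Λ → Λ → ℝ} {a : Λ}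
  {P : Measure Ω} [IsProbabilityMeasure P] {X : ℝ≥0 → Ω → Λ}
  {ι : Type*} [Fintype ι] [DecidableEq ι]

/-- Right-continuity of the path of `ω`, for the discrete topology. -/
def RightContinuousAt (X : ℝ≥0 → Ω → Λ) (ω : Ω) : Prop :=
  ∀ t, ∀ᶠ s in 𝓝[≥] t, X s ω = X t ω

/-- The Riemann sum that approximates the local time. -/
noncomputable def approxLocalTime (X : ℝ≥0 → Ω → Λ) (T : ℝ≥0) (n : ℕ) (ω : Ω) (y : Λ) : ℝ :=
  ∑ k ∈ Finset.range n, (T : ℝ) / n *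
    Set.indicator {y} (fun _ => (1 : ℝ)) (X (((k + 1 : ℕ) : ℝ≥0) * (T / n)) ω)

lemma tendsto_approxLocalTime {ω : Ω} (hω : RightContinuousAt X ω) {T : ℝ≥0} (hT : 0 < T) (y : Λ) :
    Tendsto (fun n => approxLocalTime X T n ω y) atTop (𝓝 (localTime X T ω y)) := by
  have hT' : (0 : ℝ) < T := by exact_mod_cast hT
  have h := tendsto_riemann_sum hT' (C := 1)
    (u := Set.indicator {s : ℝ | X s.toNNReal ω = y} (fun _ => (1 : ℝ))) ?_ ?_
  · refine h.congr fun n => Finset.sum_congr rfl fun k _ => ?_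
    have e : (((k + 1 : ℕ) : ℝ) * ((T : ℝ) / n)).toNNReal = ((k + 1 : ℕ) : ℝ≥0) * (T / n) := by
      rw [← Real.toNNReal_coe (r := ((k + 1 : ℕ) : ℝ≥0) * (T / n))]
      push_cast
      rfl
    congr 1
    by_cases hy : X (((k + 1 : ℕ) : ℝ≥0) * (T / n)) ω = y
    · rw [Set.indicator_of_mem (by rw [Set.mem_ofPred_eq, e]; exact hy),
        Set.indicator_of_mem (by exact hy)]
    · rw [Set.indicator_of_notMem (by rw [Set.mem_ofPred_eq, e]; exact hy),
        Set.indicator_of_notMem (by exact hy)]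
  · intro s
    by_cases hs : s ∈ {s : ℝ | X s.toNNReal ω = y}
    · rw [Set.indicator_of_mem hs]; simp
    · rw [Set.indicator_of_notMem hs]; simp
  · intro s _
    have htend : Tendsto Real.toNNReal (𝓝[≥] s) (𝓝[≥] s.toNNReal) := by
      refine tendsto_nhdsWithin_iff.2 ⟨?_, ?_⟩
      · exact (continuous_real_toNNReal.tendsto s).mono_left nhdsWithin_le_nhds
      · filter_upwards [self_mem_nhdsWithin] with r hr using Real.toNNReal_mono hr
    filter_upwards [htend.eventually (hω s.toNNReal)] with r hr
    by_cases hs : s ∈ {s : ℝ | X s.toNNReal ω = y}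
    · have hr' : r ∈ {s : ℝ | X s.toNNReal ω = y} := hr.trans hs
      rw [Set.indicator_of_mem hs, Set.indicator_of_mem hr']
    · have hr' : r ∉ {s : ℝ | X s.toNNReal ω = y} := fun h => hs (hr.symm.trans h)
      rw [Set.indicator_of_notMem hs, Set.indicator_of_notMem hr']

/-- The event that the chain stays in the range of `j` up to time `T`. -/
def stayEvent (X : ℝ≥0 → Ω → Λ) (T : ℝ≥0) (j : ι → Λ) : Set Ω :=
  {ω | ∀ s ≤ T, X s ω ∈ Set.range j}

/-- The weight `exp (-h v)` on the range of `j`, zero elsewhere. -/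
noncomputable def expWeight (j : ι → Λ) (v : ι → ℂ) (h : ℝ≥0) (y : Λ) : ℂ :=
  ∑ γ, Set.indicator {j γ} (fun _ => Complex.exp (-((h : ℝ) * v γ))) y

lemma indicator_singleton_apply {j : ι → Λ} (hj : Function.Injective j) {M : Type*} [Zero M]
    (δ γ : ι) (z : M) : Set.indicator {j δ} (fun _ => z) (j γ) = if γ = δ then z else 0 := by
  by_cases h : γ = δ
  · subst h; simp
  · have hn : j γ ∉ ({j δ} : Set Λ) := fun hc => h (hj hc)
    rw [Set.indicator_of_notMem hn, if_neg h]

lemma expWeight_apply {j : ι → Λ} (hj : Function.Injective j) (v : ι → ℂ) (h : ℝ≥0) (γ : ι) :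
    expWeight j v h (j γ) = Complex.exp (-((h : ℝ) * v γ)) := by
  simp [expWeight, indicator_singleton_apply hj]

lemma expWeight_of_notMem {j : ι → Λ} (v : ι → ℂ) (h : ℝ≥0) {y : Λ} (hy : y ∉ Set.range j) :
    expWeight j v h y = 0 :=
  Finset.sum_eq_zero fun γ _ => Set.indicator_of_notMem (fun hc => hy ⟨γ, hc.symm⟩) _

lemma norm_expWeight_le {j : ι → Λ} (hj : Function.Injective j) (v : ι → ℂ) (h : ℝ≥0) (y : Λ) :
    ‖expWeight j v h y‖ ≤ Real.exp (h * ∑ γ, ‖v γ‖) := by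
  by_cases hy : y ∈ Set.range j
  · obtain ⟨γ, rfl⟩ := hy
    rw [expWeight_apply hj, Complex.norm_exp, Real.exp_le_exp]
    refine (Complex.re_le_norm _).trans ?_
    rw [norm_neg, norm_mul, Complex.norm_real, Real.norm_of_nonneg h.coe_nonneg]
    gcongr
    exact Finset.single_le_sum (f := fun γ => ‖v γ‖) (fun _ _ => norm_nonneg _)
      (Finset.mem_univ γ)
  · rw [expWeight_of_notMem v h hy, norm_zero]
    exact (Real.exp_pos _).le

lemma prod_expWeight_of_stay {ω : Ω} {T : ℝ≥0} {j : ι → Λ} (hj : Function.Injective j) (v : ι → ℂ)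
    (hω : ω ∈ stayEvent X T j) {n : ℕ} (hn : 0 < n) :
    ∏ k ∈ Finset.range n, expWeight j v (T / n) (X (((k + 1 : ℕ) : ℝ≥0) * (T / n)) ω) =
      Complex.exp (-∑ γ, v γ * (approxLocalTime X T n ω (j γ) : ℂ)) := by
  have hn' : (0 : ℝ≥0) < n := by exact_mod_cast hn
  have hfac : ∀ k ∈ Finset.range n,
      expWeight j v (T / n) (X (((k + 1 : ℕ) : ℝ≥0) * (T / n)) ω) =
      Complex.exp (-∑ γ, v γ * (((T : ℝ) / n * Set.indicator {j γ} (fun _ => (1 : ℝ))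
        (X (((k + 1 : ℕ) : ℝ≥0) * (T / n)) ω) : ℝ) : ℂ)) := by
    intro k hk
    rw [Finset.mem_range] at hk
    have hle : ((k + 1 : ℕ) : ℝ≥0) * (T / n) ≤ T := by
      calc ((k + 1 : ℕ) : ℝ≥0) * (T / n) ≤ (n : ℝ≥0) * (T / n) := by
            gcongr
            exact_mod_cast hk
        _ = T := by field_simp
    obtain ⟨δ, hδ⟩ := hω _ hle
    rw [← hδ, expWeight_apply hj]
    congr 2
    simp only [indicator_singleton_apply hj]
    rw [Finset.sum_eq_single δ]
    · simp [mul_comm]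
    · intro γ _ hγ
      simp [Ne.symm hγ]
    · simp
  rw [Finset.prod_congr rfl hfac, ← Complex.exp_sum]
  congr 1
  simp only [approxLocalTime, Complex.ofReal_sum, Finset.mul_sum, Finset.sum_neg_distrib]
  rw [Finset.sum_comm]

lemma tendsto_nnreal_div_nat (T : ℝ≥0) : Tendsto (fun n : ℕ => T / (n : ℝ≥0)) atTop (𝓝 0) := by
  rw [← NNReal.tendsto_coe]
  simpa using tendsto_const_div_atTop_nhds_zero_nat (T : ℝ)

/-- By right-continuity a path that is outside the range at some `s < T` stays outside for a while,
so every sufficiently fine grid has a point there, and its weight is zero. -/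
lemma eventually_prod_expWeight_eq_zero {ω : Ω} (hω : RightContinuousAt X ω) {T : ℝ≥0}
    (hT : 0 < T) {j : ι → Λ} (v : ι → ℂ) (hs : ω ∉ stayEvent X T j) :
    ∀ᶠ n : ℕ in atTop,
      ∏ k ∈ Finset.range n, expWeight j v (T / n) (X (((k + 1 : ℕ) : ℝ≥0) * (T / n)) ω) = 0 := by
  obtain ⟨s, hsT, hsj⟩ : ∃ s ≤ T, X s ω ∉ Set.range j := by
    simpa [stayEvent] using hs
  rcases hsT.lt_or_eq with hlt | rfl
  · have htend : Tendsto (fun n : ℕ => ((⌊s / (T / n)⌋₊ + 1 : ℕ) : ℝ≥0) * (T / n)) atTop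
        (𝓝[≥] s) := by
      have hge : ∀ n : ℕ, 0 < n → s ≤ ((⌊s / (T / n)⌋₊ + 1 : ℕ) : ℝ≥0) * (T / n) := by
        intro n hn
        have hh : 0 < T / n := div_pos hT (by exact_mod_cast hn)
        rw [← div_le_iff₀ hh]
        push_cast
        exact (Nat.lt_floor_add_one _).le
      refine tendsto_nhdsWithin_iff.2 ⟨?_, ?_⟩
      · have h0 : Tendsto (fun n : ℕ => s + T / n) atTop (𝓝 s) := by
          simpa using tendsto_const_nhds.add (tendsto_nnreal_div_nat T)
        refine tendsto_of_tendsto_of_tendsto_of_le_of_le' tendsto_const_nhds h0 ?_ ?_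
        · filter_upwards [eventually_gt_atTop 0] with n hn using hge n hn
        · filter_upwards [eventually_gt_atTop 0] with n hn
          have hh : 0 < T / n := div_pos hT (by exact_mod_cast hn)
          push_cast
          rw [add_mul, one_mul]
          gcongr
          rw [← le_div_iff₀ hh]
          exact Nat.floor_le zero_le
      · filter_upwards [eventually_gt_atTop 0] with n hn using hge n hn
    filter_upwards [htend.eventually (hω s), eventually_gt_atTop 0] with n hX hn
    have hn' : (0 : ℝ≥0) < n := by exact_mod_cast hn
    refine Finset.prod_eq_zero (i := ⌊s / (T / n)⌋₊) ?_
      (expWeight_of_notMem v _ (by rw [hX]; exact hsj))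
    rw [Finset.mem_range, Nat.floor_lt zero_le, div_lt_iff₀ (div_pos hT hn')]
    calc s < T := hlt
      _ = n * (T / n) := by field_simp
  · filter_upwards [eventually_gt_atTop 0] with n hn
    have hn' : (0 : ℝ≥0) < n := by exact_mod_cast hn
    refine Finset.prod_eq_zero (i := n - 1) (Finset.mem_range.2 (by omega))
      (expWeight_of_notMem v _ ?_)
    rw [Nat.sub_add_cancel hn, mul_div_cancel₀ _ hn'.ne']
    exact hsj

lemma tendsto_prod_expWeight {ω : Ω} (hω : RightContinuousAt X ω) {T : ℝ≥0}
    (hT : 0 < T) {j : ι → Λ} (hj : Function.Injective j) (v : ι → ℂ) :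
    Tendsto (fun n : ℕ =>
      ∏ k ∈ Finset.range n, expWeight j v (T / n) (X (((k + 1 : ℕ) : ℝ≥0) * (T / n)) ω)) atTop
      (𝓝 ((stayEvent X T j).indicator (fun _ => (1 : ℂ)) ω *
        Complex.exp (-∑ γ, v γ * (localTime X T ω (j γ) : ℂ)))) := by
  by_cases hs : ω ∈ stayEvent X T j
  · rw [Set.indicator_of_mem hs, one_mul]
    have h1 : Tendsto (fun n : ℕ => Complex.exp (-∑ γ, v γ * (approxLocalTime X T n ω (j γ) : ℂ)))
        atTop (𝓝 (Complex.exp (-∑ γ, v γ * (localTime X T ω (j γ) : ℂ)))) := by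
      refine (Complex.continuous_exp.tendsto _).comp (Tendsto.neg (tendsto_finsetSum _ fun γ _ => ?_))
      exact ((Complex.continuous_ofReal.tendsto _).comp
        (tendsto_approxLocalTime hω hT (j γ))).const_mul _
    refine h1.congr' ?_
    filter_upwards [eventually_gt_atTop 0] with n hn
    rw [prod_expWeight_of_stay hj v hs hn]
  · rw [Set.indicator_of_notMem hs, zero_mul]
    refine tendsto_const_nhds.congr' ?_
    filter_upwards [eventually_prod_expWeight_eq_zero hω hT v hs] with n hn using hn.symm

lemma tendsto_nat_mul_exp_sub_one (w : ℂ) :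
    Tendsto (fun n : ℕ => (n : ℂ) * (Complex.exp (w / n) - 1)) atTop (𝓝 w) := by
  have hd : HasDerivAt (fun t : ℝ => Complex.exp (t * w)) w 0 := by
    have h1 : HasDerivAt (fun t : ℝ => (t : ℂ) * w) (1 * w) 0 :=
      (HasDerivAt.ofReal_comp (hasDerivAt_id (0 : ℝ))).mul_const w
    simpa using h1.cexp
  have h2 := hasDerivAt_iff_tendsto_slope_zero.1 hd
  have h3 : Tendsto (fun n : ℕ => (n : ℝ)⁻¹) atTop (𝓝[≠] 0) := by
    refine tendsto_nhdsWithin_iff.2 ⟨tendsto_inv_atTop_nhds_zero_nat, ?_⟩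
    filter_upwards [eventually_gt_atTop 0] with n hn
    have : (n : ℝ) ≠ 0 := by exact_mod_cast hn.ne'
    simpa using this
  refine (h2.comp h3).congr fun n => ?_
  simp [div_eq_inv_mul]

lemma tendsto_stepMatrix {A : Λ → Λ → ℝ} (hp : IsTransitionFunction p) (hpA : HasGenerator p A)
    {T : ℝ≥0} (hT : 0 < T) {j : ι → Λ} (hj : Function.Injective j) (v : ι → ℂ) (α β : ι) :
    Tendsto (fun n : ℕ =>
      (n : ℂ) * (stepMatrix p (T / n) j (expWeight j v (T / n)) - 1) α β) atTop
      (𝓝 (((T : ℂ) • (Matrix.of (fun γ δ => (A (j γ) (j δ) : ℂ)) - Matrix.diagonal v)) α β)) := by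
  have hp0 : (p 0 (j α) (j β) : ℂ) = (1 : Matrix ι ι ℂ) α β := by
    by_cases h : α = β
    · subst h; rw [hp.zero_self, Matrix.one_apply_eq]; simp
    · rw [hp.zero_ne _ _ (fun hc => h (hj hc)), Matrix.one_apply_ne h]; simp
  have hmesh : Tendsto (fun n : ℕ => T / (n : ℝ≥0)) atTop (𝓝[>] 0) := by
    refine tendsto_nhdsWithin_iff.2 ⟨tendsto_nnreal_div_nat T, ?_⟩
    filter_upwards [eventually_gt_atTop 0] with n hn
    exact div_pos hT (by exact_mod_cast hn)
  have h1 : Tendsto (fun n : ℕ => (T : ℂ) * ((((p (T / n) (j α) (j β) - p 0 (j α) (j β)) /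
      ((T / n : ℝ≥0) : ℝ) : ℝ)) : ℂ)) atTop (𝓝 ((T : ℂ) * (A (j α) (j β) : ℂ))) :=
    ((Complex.continuous_ofReal.tendsto _).comp ((hpA (j α) (j β)).comp hmesh)).const_mul _
  have h2 : Tendsto (fun n : ℕ => Complex.exp (-((((T / n : ℝ≥0) : ℝ) : ℂ) * v β))) atTop
      (𝓝 1) := by
    have h3 : Tendsto (fun n : ℕ => ((((T / n : ℝ≥0) : ℝ) : ℂ))) atTop (𝓝 0) := by
      have := (Complex.continuous_ofReal.tendsto _).comp
        ((NNReal.continuous_coe.tendsto _).comp (tendsto_nnreal_div_nat T))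
      simpa [Function.comp_def] using this
    have h4 := (Complex.continuous_exp.tendsto _).comp ((h3.mul_const (v β)).neg)
    refine (by simpa using h4 : Tendsto _ _ _).congr fun n => ?_
    simp
  have h5 := (tendsto_nat_mul_exp_sub_one (-((T : ℂ) * v β))).const_mul ((1 : Matrix ι ι ℂ) α β)
  -- With `e = exp (-(T / n) v_β)` and `p₀` the identity matrix: `n (p e - p₀) = n (p - p₀) e + p₀ n
  -- (e - 1)`. The generator gives the first limit, the derivative of the exponential the second.
  have h6 := (h1.mul h2).add h5
  have e : ((T : ℂ) • (Matrix.of (fun γ δ => (A (j γ) (j δ) : ℂ)) - Matrix.diagonal v)) α β =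
      (T : ℂ) * (A (j α) (j β) : ℂ) * 1 + (1 : Matrix ι ι ℂ) α β * -((T : ℂ) * v β) := by
    rw [Matrix.smul_apply, Matrix.sub_apply, Matrix.of_apply, smul_eq_mul, Matrix.diagonal_apply,
      Matrix.one_apply]
    split_ifs with hαβ
    · subst hαβ; ring
    · ring
  rw [e]
  refine h6.congr' ?_
  filter_upwards [eventually_gt_atTop 0] with n hn
  have hn' : (n : ℂ) ≠ 0 := by exact_mod_cast hn.ne'
  have hT' : ((T : ℝ) : ℂ) ≠ 0 := by exact_mod_cast hT.ne'
  rw [stepMatrix, Matrix.sub_apply, Matrix.of_apply, expWeight_apply hj, ← hp0]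
  have e2 : -((T : ℂ) * v β) / n = -((((T / n : ℝ≥0) : ℝ) : ℂ) * v β) := by
    push_cast; ring
  rw [e2]
  push_cast
  field_simp
  ring

/-- The Feynman–Kac formula for the chain killed outside of a finite set. -/
theorem IsMarkovChainFrom.hasSum_feynmanKac {A : Λ → Λ → ℝ} (hX : IsMarkovChainFrom p a P X)
    (hp : IsTransitionFunction p) (hpA : HasGenerator p A) {T : ℝ≥0} (hT : 0 < T) {j : ι → Λ}
    (hj : Function.Injective j) (v : ι → ℂ) (α β : ι) (hα : j α = a) :
    HasSum (fun k : ℕ => ((k.factorial : ℂ)⁻¹) *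
      (((T : ℂ) • (Matrix.of (fun γ δ => (A (j γ) (j δ) : ℂ)) - Matrix.diagonal v)) ^ k) α β)
      (∫ ω, (stayEvent X T j).indicator (fun _ => (1 : ℂ)) ω *
        Complex.exp (-∑ γ, v γ * (localTime X T ω (j γ) : ℂ)) *
        Set.indicator {ω | X T ω = j β} (fun _ => (1 : ℂ)) ω ∂P) := by
  refine hasSum_of_tendsto_matrix_pow (fun α β => tendsto_stepMatrix hp hpA hT hj v α β) ?_
  have hskel : ∀ n : ℕ, 0 < n → ∫ ω, (∏ k ∈ Finset.range n,
      expWeight j v (T / n) (X (((k + 1 : ℕ) : ℝ≥0) * (T / n)) ω)) *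
        Set.indicator {ω | X T ω = j β} (fun _ => (1 : ℂ)) ω ∂P =
      (stepMatrix p (T / n) j (expWeight j v (T / n)) ^ n) α β := by
    intro n hn
    have hn' : (n : ℝ≥0) ≠ 0 := by exact_mod_cast hn.ne'
    rw [← hX.integral_skeleton (T / n) hj (fun y hy => expWeight_of_notMem v _ hy) α β hα n,
      mul_div_cancel₀ _ hn']
  refine Tendsto.congr' (f₁ := fun n : ℕ => ∫ ω, (∏ k ∈ Finset.range n,
      expWeight j v (T / n) (X (((k + 1 : ℕ) : ℝ≥0) * (T / n)) ω)) *
        Set.indicator {ω | X T ω = j β} (fun _ => (1 : ℂ)) ω ∂P) ?_ ?_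
  · filter_upwards [eventually_gt_atTop 0] with n hn using hskel n hn
  · refine tendsto_integral_of_dominated_convergence
      (fun _ => Real.exp (T * ∑ γ, ‖v γ‖)) ?_ (integrable_const _) ?_ ?_
    · intro n
      refine Measurable.aestronglyMeasurable (Measurable.mul ?_ ?_)
      · exact Finset.measurable_prod _ fun k _ => hX.measurable_comp _ _
      · exact measurable_const.indicator (hX.measurable _ _)
    · intro n
      refine ae_of_all _ fun ω => ?_
      have hi : ‖Set.indicator {ω | X T ω = j β} (fun _ => (1 : ℂ)) ω‖ ≤ 1 := by
        by_cases hS : ω ∈ {ω | X T ω = j β}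
        · rw [Set.indicator_of_mem hS]; simp
        · rw [Set.indicator_of_notMem hS]; simp
      rw [norm_mul, norm_prod]
      refine (mul_le_of_le_one_right (Finset.prod_nonneg fun _ _ => norm_nonneg _) hi).trans ?_
      refine (Finset.prod_le_prod (fun _ _ => norm_nonneg _)
        fun k _ => norm_expWeight_le hj v _ _).trans ?_
      rw [Finset.prod_const, Finset.card_range, ← Real.exp_nat_mul, Real.exp_le_exp]
      rcases Nat.eq_zero_or_pos n with rfl | hn
      · simp only [Nat.cast_zero, zero_mul]
        positivity
      · have hn' : (n : ℝ) ≠ 0 := by exact_mod_cast hn.ne'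
        push_cast
        field_simp
        rfl
    · filter_upwards [hX.right_continuous] with ω hω
      exact (tendsto_prod_expWeight hω hT hj v).mul_const _

end FeynmanKac

/-! ### Uniqueness of a complex density with a given characteristic function. -/

section Uniqueness

variable {ι : Type*} [Fintype ι] [DecidableEq ι]

/-- The character `exp (i ∑ x, ξ x l x)`. -/
noncomputable def character (ξ l : ι → ℝ) : ℂ :=
  Complex.exp (Complex.I * ((∑ x, ξ x * l x : ℝ) : ℂ))

lemma norm_character (ξ l : ι → ℝ) : ‖character ξ l‖ = 1 := by
  rw [character, mul_comm, Complex.norm_exp_ofReal_mul_I]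

lemma continuous_character (ξ : ι → ℝ) : Continuous (character ξ) := by
  unfold character; fun_prop

lemma conj_character (ξ l : ι → ℝ) :
    (starRingEnd ℂ) (character ξ l) = character (-ξ) l := by
  rw [character, character, ← Complex.exp_conj, map_mul, Complex.conj_I, Complex.conj_ofReal]
  congr 1
  simp

lemma measure_ext_of_character {μ ν : Measure (ι → ℝ)} [IsFiniteMeasure μ] [IsFiniteMeasure ν]
    (h : ∀ ξ, ∫ l, character ξ l ∂μ = ∫ l, character ξ l ∂ν) : μ = ν := by
  refine Measure.ext_of_charFunDual (funext fun L => ?_)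
  have hL : ∀ l : ι → ℝ, Complex.exp (L l * Complex.I) =
      character (fun x => L (Pi.single x 1)) l := by
    intro l
    have : L l = ∑ x, L (Pi.single x 1) * l x := by
      conv_lhs => rw [pi_eq_sum_univ' l]
      simp [map_sum, mul_comm]
    rw [character, this, mul_comm]
  simp only [charFunDual_apply, hL]
  exact h _

/-- The negative part of the density is moved to the other side, so that uniqueness applies to the
two positive finite measures `μ₁` and `μ + μ₂`. -/
lemma integral_eq_of_character_real {μ σ : Measure (ι → ℝ)} [IsFiniteMeasure μ]
    {g : (ι → ℝ) → ℝ} (hgm : Measurable g) (hg : Integrable g σ)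
    (h : ∀ ξ, ∫ l, character ξ l * (g l : ℂ) ∂σ = ∫ l, character ξ l ∂μ)
    {F : (ι → ℝ) → ℂ} (hF : Measurable F) {C : ℝ} (hC : ∀ l, ‖F l‖ ≤ C) :
    ∫ l, F l * (g l : ℂ) ∂σ = ∫ l, F l ∂μ := by
  set μ₁ := σ.withDensity fun l => ENNReal.ofReal (g l) with hμ₁
  set μ₂ := σ.withDensity fun l => ENNReal.ofReal (-g l) with hμ₂
  have : IsFiniteMeasure μ₁ := isFiniteMeasure_withDensity_ofReal hg.2
  have : IsFiniteMeasure μ₂ := isFiniteMeasure_withDensity_ofReal hg.neg.2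
  have key : ∀ {G : (ι → ℝ) → ℂ} {C : ℝ}, Measurable G → (∀ l, ‖G l‖ ≤ C) →
      ∫ l, G l * (g l : ℂ) ∂σ = ∫ l, G l ∂μ₁ - ∫ l, G l ∂μ₂ := by
    intro G C hG hGC
    have e1 : ∫ l, G l ∂μ₁ = ∫ l, G l * ((max (g l) 0 : ℝ) : ℂ) ∂σ := by
      refine (integral_withDensity_eq_integral_smul (f := fun l => (g l).toNNReal)
        (by fun_prop) G).trans (integral_congr_ae (ae_of_all _ fun l => ?_))
      simp only [NNReal.smul_def, Real.coe_toNNReal', Complex.real_smul]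
      rw [mul_comm]
    have e2 : ∫ l, G l ∂μ₂ = ∫ l, G l * ((max (-g l) 0 : ℝ) : ℂ) ∂σ := by
      refine (integral_withDensity_eq_integral_smul (f := fun l => (-g l).toNNReal)
        (by fun_prop) G).trans (integral_congr_ae (ae_of_all _ fun l => ?_))
      simp only [NNReal.smul_def, Real.coe_toNNReal', Complex.real_smul]
      rw [mul_comm]
    have hint : ∀ {u : (ι → ℝ) → ℝ}, Integrable u σ →
        Integrable (fun l => G l * (u l : ℂ)) σ := fun hu =>
      hu.ofReal.bdd_mul hG.aestronglyMeasurable (ae_of_all _ hGC)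
    rw [e1, e2, ← integral_sub (hint hg.pos_part) (hint hg.neg_part)]
    refine integral_congr_ae (ae_of_all _ fun l => ?_)
    simp only
    rw [← mul_sub, ← Complex.ofReal_sub, max_zero_sub_max_neg_zero_eq_self]
  have hintF : ∀ (ν : Measure (ι → ℝ)) [IsFiniteMeasure ν] {G : (ι → ℝ) → ℂ} {C : ℝ},
      Measurable G → (∀ l, ‖G l‖ ≤ C) → Integrable G ν := fun ν _ G C hG hGC =>
    Integrable.of_bound hG.aestronglyMeasurable C (ae_of_all _ hGC)
  have heq : μ₁ = μ + μ₂ := by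
    refine measure_ext_of_character fun ξ => ?_
    have hm := (continuous_character ξ).measurable
    have hb : ∀ l, ‖character ξ l‖ ≤ 1 := fun l => (norm_character ξ l).le
    rw [integral_add_measure (hintF μ hm hb) (hintF μ₂ hm hb), ← h ξ, key hm hb]
    ring
  rw [key hF hC, heq, integral_add_measure (hintF μ hF hC) (hintF μ₂ hF hC)]
  ring

/-- A finite measure with the characteristic function of a complex density has this density. -/
lemma integral_eq_of_character {μ σ : Measure (ι → ℝ)} [IsFiniteMeasure μ]
    {g : (ι → ℝ) → ℂ} (hgm : Measurable g) (hg : Integrable g σ)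
    (h : ∀ ξ, ∫ l, character ξ l * g l ∂σ = ∫ l, character ξ l ∂μ)
    {F : (ι → ℝ) → ℂ} (hF : Measurable F) {C : ℝ} (hC : ∀ l, ‖F l‖ ≤ C) :
    ∫ l, F l * g l ∂σ = ∫ l, F l ∂μ := by
  have hint : ∀ {G : (ι → ℝ) → ℂ} {C : ℝ} {u : (ι → ℝ) → ℂ}, Measurable G → (∀ l, ‖G l‖ ≤ C) →
      Integrable u σ → Integrable (fun l => G l * u l) σ := fun hG hGC hu =>
    hu.bdd_mul hG.aestronglyMeasurable (ae_of_all _ hGC)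
  have hgc : Integrable (fun l => (starRingEnd ℂ) (g l)) σ :=
    hg.congr' (Complex.continuous_conj.comp_aestronglyMeasurable hg.1)
      (ae_of_all _ fun l => (Complex.norm_conj _).symm)
  -- Since `μ` is a positive measure, conjugation of the hypothesis at `-ξ` shows that the conjugate
  -- of `g` has the same transform. So `re g` has the transform of `μ` and `im g` that of zero;
  -- reality of the density need not be known beforehand.
  have hconj : ∀ ξ, ∫ l, character ξ l * (starRingEnd ℂ) (g l) ∂σ = ∫ l, character ξ l ∂μ := by
    intro ξ
    have h1 := congrArg (starRingEnd ℂ) (h (-ξ))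
    rw [← integral_conj, ← integral_conj] at h1
    simpa only [map_mul, conj_character, neg_neg] using h1
  have hm := fun ξ : ι → ℝ => (continuous_character ξ).measurable
  have hb : ∀ ξ l : ι → ℝ, ‖character ξ l‖ ≤ 1 := fun ξ l => (norm_character ξ l).le
  have hre : ∫ l, F l * ((g l).re : ℂ) ∂σ = ∫ l, F l ∂μ := by
    refine integral_eq_of_character_real (Complex.measurable_re.comp hgm) hg.re (fun ξ => ?_) hF hC
    have e : ∀ l, character ξ l * ((g l).re : ℂ) =
        (character ξ l * g l + character ξ l * (starRingEnd ℂ) (g l)) / 2 := by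
      intro l
      rw [Complex.re_eq_add_conj]; ring
    simp only [Function.comp_apply, e]
    rw [integral_div, integral_add (hint (hm ξ) (hb ξ) hg) (hint (hm ξ) (hb ξ) hgc), h, hconj]
    ring
  have him : ∫ l, F l * ((g l).im : ℂ) ∂σ = ∫ l, F l ∂(0 : Measure (ι → ℝ)) := by
    refine integral_eq_of_character_real (Complex.measurable_im.comp hgm) hg.im (fun ξ => ?_) hF hC
    have e : ∀ l, character ξ l * ((g l).im : ℂ) =
        (character ξ l * g l - character ξ l * (starRingEnd ℂ) (g l)) / (2 * Complex.I) := by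
      intro l
      rw [Complex.im_eq_sub_conj]; ring
    simp only [Function.comp_apply, e]
    rw [integral_div, integral_sub (hint (hm ξ) (hb ξ) hg) (hint (hm ξ) (hb ξ) hgc), h, hconj]
    simp
  have e : ∀ l, F l * g l = F l * ((g l).re : ℂ) + F l * ((g l).im : ℂ) * Complex.I := by
    intro l
    conv_lhs => rw [← Complex.re_add_im (g l)]
    ring
  simp only [e]
  have h1 : Integrable (fun l => F l * ((g l).re : ℂ)) σ := hint hF hC hg.re.ofReal
  have h2 : Integrable (fun l => F l * ((g l).im : ℂ) * Complex.I) σ :=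
    (hint hF hC hg.im.ofReal).mul_const _
  rw [integral_add h1 h2, integral_mul_const, hre]
  have him' : ∫ l, F l * ((g l).im : ℂ) ∂σ = 0 := by rw [him]; simp
  rw [him', zero_mul, add_zero]

end Uniqueness

/-! ### The law of the local times on the covering event, and its density. -/

section Assembly

variable {Λ Ω : Type*} [Countable Λ] [DecidableEq Λ] [MeasurableSpace Ω] {p : ℝ≥0 → Λ → Λ → ℝ}
  {P : Measure Ω} [IsProbabilityMeasure P] {X : ℝ≥0 → Ω → Λ} {R : Finset Λ}

/-- The vector of the local times in the points of `R`. -/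
noncomputable def localTimes (X : ℝ≥0 → Ω → Λ) (T : ℝ≥0) (R : Finset Λ) (ω : Ω) : R → ℝ :=
  fun x => localTime X T ω x

lemma localTime_eq_zero {T : ℝ≥0} {ω : Ω} {x : Λ} (h : ∀ s ≤ T, X s ω ≠ x) :
    localTime X T ω x = 0 := by
  refine (intervalIntegral.integral_congr (g := fun _ => (0 : ℝ)) fun s hs => ?_).trans (by simp)
  rw [Set.uIcc_of_le T.coe_nonneg] at hs
  have hsT : s.toNNReal ≤ T := by simpa using Real.toNNReal_le_toNNReal hs.2
  have hs' : s ∉ {s : ℝ | X s.toNNReal ω = x} := h _ hsT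
  exact Set.indicator_of_notMem hs' _

lemma norm_indicator_one_le {α : Type*} (s : Set α) (x : α) :
    ‖s.indicator (fun _ => (1 : ℂ)) x‖ ≤ 1 :=
  (norm_indicator_le_norm_self _ x).trans norm_one.le

lemma IsMarkovChainFrom.aemeasurable_localTimes {a : Λ} (hX : IsMarkovChainFrom p a P X) {T : ℝ≥0}
    (hT : 0 < T) (R : Finset Λ) : AEMeasurable (localTimes X T R) P := by
  refine aemeasurable_pi_lambda _ fun x => ?_
  refine aemeasurable_of_tendsto_metrizable_ae atTop
    (f := fun n ω => approxLocalTime X T n ω x) (fun n => ?_) ?_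
  · refine Measurable.aemeasurable ?_
    refine Finset.measurable_sum _ fun k _ => Measurable.const_mul ?_ _
    exact hX.measurable_comp (Set.indicator {(x : Λ)} fun _ => (1 : ℝ)) _
  · filter_upwards [hX.right_continuous] with ω hω
    exact tendsto_approxLocalTime hω hT (x : Λ)

/-- Staying in a set constrains uncountably many times. Its indicator is nevertheless an almost sure
limit of products of weights at grid times, with `v = 0`. -/
lemma IsMarkovChainFrom.aemeasurable_stayEvent {a : Λ} (hX : IsMarkovChainFrom p a P X) {T : ℝ≥0}
    (hT : 0 < T) {ι : Type*} [Fintype ι] [DecidableEq ι] {j : ι → Λ} (hj : Function.Injective j) :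
    AEMeasurable ((stayEvent X T j).indicator fun _ => (1 : ℂ)) P := by
  refine aemeasurable_of_tendsto_metrizable_ae atTop (f := fun n ω =>
    ∏ k ∈ Finset.range n, expWeight j 0 (T / n) (X (((k + 1 : ℕ) : ℝ≥0) * (T / n)) ω))
    (fun n => ?_) ?_
  · exact (Finset.measurable_prod _ fun k _ =>
      hX.measurable_comp (expWeight j 0 (T / n)) _).aemeasurable
  · filter_upwards [hX.right_continuous] with ω hω
    simpa using tendsto_prod_expWeight hω hT hj 0

/-- The event that the chain stays in the subset `S` of `R` up to time `T`. -/
def staySubset (X : ℝ≥0 → Ω → Λ) (T : ℝ≥0) (S : Finset R) : Set Ω :=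
  stayEvent X T fun x : S => ((x : R) : Λ)

lemma injective_val_val (S : Finset R) : Function.Injective fun x : S => ((x : R) : Λ) :=
  Subtype.val_injective.comp Subtype.val_injective

lemma mem_staySubset {T : ℝ≥0} {S : Finset R} {ω : Ω} :
    ω ∈ staySubset X T S ↔ ∀ s ≤ T, ∃ x ∈ S, (x : Λ) = X s ω := by
  simp only [staySubset, stayEvent, Set.mem_ofPred_eq, Set.mem_range]
  refine forall₂_congr fun s _ => ⟨?_, ?_⟩
  · rintro ⟨x, hx⟩
    exact ⟨x, x.2, hx⟩
  · rintro ⟨x, hxS, hx⟩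
    exact ⟨⟨x, hxS⟩, hx⟩

/-- Inclusion–exclusion for the set `U` of visited sites: the path stays in `S` precisely when `U ⊆
S`. A path that leaves `R` contributes to no `S`. -/
lemma sum_staySubset (T : ℝ≥0) (R : Finset Λ) (ω : Ω) :
    ∑ S : Finset R, (-1 : ℂ) ^ Sᶜ.card * (staySubset X T S).indicator (fun _ => (1 : ℂ)) ω =
      Set.indicator {ω | chainRange X T ω = (R : Set Λ)} (fun _ => (1 : ℂ)) ω := by
  classical
  by_cases hR : chainRange X T ω ⊆ R
  · let U : Finset R := Finset.univ.filter fun x => (x : Λ) ∈ chainRange X T ω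
    have hstay : ∀ S : Finset R, ω ∈ staySubset X T S ↔ U ⊆ S := by
      intro S
      rw [mem_staySubset]
      constructor
      · intro h x hx
        obtain ⟨s, hs, hsx⟩ := (Finset.mem_filter.1 hx).2
        obtain ⟨y, hyS, hy⟩ := h s hs.2
        rwa [Subtype.ext (hsx.symm.trans hy.symm : (x : Λ) = y)]
      · intro h s hs
        have hmem : X s ω ∈ chainRange X T ω := ⟨s, ⟨zero_le, hs⟩, rfl⟩
        exact ⟨⟨X s ω, hR hmem⟩, h (Finset.mem_filter.2 ⟨Finset.mem_univ _, hmem⟩), rfl⟩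
    have hU : chainRange X T ω = (R : Set Λ) ↔ U = Finset.univ := by
      rw [Finset.filter_eq_self]
      constructor
      · intro h x _
        rw [h]
        exact x.2
      · exact fun h => hR.antisymm fun x hx => h ⟨x, hx⟩ (Finset.mem_univ _)
    have := sum_neg_one_pow_compl (K := ℂ) U
    simp only [Set.indicator_apply, Set.mem_ofPred_eq, hstay, hU]
    exact this
  · have hne : ω ∉ {ω | chainRange X T ω = (R : Set Λ)} := fun h => hR (le_of_eq h)
    rw [Set.indicator_of_notMem hne]
    refine Finset.sum_eq_zero fun S _ => ?_
    rw [Set.indicator_of_notMem, mul_zero]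
    intro h
    refine hR ?_
    rintro _ ⟨s, hs, rfl⟩
    obtain ⟨y, _, hy⟩ := mem_staySubset.1 h s hs.2
    simp only [← hy, Finset.mem_coe, y.2]

/-- Sites outside `S` are never visited and have zero local time, so the tilt over `R` reduces to
one over `S`. -/
lemma expTilt_localTimes_of_stay {T : ℝ≥0} {S : Finset R} {ω : Ω} (h : ω ∈ staySubset X T S)
    (v : R → ℂ) : expTilt v (localTimes X T R ω) =
      Complex.exp (-∑ x : S, v x * (localTime X T ω ((x : R) : Λ) : ℂ)) := by
  unfold expTilt localTimes
  rw [Finset.sum_coe_sort S (fun x : R => v x * (localTime X T ω x : ℂ))]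
  congr 2
  refine (Finset.sum_subset (Finset.subset_univ S) fun x _ hx => ?_).symm
  rw [localTime_eq_zero fun s hs hsx => ?_, Complex.ofReal_zero, mul_zero]
  obtain ⟨y, hyS, hy⟩ := mem_staySubset.1 h s hs
  exact hx (Subtype.ext (hsx.symm.trans hy.symm : (x : Λ) = y) ▸ hyS)

/-- Feynman–Kac on `S` if both endpoints lie in `S`. Otherwise almost no path from `a` to `b` stays
in `S`, which matches the zero default of `restrictedPow`. -/
lemma IsMarkovChainFrom.hasSum_restrictedPow {A : Λ → Λ → ℝ} {a : R}
    (hX : IsMarkovChainFrom p a P X) (hp : IsTransitionFunction p) (hpA : HasGenerator p A)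
    {T : ℝ≥0} (hT : 0 < T) (v : R → ℂ) (b : R) (S : Finset R) :
    HasSum (fun N : ℕ => restrictedPow (Matrix.of (fun x y : R => (A x y : ℂ)) - Matrix.diagonal v)
        S N a b * ((T : ℂ) ^ N / N.factorial))
      (∫ ω, (staySubset X T S).indicator (fun _ => (1 : ℂ)) ω *
        expTilt v (localTimes X T R ω) *
        Set.indicator {ω | X T ω = b} (fun _ => (1 : ℂ)) ω ∂P) := by
  by_cases hS : a ∈ S ∧ b ∈ S
  · have h := hX.hasSum_feynmanKac hp hpA hT (injective_val_val S) (fun x => v x)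
      ⟨a, hS.1⟩ ⟨b, hS.2⟩ rfl
    have hM : Matrix.of (fun γ δ : S => (A ((γ : R) : Λ) ((δ : R) : Λ) : ℂ)) -
        Matrix.diagonal (fun x : S => v x) =
        (Matrix.of (fun x y : R => (A x y : ℂ)) - Matrix.diagonal v).submatrix
          Subtype.val Subtype.val := by
      ext x y
      simp only [Matrix.sub_apply, Matrix.submatrix_apply, Matrix.of_apply, Matrix.diagonal_apply,
        Subtype.val_inj]
    rw [hM] at h
    convert h using 1
    · funext N
      rw [restrictedPow, dif_pos hS, smul_pow, Matrix.smul_apply, smul_eq_mul]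
      ring
    · refine integral_congr_ae (ae_of_all _ fun ω => ?_)
      simp only
      by_cases hω : ω ∈ staySubset X T S
      · rw [expTilt_localTimes_of_stay hω]
        rfl
      · have hω' : ω ∉ stayEvent X T fun x : S => ((x : R) : Λ) := hω
        rw [Set.indicator_of_notMem hω, Set.indicator_of_notMem hω']
        simp
  · have h0 : ∀ᵐ ω ∂P, (staySubset X T S).indicator (fun _ => (1 : ℂ)) ω *
        expTilt v (localTimes X T R ω) *
        Set.indicator {ω | X T ω = b} (fun _ => (1 : ℂ)) ω = 0 := by
      filter_upwards [hX.ae_zero_eq] with ω hω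
      by_cases hs : ω ∈ staySubset X T S
      · have hs' := mem_staySubset.1 hs
        obtain ⟨x, hxS, hx⟩ := hs' 0 zero_le
        have haS : a ∈ S := Subtype.ext (hx.trans hω) ▸ hxS
        rw [Set.indicator_of_notMem (s := {ω | X T ω = b}), mul_zero]
        intro hb
        obtain ⟨y, hyS, hy⟩ := hs' T le_rfl
        exact hS ⟨haS, Subtype.ext (hy.trans hb) ▸ hyS⟩
      · rw [Set.indicator_of_notMem hs, zero_mul, zero_mul]
    rw [integral_congr_ae h0, integral_zero]
    simp only [restrictedPow, dif_neg hS, zero_mul]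
    exact hasSum_zero

/-- The event that the chain ends in `b` and visits exactly the points of `R` up to time `T`. -/
def coverEvent (X : ℝ≥0 → Ω → Λ) (T : ℝ≥0) (R : Finset Λ) (b : Λ) : Set Ω :=
  {ω | X T ω = b} ∩ {ω | chainRange X T ω = (R : Set Λ)}

lemma indicator_coverEvent (T : ℝ≥0) (R : Finset Λ) (b : Λ) (ω : Ω) :
    (coverEvent X T R b).indicator (fun _ => (1 : ℂ)) ω =
      ∑ S : Finset R, (-1 : ℂ) ^ Sᶜ.card * ((staySubset X T S).indicator (fun _ => (1 : ℂ)) ω *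
        Set.indicator {ω | X T ω = b} (fun _ => (1 : ℂ)) ω) := by
  simp only [← mul_assoc]
  rw [← Finset.sum_mul, sum_staySubset, mul_comm]
  rw [coverEvent, ← Set.inter_indicator_mul, mul_one]

lemma IsMarkovChainFrom.aemeasurable_staySubset_mul {a : Λ} (hX : IsMarkovChainFrom p a P X)
    {T : ℝ≥0} (hT : 0 < T) (S : Finset R) (b : Λ) :
    AEMeasurable (fun ω => (staySubset X T S).indicator (fun _ => (1 : ℂ)) ω *
      Set.indicator {ω | X T ω = b} (fun _ => (1 : ℂ)) ω) P :=
  (hX.aemeasurable_stayEvent hT (injective_val_val S)).mul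
    (measurable_const.indicator (hX.measurable T b)).aemeasurable

lemma IsMarkovChainFrom.nullMeasurableSet_coverEvent {a : Λ} (hX : IsMarkovChainFrom p a P X)
    {T : ℝ≥0} (hT : 0 < T) (R : Finset Λ) (b : Λ) :
    NullMeasurableSet (coverEvent X T R b) P := by
  have h : AEMeasurable ((coverEvent X T R b).indicator fun _ => (1 : ℂ)) P := by
    simp only [funext (indicator_coverEvent (X := X) T R b)]
    exact Finset.aemeasurable_fun_sum _ fun S _ =>
      (hX.aemeasurable_staySubset_mul hT S b).const_mul _
  exact (aemeasurable_indicator_const_iff (1 : ℂ)).1 h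

lemma expTilt_neg_I_mul (ξ l : R → ℝ) : expTilt (fun x => -(Complex.I * ξ x)) l =
    character ξ l := by
  unfold expTilt character
  congr 1
  simp only [Complex.ofReal_sum, Complex.ofReal_mul, Finset.mul_sum, ← Finset.sum_neg_distrib]
  exact Finset.sum_congr rfl fun x _ => by ring

/-- The law of the local times on the event that the chain ends in `b` and visits exactly the
points of `R`. -/
noncomputable def localTimesLaw (P : Measure Ω) (X : ℝ≥0 → Ω → Λ) (T : ℝ≥0) (R : Finset Λ)
    (b : Λ) : Measure (R → ℝ) :=
  (P.restrict (coverEvent X T R b)).map (localTimes X T R)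

lemma IsMarkovChainFrom.integral_localTimesLaw {a : Λ} (hX : IsMarkovChainFrom p a P X)
    {T : ℝ≥0} (hT : 0 < T) (R : Finset Λ) (b : Λ) {F : (R → ℝ) → ℂ} (hF : Measurable F) :
    ∫ l, F l ∂(localTimesLaw P X T R b) = ∫ ω, F (localTimes X T R ω) *
      (coverEvent X T R b).indicator (fun _ => (1 : ℂ)) ω ∂P := by
  rw [localTimesLaw, integral_map (hX.aemeasurable_localTimes hT R).restrict
    hF.aestronglyMeasurable, ← integral_indicator₀ (hX.nullMeasurableSet_coverEvent hT R b)]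
  refine integral_congr_ae (ae_of_all _ fun ω => ?_)
  by_cases hω : ω ∈ coverEvent X T R b <;> simp [hω]

/-- The alternating sum over `S` of Feynman–Kac formulas, with `v = -iξ` so that the tilt is a
character. -/
lemma IsMarkovChainFrom.hasSum_coveringPow {A : Λ → Λ → ℝ} {a : R}
    (hX : IsMarkovChainFrom p a P X) (hp : IsTransitionFunction p) (hpA : HasGenerator p A)
    {T : ℝ≥0} (hT : 0 < T) (ξ : R → ℝ) (b : R) :
    HasSum (fun N : ℕ => coveringPow (Matrix.of (fun x y : R => (A x y : ℂ)) -
        Matrix.diagonal fun x => -(Complex.I * ξ x)) N a b * ((T : ℂ) ^ N / N.factorial))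
      (∫ l, character ξ l ∂(localTimesLaw P X T R b)) := by
  rw [hX.integral_localTimesLaw hT R b (continuous_character ξ).measurable]
  have hint : ∀ S : Finset R, Integrable (fun ω => (staySubset X T S).indicator (fun _ => (1 : ℂ)) ω *
      expTilt (fun x => -(Complex.I * ξ x)) (localTimes X T R ω) *
      Set.indicator {ω | X T ω = b} (fun _ => (1 : ℂ)) ω) P := by
    intro S
    have hm : AEMeasurable (fun ω => character ξ (localTimes X T R ω)) P :=
      (continuous_character ξ).measurable.comp_aemeasurable (hX.aemeasurable_localTimes hT R)
    refine Integrable.of_bound (C := 1) ?_ (ae_of_all _ fun ω => ?_)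
    · simp only [expTilt_neg_I_mul, mul_right_comm _ (character ξ _)]
      exact ((hX.aemeasurable_staySubset_mul hT S b).mul hm).aestronglyMeasurable
    · rw [expTilt_neg_I_mul, norm_mul, norm_mul, norm_character, mul_one]
      exact mul_le_one₀ (norm_indicator_one_le _ _) (norm_nonneg _) (norm_indicator_one_le _ _)
  have h := hasSum_sum (s := (Finset.univ : Finset (Finset R))) fun S _ =>
    (hX.hasSum_restrictedPow hp hpA hT (fun x => -(Complex.I * ξ x)) b S).mul_left
      ((-1 : ℂ) ^ Sᶜ.card)
  have hval : ∫ ω, character ξ (localTimes X T R ω) *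
      (coverEvent X T R b).indicator (fun _ => (1 : ℂ)) ω ∂P =
      ∑ S : Finset R, (-1 : ℂ) ^ Sᶜ.card * ∫ ω, (staySubset X T S).indicator (fun _ => (1 : ℂ)) ω *
        expTilt (fun x => -(Complex.I * ξ x)) (localTimes X T R ω) *
        Set.indicator {ω | X T ω = b} (fun _ => (1 : ℂ)) ω ∂P := by
    simp only [← integral_const_mul]
    rw [← integral_finsetSum _ fun S _ => (hint S).const_mul _]
    refine integral_congr_ae (ae_of_all _ fun ω => ?_)
    simp only [expTilt_neg_I_mul, indicator_coverEvent, Finset.mul_sum]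
    exact Finset.sum_congr rfl fun S _ => by ring
  rw [hval]
  simpa only [coveringPow, Finset.sum_mul, mul_assoc] using h

/-- The law of the local times has the density `ρ_{ab}`. -/
theorem IsMarkovChainFrom.integral_density {A : Λ → Λ → ℝ} {a : R}
    (hX : IsMarkovChainFrom p a P X) (hp : IsTransitionFunction p) (hpA : HasGenerator p A)
    {T : ℝ≥0} (hT : 0 < T) (b : R) {F : (R → ℝ) → ℂ} (hF : Measurable F) {C : ℝ}
    (hC : ∀ l, ‖F l‖ ≤ C) :
    ∫ l, F l * density (fun x y : R => A x y) a b l ∂(surfaceMeasure a T) =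
      ∫ l, F l ∂(localTimesLaw P X T R b) := by
  have hT' : (0 : ℝ) < T := by exact_mod_cast hT
  set M : Matrix R R ℂ := Matrix.of fun x y : R => (A x y : ℂ) with hM
  have hcont : Continuous (expTransform (densityFunctional M a b)) :=
    (geomBounded_densityFunctional M a b).continuous
  have hfin : IsFiniteMeasure (localTimesLaw P X T R b) := by
    unfold localTimesLaw
    infer_instance
  rw [← integral_eq_of_character (μ := localTimesLaw P X T R b) hcont.measurable
    (integrable_surfaceMeasure_of_continuous a hT' hcont) (fun ξ => ?_) hF hC]
  · refine integral_congr_ae ?_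
    filter_upwards [ae_mem_simplex a (T : ℝ)] with l hl
    rw [density_eqOn _ a b hl.1]
  -- For `A - diag v` with `v = -iξ`, the same series sums to the characteristic function of the law
  -- and to the total mass of the tilted density.
  · have h1 := hX.hasSum_coveringPow hp hpA hT ξ b
    have h2 := hasSum_integral_densityFunctional
      (M - Matrix.diagonal fun x => -(Complex.I * ξ x)) a b a hT'
    rw [← h2.unique h1]
    refine integral_congr_ae ?_
    filter_upwards [ae_mem_simplex a (T : ℝ)] with l hl
    rw [expTransform_densityFunctional_sub_diagonal M _ a b hl.1, expTilt_neg_I_mul]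

end Assembly

end LocalTimeDensity

/-! ### The theorem. -/

open LocalTimeDensity
theorem theorem2p1 {Λ : Type*} [Countable Λ] [Nontrivial Λ] [DecidableEq Λ]
    (A : Λ → Λ → ℝ) (hA : IsConservative A)
    (p : ℝ≥0 → Λ → Λ → ℝ) (hp : IsTransitionFunction p) (hpA : HasGenerator p A)
    (R : Finset Λ) (a b : R)
    {Ω : Type*} [MeasurableSpace Ω] (P : Measure Ω) [IsProbabilityMeasure P]
    (X : ℝ≥0 → Ω → Λ) (hX : IsMarkovChainFrom p a P X) :
    -- the derivatives in the definition of the density exist in the classical sense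
    ContDiffOn ℝ (⊤ : ℕ∞) (torusIntegral fun x y : R => A x y) (orthant R) ∧
    ∀ T : ℝ≥0, 0 < T →
      Integrable (density (fun x y : R => A x y) a b) (surfaceMeasure a T) ∧
      ∀ F : (R → ℝ) → ℝ, Measurable F → (∃ C, ∀ l ∈ simplex R T, |F l| ≤ C) →
        ((∫ ω, F (fun x : R => localTime X T ω x) *
            Set.indicator {ω | X T ω = b} (fun _ => (1 : ℝ)) ω *
            Set.indicator {ω | chainRange X T ω = (R : Set Λ)} (fun _ => (1 : ℝ)) ω ∂P : ℝ) : ℂ) =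
          ∫ l, (F l : ℂ) * density (fun x y : R => A x y) a b l ∂(surfaceMeasure a T) := by
  refine ⟨?_, fun T hT => ⟨?_, fun F hF hbound => ?_⟩⟩
  · exact (geomBounded_macMahonFunctional _).contDiff.contDiffOn.congr fun l hl =>
      torusIntegral_eq_expTransform _ fun x => (hl x).le
  · refine (integrable_surfaceMeasure_of_continuous a (by exact_mod_cast hT)
      (geomBounded_densityFunctional (Matrix.of fun x y : R => (A x y : ℂ)) a b).continuous).congr ?_
    filter_upwards [ae_mem_simplex a (T : ℝ)] with l hl
    rw [density_eqOn _ a b hl.1]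
  · obtain ⟨C, hC⟩ := hbound
    set Δ := simplex R (T : ℝ)
    have hΔ : MeasurableSet Δ := measurableSet_simplex _
    set μ := localTimesLaw P X T R b with hμ
    have hfin : IsFiniteMeasure μ := by
      rw [hμ, localTimesLaw]
      infer_instance
    -- That the local times on the covering event are positive and sum to `T` is read off from the
    -- density formula, applied to the indicator of the complement of the simplex; no path argument
    -- is needed.
    have hsupp : ∀ᵐ l ∂μ, l ∈ Δ := by
      have h := hX.integral_density hp hpA hT b
        (F := Δᶜ.indicator fun _ => (1 : ℂ)) (measurable_const.indicator hΔ.compl) (C := 1)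
        (norm_indicator_one_le _)
      rw [integral_indicator_const _ hΔ.compl, integral_congr_ae (g := fun _ => (0 : ℂ))
        (by
          filter_upwards [ae_mem_simplex a (T : ℝ)] with l hl
          have hl' : l ∉ Δᶜ := fun h => h hl
          rw [Set.indicator_of_notMem hl', zero_mul])] at h
      have h' : μ.real Δᶜ = 0 := by simpa using h.symm
      rw [ae_iff]
      exact (measureReal_eq_zero_iff).1 h'
    -- `F` is bounded on the simplex only, so the density formula is applied to its truncation. Both
    -- measures live on the simplex, and the truncation changes neither integral.
    have hG : Measurable (Δ.indicator fun l => (F l : ℂ)) :=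
      (Complex.measurable_ofReal.comp hF).indicator hΔ
    have h := hX.integral_density hp hpA hT b hG (C := max C 0) fun l => by
      by_cases hl : l ∈ Δ
      · rw [Set.indicator_of_mem hl, Complex.norm_real]
        exact (hC l hl).trans (le_max_left _ _)
      · rw [Set.indicator_of_notMem hl, norm_zero]
        exact le_max_right _ _
    have e1 : ∫ l, (F l : ℂ) * density (fun x y : R => A x y) a b l ∂(surfaceMeasure a T) =
        ∫ l, Δ.indicator (fun l => (F l : ℂ)) l * density (fun x y : R => A x y) a b l
          ∂(surfaceMeasure a T) := by
      refine integral_congr_ae ?_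
      filter_upwards [ae_mem_simplex a (T : ℝ)] with l hl
      rw [Set.indicator_of_mem hl]
    have e2 : ∫ l, Δ.indicator (fun l => (F l : ℂ)) l ∂μ = ∫ l, (F l : ℂ) ∂μ := by
      refine integral_congr_ae ?_
      filter_upwards [hsupp] with l hl
      rw [Set.indicator_of_mem hl]
    have e3 := hX.integral_localTimesLaw hT R b (F := fun l => (F l : ℂ))
      (Complex.measurable_ofReal.comp hF)
    rw [e1, h, e2, e3, ← integral_complex_ofReal]
    refine integral_congr_ae (ae_of_all _ fun ω => ?_)
    by_cases h1 : X T ω = b <;> by_cases h2 : chainRange X T ω = (R : Set Λ) <;>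
      simp [coverEvent, h1, h2]
    rfl
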